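/- **Setting.** Let $S$ be an infinite set of sites with a connected graph on it (the infinite lattice, graph distance $\mathrm{dist}$), and let $\Lambda=\Lambda_n$ ($n=1,2,\dots$) be a sequence of finite connected graphs (finite lattices, with arbitrary boundary conditions) whose site sets are subsets of $S$, such that every site of $S$ lies in $\Lambda_n$ for all large $n$ and $\mathrm{dist}_{\Lambda_n}(x,y)=\mathrm{dist}(x,y)$ for all large $n$, for each pair $x,y\in S$. To each site belongs a finite-dimensional Hilbert space, and to each finite volume the tensor product of these spaces (spin systems) or the fermionic Fock space (lattice fermion systems). The Hamiltonian is $H_\Lambda=\sum_{X\subset\Lambda}h_X$ with self-adjoint $h_X$ supported in $X$ (and even in the fermion operators in the fermionic case); $h_X$ may depend on $\Lambda$. All bounds below are uniform in $\Lambda$ and in the sites $x,y\in\Lambda$, and $\mathrm{dist}$, $\mathrm{diam}$ are those of $\Lambda$. The interaction decays in one of the following ways, with positive constants; each time $v_0$ denotes the indicated number. * Power law with exponent $\eta>0$: either (P1) $\sum_{X\ni x,y}\|h_X\|\le\lambda_0[1+\mathrm{dist}(x,y)]^{-\eta}$ and $\sum_{z}[1+\mathrm{dist}(x,z)]^{-\eta}[1+\mathrm{dist}(z,y)]^{-\eta}\le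 p_0[1+\mathrm{dist}(x,y)]^{-\eta}$, with $v_0=2\lambda_0p_0$; or (P2) $\sum_{X\ni x}\|h_X\|\,|X|\,[1+\mathrm{diam}(X)]^{\eta}\le s_1$, with $v_0=2s_1$. * Exponential with rate $\mu>0$: either (E1) $\sum_{X\ni x,y}\|h_X\|\le\lambda_0e^{-(\mu+\varepsilon)\mathrm{dist}(x,y)}$ and $\sum_y[1+\mathrm{dist}(x,y)]^{-\eta}\le\sigma$ for some $\varepsilon,\eta>0$, with $v_0=2\lambda_0\lambda_0'p_0$, $\lambda_0'=\sup_{r\in\mathbb N}e^{-\varepsilon r}(1+r)^{\eta}$, $p_0=2^{\eta+1}\sigma$; or (E2) $\sum_{X\ni x}\|h_X\|\,|X|\,e^{\mu\,\mathrm{diam}(X)}\le s_1$, with $v_0=2s_1$. Put $g(r)=(1+r)^{-\eta}$ in the power-law case and $g(r)=e^{-\mu r}$ in the exponential case. An observable $A_X$ with compact support is an operator of a finite volume $X\subset S$, regarded as an operator of every $\Lambda\supset X$. A pair $A_X,B_Y$ is *bosonic* if $[A_X,B_Y]=0$ whenever $X\cap Y=\emptyset$. A number $v>0$ is called an *upper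 bound of the group velocity* if there is $C'>0$ such that for all $\Lambda$, all bosonic pairs $A_X,B_Y$ in $\Lambda$ with $\mathrm{dist}(X,Y)>0$ and all $t\in\mathbb R$, with $A_X(t)=e^{itH_\Lambda}A_Xe^{-itH_\Lambda}$, $$\|[A_X(t),B_Y]\|\le C'\|A_X\|\,\|B_Y\|\,|X|\,|Y|\,g(\mathrm{dist}(X,Y))\,(e^{v|t|}-1).$$ *Uniform gap.* There are $q\ge1$ and $\Delta E>0$ such that, for all large $n$, the $q$ lowest eigenvalues of $H_{\Lambda_n}$ (counted with multiplicity) form a ground state sector whose width $\max_{\nu,\nu'}|E_{0,\nu}-E_{0,\nu'}|$ tends to $0$ as $n\to\infty$, and every other eigenvalue exceeds every eigenvalue of the sector by more than $\Delta E$. Let $P_{0,\Lambda}$ be the spectral projection onto the sector. Let $\langle A\rangle_0=\lim_n\frac1q\mathrm{Tr}(A\,P_{0,\Lambda_n})$ and $\omega(A)=\lim_n\langle\Phi_{\Lambda_n},A\,\Phi_{\Lambda_n}\rangle$ with normalized vectors $\Phi_{\Lambda_n}$ in the sector, the limits being assumed to exist for all observables $A$ of compact support (pass to a subsequence of lattices).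 *Self-similarity.* A transformation $R$ is a family of linear or antilinear ring automorphisms of the operator algebras of the lattices $\Lambda_n$; $R(A)=B$ and $R(H_\Lambda)=H_\Lambda$ mean that this holds for all large $n$. Let $m=q^2$. For every observable $A$ with compact support there is $k$ such that for every $L>0$ there are transformations $R_1,\dots,R_m$ in a given set $\mathcal T$ of transformations, and observables $B^{(1)},\dots,B^{(m)}$ with compact support, such that $R_j(H_\Lambda)=H_\Lambda$, $B^{(j)}=R_j(A)$, $(B^{(j)})^\dagger=R_j(A^\dagger)$, $|\mathrm{supp}\,B^{(j)}|\le k$, $\mathrm{dist}(\mathrm{supp}\,A,\mathrm{supp}\,B^{(j)})\ge L$ for all $j$, and $\mathrm{dist}(\mathrm{supp}\,B^{(i)},\mathrm{supp}\,B^{(j)})\ge L$ for all $i\ne j$. **Theorem.** (a) $v_0$ is an upper bound of the group velocity. (b) Let $v$ be any upper bound of the group velocity (for example $v_0$) and assume a uniform gap with $q$ and $\Delta E$. Put $$\tilde\eta=\frac{\eta}{1+2v/\Delta E},\qquad \tilde\mu=\frac{\mu}{1+2v/\Delta E}.$$ Then there is a constant $C>0$ (which does not depend on $\mathcal T,\mathcal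 A_b^s,\omega,A_X,B_Y$ below) with the following property. Assume self-similarity with transformations from a set $\mathcal T$, and let $\mathcal A_b^s$ be a set of observables with compact support, every two of which form a bosonic pair, such that $R(\mathcal A_b^s)\subset\mathcal A_b^s=(\mathcal A_b^s)^\dagger$ for $R\in\mathcal T$, and such that $\langle A'_XB'_Y\rangle_0\to0$ as $\mathrm{dist}(X,Y)\to\infty$ for $A'_X,B'_Y\in\mathcal A_b^s$, uniformly as long as $|X|,|Y|,\|A'_X\|,\|B'_Y\|$ stay bounded. Then for every $\omega$ as above, every $A_X\in\mathcal A_b^s$ and every observable $B_Y$ with compact support such that the pair $A_X,B_Y$ is bosonic, $$|\omega(A_XB_Y)|\le C\,\|A_X\|\,\|B_Y\|\,|X|\,|Y|\times\begin{cases}[1+\mathrm{dist}(X,Y)]^{-\tilde\eta}&\text{for power-law decaying }h_X,\\ \exp[-\tilde\mu\,\mathrm{dist}(X,Y)]&\text{for exponentially decaying }h_X.\end{cases}$$ -/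

import Mathlib

open scoped Matrix.Norms.L2Operator
open Filter Topology

noncomputable section

/-- The local Hilbert spaces of a quantum lattice system: at the site `x` the space `ℂ ^ (dim x)`
with its standard basis, every basis vector carrying a fermion parity.

* A spin system has `par = 0`; the Hilbert space of a finite volume is then the tensor product.
* A lattice fermion system with `k` modes at the site `x` has `dim x = 2 ^ k`, the basis vectors
  being the occupation numbers of these modes and `par` the number of particles mod 2; the
  Hilbert space of a finite volume is then the Fock space in its occupation number basis, the
  modes being ordered by the order of the sites. -/
structure SiteSpaces (S : Type*) where
  dim : S → ℕ
  dim_pos : ∀ x, 0 < dim x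
  par : ∀ x, Fin (dim x) → ZMod 2

namespace SiteSpaces

variable {S : Type*} [LinearOrder S] (K : SiteSpaces S)

/-- The labels of the standard basis of the Hilbert space of the finite volume `Λ`. -/
abbrev Config (Λ : Finset S) : Type _ := ∀ x : Λ, Fin (K.dim x)

/-- The operators on the Hilbert space of the finite volume `Λ`, in the standard basis. -/
abbrev Op (Λ : Finset S) : Type _ := Matrix (K.Config Λ) (K.Config Λ) ℂ

/-- The sign `(-1) ^ a`. -/
def zsign (a : ZMod 2) : ℂ := if a = 0 then 1 else -1

/-- The Jordan–Wigner sign of the matrix element between `s` and `t` of an operator of `X`, seen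
as an operator of `Λ ⊇ X`: every odd site `y ∈ Λ \ X` contributes a factor `-1` for every site
`x > y` of `X` whose parity is changed. It is `1` for spin systems. -/
def jwSign (X Λ : Finset S) (s t : K.Config Λ) : ℂ :=
  ∏ y : Λ, ∏ x : Λ, if (y : S) ∉ X ∧ (x : S) ∈ X ∧ y < x then
    zsign (K.par y (s y) * (K.par x (s x) + K.par x (t x))) else 1

/-- The operator of the volume `Λ` given by an operator `M` of the subvolume `X`: it is `M ⊗ 1`
for spin systems, and the same polynomial in the creation and annihilation operators of the sites
of `X` as `M` for fermion systems. -/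
def embed {X Λ : Finset S} (h : X ⊆ Λ) (M : K.Op X) : K.Op Λ :=
  Matrix.of fun s t =>
    if ∀ y : Λ, (y : S) ∉ X → s y = t y then
      K.jwSign X Λ s t * M (fun x => s ⟨x, h x.2⟩) (fun x => t ⟨x, h x.2⟩)
    else 0

/-- Even operators: they preserve the total fermion parity. (No condition for spin systems.) -/
def IsEven {X : Finset S} (M : K.Op X) : Prop :=
  ∀ s t, (∑ x : X, K.par x (s x)) ≠ (∑ x : X, K.par x (t x)) → M s t = 0

theorem embed_conjTranspose {X Λ : Finset S} (h : X ⊆ Λ) (M : K.Op X) :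
    (K.embed h M).conjTranspose = K.embed h M.conjTranspose := by
  have hz : ∀ a : ZMod 2, star (zsign a) = zsign a := by
    intro a; unfold zsign; split_ifs <;> simp
  ext s t
  simp only [embed, Matrix.conjTranspose_apply, Matrix.of_apply]
  by_cases hst : ∀ y : Λ, (y : S) ∉ X → s y = t y
  · have hts : ∀ y : Λ, (y : S) ∉ X → t y = s y := fun y hy => (hst y hy).symm
    rw [if_pos hst, if_pos hts, star_mul', jwSign, jwSign, star_prod]
    congr 1
    refine Finset.prod_congr rfl fun y _ => ?_
    rw [star_prod]
    refine Finset.prod_congr rfl fun x _ => ?_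
    split_ifs with hc
    · rw [hz, hst y hc.1, add_comm]
    · simp
  · have hts : ¬ ∀ y : Λ, (y : S) ∉ X → t y = s y :=
      fun hc => hst fun y hy => (hc y hy).symm
    rw [if_neg hst, if_neg hts, star_zero]

/-- An observable with compact support: a finite set `supp` of sites together with an operator of
this volume. -/
structure LocalObs where
  supp : Finset S
  op : K.Op supp

namespace LocalObs

variable {K}

/-- The observable `A` as an operator of the volume `Λ ⊇ supp A`
(and `0` in the volumes that do not contain `supp A`). -/
def toOp (A : K.LocalObs) (Λ : Finset S) : K.Op Λ :=
  if h : A.supp ⊆ Λ then K.embed h A.op else 0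

/-- The product `A B`, an observable with support `supp A ∪ supp B`. -/
def mul (A B : K.LocalObs) : K.LocalObs :=
  ⟨A.supp ∪ B.supp, A.toOp (A.supp ∪ B.supp) * B.toOp (A.supp ∪ B.supp)⟩

/-- The adjoint `A†`. -/
def adj (A : K.LocalObs) : K.LocalObs := ⟨A.supp, A.op.conjTranspose⟩

/-- The pair `A, B` is bosonic: the two observables commute if their supports are disjoint. -/
def BosonicPair (A B : K.LocalObs) : Prop :=
  Disjoint A.supp B.supp →
    Commute (A.toOp (A.supp ∪ B.supp)) (B.toOp (A.supp ∪ B.supp))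

end LocalObs

end SiteSpaces

/-- `dist(X, Y) ≥ r` for the graph distance (with `dist(X, Y) = ∞` if `X` or `Y` is empty). -/
def FarApart {S : Type*} (G : SimpleGraph S) (r : ℕ) (X Y : Finset S) : Prop :=
  ∀ x ∈ X, ∀ y ∈ Y, r ≤ G.dist x y

/-- The diameter of a finite set for the graph distance. -/
def graphDiam {S : Type*} (G : SimpleGraph S) (X : Finset S) : ℕ :=
  (X ×ˢ X).sup fun p => G.dist p.1 p.2

/-- A sequence of finite lattices `Λ n`, going to an infinite lattice, with a Hamiltonian on each.

The infinite lattice has the set of sites `S` and the bonds of `G`. The finite lattice number `n`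
has the set of sites `sites n`, the bonds of `graph n` (boundary conditions are arbitrary) and the
Hamiltonian `∑ X ⊆ sites n, h n X`. In a fermion system the local Hamiltonians are even. -/
structure LatticeSystem (S : Type*) [LinearOrder S] where
  K : SiteSpaces S
  G : SimpleGraph S
  sites : ℕ → Finset S
  graph : ℕ → SimpleGraph S
  mem_of_adj : ∀ n x y, (graph n).Adj x y → x ∈ sites n ∧ y ∈ sites n
  reachable : ∀ n, ∀ x ∈ sites n, ∀ y ∈ sites n, (graph n).Reachable x y
  connected : G.Connected
  eventually_mem : ∀ x, ∀ᶠ n in atTop, x ∈ sites n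
  eventually_dist : ∀ x y, ∀ᶠ n in atTop, (graph n).dist x y = G.dist x y
  h : ∀ (_ : ℕ) (X : Finset S), K.Op X
  h_hermitian : ∀ n X, (h n X).IsHermitian
  h_even : ∀ n X, K.IsEven (h n X)

/-- The form of the decay of the interaction, and of the bounds on the correlations: a power law
`(1 + r) ^ (-η)`, or an exponential `exp (-μ r)`. -/
inductive DecayLaw where
  | power (η : ℝ)
  | exponential (μ : ℝ)

namespace DecayLaw

/-- The decaying function of the distance. -/
def profile : DecayLaw → ℕ → ℝ
  | power η, r => (1 + (r : ℝ)) ^ (-η)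
  | exponential μ, r => Real.exp (-μ * r)

/-- The same law with the exponents `η̃ = η / (1 + 2 v / ΔE)` and `μ̃ = μ / (1 + 2 v / ΔE)`. -/
def tilde (v ΔE : ℝ) : DecayLaw → DecayLaw
  | power η => power (η / (1 + 2 * v / ΔE))
  | exponential μ => exponential (μ / (1 + 2 * v / ΔE))

end DecayLaw

namespace LatticeSystem

open SiteSpaces

variable {S : Type*} [LinearOrder S] (Q : LatticeSystem S)

/-- The Hamiltonian of the finite lattice number `n`. -/
def H (n : ℕ) : Q.K.Op (Q.sites n) :=
  ∑ X ∈ (Q.sites n).powerset.attach, Q.K.embed (Finset.mem_powerset.1 X.2) (Q.h n X)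

theorem H_hermitian (n : ℕ) : (Q.H n).IsHermitian := by
  unfold H Matrix.IsHermitian
  rw [Matrix.conjTranspose_sum]
  refine Finset.sum_congr rfl fun X _ => ?_
  rw [embed_conjTranspose, (Q.h_hermitian n X).eq]

/-! ### Decay of the interaction -/

/-- Power-law decay, first form. -/
structure PowerDecay (η lam p : ℝ) : Prop where
  η_pos : 0 < η
  lam_pos : 0 < lam
  p_pos : 0 < p
  h_le : ∀ n, ∀ x ∈ Q.sites n, ∀ y ∈ Q.sites n,
    ∑ X ∈ (Q.sites n).powerset with x ∈ X ∧ y ∈ X, ‖Q.h n X‖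
      ≤ lam / (1 + ((Q.graph n).dist x y : ℝ)) ^ η
  lattice_le : ∀ n, ∀ x ∈ Q.sites n, ∀ y ∈ Q.sites n,
    ∑ z ∈ Q.sites n, 1 / (1 + ((Q.graph n).dist x z : ℝ)) ^ η
        * (1 / (1 + ((Q.graph n).dist z y : ℝ)) ^ η)
      ≤ p / (1 + ((Q.graph n).dist x y : ℝ)) ^ η

/-- Power-law decay, second form. -/
structure PowerDecaySum (η s : ℝ) : Prop where
  η_pos : 0 < η
  s_pos : 0 < s
  h_le : ∀ n, ∀ x ∈ Q.sites n,
    ∑ X ∈ (Q.sites n).powerset with x ∈ X,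
      ‖Q.h n X‖ * (X.card : ℝ) * (1 + (graphDiam (Q.graph n) X : ℝ)) ^ η ≤ s

/-- Exponential decay, first form. -/
structure ExpDecay (μ ε lam η σ : ℝ) : Prop where
  μ_pos : 0 < μ
  ε_pos : 0 < ε
  lam_pos : 0 < lam
  η_pos : 0 < η
  lattice_le : ∀ n, ∀ x ∈ Q.sites n,
    ∑ y ∈ Q.sites n, 1 / (1 + ((Q.graph n).dist x y : ℝ)) ^ η ≤ σ
  h_le : ∀ n, ∀ x ∈ Q.sites n, ∀ y ∈ Q.sites n,
    ∑ X ∈ (Q.sites n).powerset with x ∈ X ∧ y ∈ X, ‖Q.h n X‖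
      ≤ lam * Real.exp (-(μ + ε) * ((Q.graph n).dist x y : ℝ))

/-- Exponential decay, second form. -/
structure ExpDecaySum (μ s : ℝ) : Prop where
  μ_pos : 0 < μ
  s_pos : 0 < s
  h_le : ∀ n, ∀ x ∈ Q.sites n,
    ∑ X ∈ (Q.sites n).powerset with x ∈ X,
      ‖Q.h n X‖ * (X.card : ℝ) * Real.exp (μ * (graphDiam (Q.graph n) X : ℝ)) ≤ s

/-- The best constant `c` in `exp (-ε r) ≤ c (1 + r) ^ (-η)`. -/
def expPolyConst (ε η : ℝ) : ℝ := ⨆ r : ℕ, Real.exp (-ε * r) * (1 + (r : ℝ)) ^ η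

/-- The interaction satisfies one of the two power-law conditions, or one of the two exponential
conditions; `v` is the group velocity that belongs to the constants of the condition. -/
def InteractionDecay : DecayLaw → ℝ → Prop
  | .power η, v =>
      (∃ lam p, Q.PowerDecay η lam p ∧ v = 2 * lam * p) ∨
      (∃ s, Q.PowerDecaySum η s ∧ v = 2 * s)
  | .exponential μ, v =>
      (∃ ε lam η σ, Q.ExpDecay μ ε lam η σ ∧
        v = 2 * (lam * expPolyConst ε η) * (2 ^ (η + 1) * σ)) ∨
      (∃ s, Q.ExpDecaySum μ s ∧ v = 2 * s)

/-- The time evolution `M(t) = exp(i t H) M exp(-i t H)` in the finite lattice number `n`. -/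
def evolve (n : ℕ) (t : ℝ) (M : Q.K.Op (Q.sites n)) : Q.K.Op (Q.sites n) :=
  NormedSpace.exp ((t * Complex.I) • Q.H n) * M * NormedSpace.exp (-(t * Complex.I) • Q.H n)

/-- `v` is an upper bound of the group velocity of the information propagation, uniformly in the
volume: the Lieb–Robinson bound for the decay law `D` holds with the velocity `v`. -/
def IsVelocityBound (D : DecayLaw) (v : ℝ) : Prop :=
  0 < v ∧ ∃ C : ℝ, 0 < C ∧ ∀ (n : ℕ) (A B : Q.K.LocalObs),
    A.supp ⊆ Q.sites n → B.supp ⊆ Q.sites n → A.BosonicPair B →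
    ∀ r : ℕ, 0 < r → FarApart (Q.graph n) r A.supp B.supp → ∀ t : ℝ,
      ‖Q.evolve n t (A.toOp _) * B.toOp _ - B.toOp _ * Q.evolve n t (A.toOp _)‖
        ≤ C * ‖A.op‖ * ‖B.op‖ * (A.supp.card : ℝ) * (B.supp.card : ℝ)
          * D.profile r * (Real.exp (v * |t|) - 1)

/-! ### The ground state sector -/

/-- Uniform gap `ΔE` above a `q`-fold (quasi)degenerate ground state sector. The eigenvalues of the
Hamiltonian, counted with multiplicity, are indexed by the basis labels, and `I n` is the set of
the indices of the `q` eigenvalues of the sector, at the bottom of the spectrum. -/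
structure UniformGap (q : ℕ) (ΔE : ℝ) (I : ∀ n, Finset (Q.K.Config (Q.sites n))) : Prop where
  q_pos : 0 < q
  gap_pos : 0 < ΔE
  card_eq : ∀ᶠ n in atTop, (I n).card = q
  gap : ∀ᶠ n in atTop, ∀ i ∈ I n, ∀ j ∉ I n,
    (Q.H_hermitian n).eigenvalues i + ΔE < (Q.H_hermitian n).eigenvalues j
  width : ∀ δ : ℝ, 0 < δ → ∀ᶠ n in atTop, ∀ i ∈ I n, ∀ j ∈ I n,
    |(Q.H_hermitian n).eigenvalues i - (Q.H_hermitian n).eigenvalues j| ≤ δ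

/-- The orthogonal projection onto the span of the eigenvectors with indices in `J`. -/
def sectorProj (n : ℕ) (J : Finset (Q.K.Config (Q.sites n))) : Q.K.Op (Q.sites n) :=
  ∑ i ∈ J, Matrix.vecMulVec ((Q.H_hermitian n).eigenvectorBasis i).ofLp
    (star ((Q.H_hermitian n).eigenvectorBasis i).ofLp)

/-- `ρ` is the infinite-volume limit of the expectations `(1 / q) Tr (⋯) P₀` in the ground state
sector. -/
def IsSectorExpectation (q : ℕ) (I : ∀ n, Finset (Q.K.Config (Q.sites n)))
    (ρ : Q.K.LocalObs → ℂ) : Prop :=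
  ∀ A : Q.K.LocalObs, Tendsto
    (fun n => (1 / (q : ℂ)) * (A.toOp (Q.sites n) * Q.sectorProj n (I n)).trace) atTop (𝓝 (ρ A))

/-- `ω` is a ground-state expectation in the infinite volume: the limit of the expectations in
normalized vectors `Φ n` of the ground state sector. -/
def IsGroundStateExpectation (I : ∀ n, Finset (Q.K.Config (Q.sites n)))
    (ω : Q.K.LocalObs → ℂ) : Prop :=
  ∃ Φ : ∀ n, Q.K.Config (Q.sites n) → ℂ,
    (∀ᶠ n in atTop, star (Φ n) ⬝ᵥ Φ n = 1 ∧ (Q.sectorProj n (I n)).mulVec (Φ n) = Φ n) ∧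
    ∀ A : Q.K.LocalObs, Tendsto
      (fun n => star (Φ n) ⬝ᵥ (A.toOp (Q.sites n)).mulVec (Φ n)) atTop (𝓝 (ω A))

/-! ### Self-similarity -/

/-- A transformation: in every finite lattice, a linear or antilinear automorphism of the algebra
of operators (implemented by a unitary or an antiunitary operator, for example). -/
structure Transformation where
  toFun : ∀ n, Q.K.Op (Q.sites n) ≃+* Q.K.Op (Q.sites n)
  smul : ∀ n,
    (∀ (c : ℂ) (M : Q.K.Op (Q.sites n)), toFun n (c • M) = c • toFun n M) ∨
    (∀ (c : ℂ) (M : Q.K.Op (Q.sites n)), toFun n (c • M) = (starRingEnd ℂ) c • toFun n M)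

/-- `R(A) = B`, in all sufficiently large volumes. -/
def Transformation.Maps {Q : LatticeSystem S} (R : Q.Transformation) (A B : Q.K.LocalObs) : Prop :=
  ∀ᶠ n in atTop, R.toFun n (A.toOp (Q.sites n)) = B.toOp (Q.sites n)

/-- Self-similarity with respect to transformations `R₁, …, R_m` from the set `T`, with `m = q²`.
The supports of the copies `B j = R j (A)` have a bounded number of sites as `L` grows. -/
def SelfSimilar (q : ℕ) (T : Set Q.Transformation) : Prop :=
  ∀ A : Q.K.LocalObs, ∃ k : ℕ, ∀ L : ℕ,
    ∃ (R : Fin (q ^ 2) → Q.Transformation) (B : Fin (q ^ 2) → Q.K.LocalObs),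
      (∀ j, R j ∈ T ∧ (∀ᶠ n in atTop, (R j).toFun n (Q.H n) = Q.H n) ∧
        (R j).Maps A (B j) ∧ (R j).Maps A.adj (B j).adj ∧
        (B j).supp.card ≤ k ∧ FarApart Q.G L A.supp (B j).supp) ∧
      ∀ i j, i ≠ j → FarApart Q.G L (B i).supp (B j).supp

/-- `R(𝒜) ⊆ 𝒜 = 𝒜†` for the transformations `R` in `T`, and the observables in `𝒜` are pairwise
bosonic. -/
structure IsBosonicClass (T : Set Q.Transformation) (𝒜 : Set Q.K.LocalObs) : Prop where
  bosonic : ∀ A ∈ 𝒜, ∀ B ∈ 𝒜, A.BosonicPair B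
  maps : ∀ R ∈ T, ∀ A ∈ 𝒜, ∀ B, R.Maps A B → B ∈ 𝒜
  adj : ∀ A ∈ 𝒜, A.adj ∈ 𝒜

/-- `ρ(A B) → 0` as `dist(supp A, supp B) → ∞` for `A, B ∈ 𝒜`, where the norms and the numbers of
sites of the supports of `A` and `B` stay bounded. -/
def CorrelationsVanish (ρ : Q.K.LocalObs → ℂ) (𝒜 : Set Q.K.LocalObs) : Prop :=
  ∀ k : ℕ, ∀ ε : ℝ, 0 < ε → ∃ r : ℕ, ∀ A ∈ 𝒜, ∀ B ∈ 𝒜,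
    A.supp.card ≤ k → B.supp.card ≤ k → ‖A.op‖ ≤ k → ‖B.op‖ ≤ k →
    FarApart Q.G r A.supp B.supp → ‖ρ (A.mul B)‖ ≤ ε

end LatticeSystem

end

/-! Velocity bound. Let `H'` collect the terms of the Hamiltonian whose supports avoid X; they
commute with A. In the interaction picture only `H - H'` moves B, so ‖[A(t),B]‖ is at most ‖[A,B]‖
plus 2‖A‖ times the time integral of ‖[(H-H')(s),B]‖. The latter is a sum of commutators [h_Z(s),B]
with Z meeting X, to which the same estimate applies. Take the weight φ(z) = ∑_{y∈Y} g(dist(z,y)).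
If ∑_{Z∋x} ‖h_Z‖ ∑_{z∈Z} φ(z) ≤ u φ(x), then the bound φ(x) exp(2ut) reproduces itself under this
iteration, and the remainder (at)^m/m!, with a rate a that depends on the volume, vanishes as m → ∞
(`lieb_robinson`). Each of the four decay conditions gives such a u with 2u ≤ v₀.

Clustering. Let P be the projection onto the ground state sector and A_s = ∫₀^∞ exp(-bt²) (A(t) -
A(-t))/(it) dt. In an eigenbasis this multiplies A_ij by a smoothed version of π sign(E_i - E_j).
Between sector vectors the gap therefore makes A_s close to -πA(1-P) when it stands on the left of
B, and to π(1-P)A when it stands on the right, with errors exp(-ΔE²/4b) and a multiple of the sector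
width. Hence ⟨[A_s,B]⟩ is close to -π⟨A(1-P)B + B(1-P)A⟩. It is also small: up to a time T by the
velocity bound, after T by the Gaussian. Choosing T and b such that g(r) exp(vT), exp(-bT²) and
exp(-ΔE²/4b) coincide turns the exponent of g into itself divided by 1 + 2v/ΔE
(`norm_anticommutator_sector_le`, `exists_clustering_const`).

The block PAP. It remains to remove APB and BPA, and for this PAP → 0 suffices. The operator A and
its q² distant copies have blocks in a space of dimension q². Clustering and the vanishing of the
sector correlations make these blocks almost orthogonal for the Hilbert–Schmidt product, so one of
the q² + 1 blocks is small. The transformations fix H, hence P, and preserve the operator norms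
involved, so all blocks have the same norm and PAP is small too (`eventually_norm_block_le`). Here
the volume goes to infinity with A and B fixed, so no rate for PAP → 0 is needed; this is why the
final constant does not depend on the class of observables, the transformations or the state. -/

noncomputable section

/-! ### The Lieb–Robinson bound in a C⋆-algebra -/

section LiebRobinson

variable {𝔸 : Type*} [CStarAlgebra 𝔸]

/-- The Heisenberg evolution `exp(i t H) A exp(-i t H)`. -/
def heisenberg (H : 𝔸) (t : ℝ) (A : 𝔸) : 𝔸 :=
  NormedSpace.exp ((t * Complex.I) • H) * A * NormedSpace.exp (-(t * Complex.I) • H)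

theorem exp_I_smul_mem_unitary {H : 𝔸} (hH : IsSelfAdjoint H) (t : ℝ) :
    NormedSpace.exp ((t * Complex.I) • H) ∈ unitary 𝔸 := by
  let _ : NormedAlgebra ℚ 𝔸 := NormedAlgebra.restrictScalars ℚ ℂ 𝔸
  refine NormedSpace.exp_mem_unitary_of_mem_skewAdjoint ?_
  rw [skewAdjoint.mem_iff, star_smul, hH.star_eq, ← neg_smul]
  simp

theorem exp_neg_I_smul_mem_unitary {H : 𝔸} (hH : IsSelfAdjoint H) (t : ℝ) :
    NormedSpace.exp (-(t * Complex.I) • H) ∈ unitary 𝔸 := by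
  have := exp_I_smul_mem_unitary hH (-t)
  simpa using this

theorem exp_smul_mul_exp_neg_smul (H : 𝔸) (c : ℂ) :
    NormedSpace.exp (c • H) * NormedSpace.exp (-c • H) = 1 := by
  let _ : NormedAlgebra ℚ 𝔸 := NormedAlgebra.restrictScalars ℚ ℂ 𝔸
  rw [← NormedSpace.exp_add_of_commute ((Commute.refl H).smul_left _ |>.smul_right _), neg_smul,
    add_neg_cancel, NormedSpace.exp_zero]

theorem exp_neg_smul_mul_exp_smul (H : 𝔸) (c : ℂ) :
    NormedSpace.exp (-c • H) * NormedSpace.exp (c • H) = 1 := by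
  simpa using exp_smul_mul_exp_neg_smul H (-c)

theorem hasDerivAt_exp_I_smul (H : 𝔸) (t : ℝ) :
    HasDerivAt (fun u : ℝ => NormedSpace.exp ((u * Complex.I) • H))
      (NormedSpace.exp ((t * Complex.I) • H) * (Complex.I • H)) t := by
  have := hasDerivAt_exp_smul_const (𝕂 := ℝ) (Complex.I • H) t
  simpa [smul_smul, Complex.real_smul, ← Complex.coe_smul] using this

theorem hasDerivAt_exp_neg_I_smul (H : 𝔸) (t : ℝ) :
    HasDerivAt (fun u : ℝ => NormedSpace.exp (-(u * Complex.I) • H))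
      (-(NormedSpace.exp (-(t * Complex.I) • H) * (Complex.I • H))) t := by
  have := hasDerivAt_exp_smul_const (𝕂 := ℝ) (-Complex.I • H) t
  simpa [smul_smul, Complex.real_smul, ← Complex.coe_smul] using this

theorem norm_heisenberg {H : 𝔸} (hH : IsSelfAdjoint H) (t : ℝ) (A : 𝔸) :
    ‖heisenberg H t A‖ = ‖A‖ := by
  rw [heisenberg, CStarRing.norm_mul_mem_unitary _ (exp_neg_I_smul_mem_unitary hH t),
    CStarRing.norm_mem_unitary_mul _ (exp_I_smul_mem_unitary hH t)]

theorem heisenberg_zero (H A : 𝔸) : heisenberg H 0 A = A := by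
  simp [heisenberg]

theorem heisenberg_mul (H : 𝔸) (t : ℝ) (A B : 𝔸) :
    heisenberg H t (A * B) = heisenberg H t A * heisenberg H t B := by
  have := exp_neg_smul_mul_exp_smul H (t * Complex.I)
  simp only [heisenberg]
  calc _ = NormedSpace.exp ((t * Complex.I) • H) * A * 1 * B *
        NormedSpace.exp (-(t * Complex.I) • H) := by noncomm_ring
    _ = _ := by rw [← this]; noncomm_ring

theorem heisenberg_sum (H : 𝔸) (t : ℝ) {ι : Type*} (s : Finset ι) (A : ι → 𝔸) :
    heisenberg H t (∑ i ∈ s, A i) = ∑ i ∈ s, heisenberg H t (A i) := by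
  simp [heisenberg, Finset.mul_sum, Finset.sum_mul]

theorem heisenberg_sub (H : 𝔸) (t : ℝ) (A B : 𝔸) :
    heisenberg H t (A - B) = heisenberg H t A - heisenberg H t B := by
  simp [heisenberg, mul_sub, sub_mul]

theorem heisenberg_neg_heisenberg (H : 𝔸) (t : ℝ) (A : 𝔸) :
    heisenberg H (-t) (heisenberg H t A) = A := by
  have h1 := exp_neg_smul_mul_exp_smul H (t * Complex.I)
  simp only [heisenberg, Complex.ofReal_neg, neg_mul, neg_neg]
  calc _ = (NormedSpace.exp (-(t * Complex.I) • H) * NormedSpace.exp ((t * Complex.I) • H)) * A *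
        (NormedSpace.exp (-(t * Complex.I) • H) * NormedSpace.exp ((t * Complex.I) • H)) := by
        simp only [mul_assoc]
    _ = A := by rw [h1]; simp

theorem heisenberg_neg_left (H : 𝔸) (t : ℝ) (A : 𝔸) :
    heisenberg (-H) t A = heisenberg H (-t) A := by
  simp [heisenberg]

theorem norm_commutator_le (A B : 𝔸) : ‖A * B - B * A‖ ≤ 2 * ‖A‖ * ‖B‖ := by
  have h1 := norm_mul_le A B
  have h2 := norm_mul_le B A
  have h3 := norm_sub_le (A * B) (B * A)
  linarith [mul_comm ‖A‖ ‖B‖]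

/-- Only the part of the Hamiltonian that does not commute with `A` contributes to the growth of
the commutator of `A(t)` with `B`. -/
theorem norm_commutator_heisenberg_le {H H' A B : 𝔸} (hH : IsSelfAdjoint H)
    (hH' : IsSelfAdjoint H') (hA : Commute H' A) {β β' : ℝ → ℝ}
    (hβ : ∀ t, HasDerivAt β (β' t) t)
    (hle : ∀ t, 0 ≤ t →
      ‖heisenberg H t (H - H') * B - B * heisenberg H t (H - H')‖ ≤ β' t)
    {t : ℝ} (ht : 0 ≤ t) :
    ‖heisenberg H t A * B - B * heisenberg H t A‖
      ≤ ‖A * B - B * A‖ + 2 * ‖A‖ * (β t - β 0) := by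
  -- `B` in the interaction picture
  let Bt : ℝ → 𝔸 := fun t => heisenberg H' t (heisenberg H (-t) B)
  have hder : ∀ t, HasDerivAt Bt (-(Complex.I • heisenberg H' t (heisenberg H (-t)
      (heisenberg H t (H - H') * B - B * heisenberg H t (H - H'))))) t := by
    intro t
    have e1 := hasDerivAt_exp_I_smul H' t
    have e2 := hasDerivAt_exp_neg_I_smul H' t
    have e3 := hasDerivAt_exp_I_smul H t
    have e4 := hasDerivAt_exp_neg_I_smul H t
    have := ((e1.mul ((e4.mul_const B).mul e3)).mul e2)
    have hBt : Bt = (fun t : ℝ => NormedSpace.exp ((t * Complex.I) • H') *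
        (NormedSpace.exp (-(t * Complex.I) • H) * B * NormedSpace.exp ((t * Complex.I) • H)) *
        NormedSpace.exp (-(t * Complex.I) • H')) := by
      funext s
      simp [Bt, heisenberg]
    rw [hBt]
    refine this.congr_deriv ?_
    have hc1 : NormedSpace.exp (-(t * Complex.I) • H) * (Complex.I • H) =
        (Complex.I • H) * NormedSpace.exp (-(t * Complex.I) • H) :=
      ((((Commute.refl H).smul_left _).smul_right _).exp_left).eq
    have hc2 : NormedSpace.exp (-(t * Complex.I) • H') * (Complex.I • H') =
        (Complex.I • H') * NormedSpace.exp (-(t * Complex.I) • H') :=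
      ((((Commute.refl H').smul_left _).smul_right _).exp_left).eq
    have hR : Complex.I • heisenberg H' t (heisenberg H (-t)
        (heisenberg H t (H - H') * B - B * heisenberg H t (H - H'))) =
        heisenberg H' t ((Complex.I • H - Complex.I • H') * heisenberg H (-t) B
          - heisenberg H (-t) B * (Complex.I • H - Complex.I • H')) := by
      rw [← smul_sub, smul_mul_assoc, mul_smul_comm, ← smul_sub, heisenberg_sub H (-t),
        heisenberg_mul, heisenberg_mul, heisenberg_neg_heisenberg]
      simp only [heisenberg, mul_smul_comm, smul_mul_assoc]
    rw [hR, hc1, hc2]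
    simp only [heisenberg, Complex.ofReal_neg, neg_mul, neg_neg, Pi.mul_apply]
    noncomm_ring
  have hnorm : ∀ t, 0 ≤ t → ‖Bt t - B‖ ≤ β t - β 0 := by
    intro t ht
    refine image_norm_le_of_norm_deriv_right_le_deriv_boundary (f := fun s => Bt s - B)
      (a := 0) (b := t) (B := fun s => β s - β 0) (B' := β')
      (f' := fun t => -(Complex.I • heisenberg H' t (heisenberg H (-t)
      (heisenberg H t (H - H') * B - B * heisenberg H t (H - H'))))) ?_ ?_ ?_ ?_ ?_ ⟨ht, le_rfl⟩
    · exact fun s _ => ((hder s).sub_const B).continuousAt.continuousWithinAt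
    · exact fun s _ => ((hder s).sub_const B).hasDerivWithinAt
    · simp [Bt, heisenberg_zero]
    · exact fun s => (hβ s).sub_const _
    · intro s hs
      rw [norm_neg, norm_smul, norm_heisenberg hH', norm_heisenberg hH, Complex.norm_I, one_mul]
      exact hle s hs.1
  have hAinv : heisenberg H' t A = A := by
    have hc : Commute (NormedSpace.exp ((t * Complex.I) • H')) A := (hA.smul_left _).exp_left
    rw [heisenberg, hc.eq, mul_assoc, exp_smul_mul_exp_neg_smul, mul_one]
  -- A is invariant under the evolution by `H'`. Undoing the evolution by `H` and applying that by
  -- `H'`, both isometric, turns [A(t),B] into [A,Bt], and Bt differs from B by at most β t - β 0.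
  have hkey : heisenberg H' t (heisenberg H (-t) (heisenberg H t A * B - B * heisenberg H t A))
      = A * Bt t - Bt t * A := by
    simp only [heisenberg_sub, heisenberg_mul, heisenberg_neg_heisenberg, hAinv, Bt]
  rw [← norm_heisenberg hH (-t), ← norm_heisenberg hH' t, hkey]
  have : A * Bt t - Bt t * A = (A * B - B * A) + (A * (Bt t - B) - (Bt t - B) * A) := by
    noncomm_ring
  rw [this]
  refine (norm_add_le _ _).trans (add_le_add le_rfl ((norm_commutator_le _ _).trans ?_))
  exact mul_le_mul_of_nonneg_left (hnorm t ht) (by positivity)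

/-- One step of the iteration that leads to the Lieb–Robinson bound. -/
theorem norm_commutator_heisenberg_sum_le {S : Type*} [DecidableEq S] {Λ : Finset S}
    {h : Finset S → 𝔸} (hsa : ∀ Z, IsSelfAdjoint (h Z)) {ν : Finset S → ℝ}
    {φ : S → ℝ} {u a : ℝ} {B : 𝔸} {m : ℕ}
    (hν0 : ∀ Z, 0 ≤ ν Z) (hφ0 : ∀ z, 0 ≤ φ z) (ha0 : 0 ≤ a)
    (hu : ∀ x ∈ Λ, ∑ Z ∈ Λ.powerset with x ∈ Z, ν Z * ∑ z ∈ Z, φ z ≤ u * φ x)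
    (ha : ∀ x ∈ Λ, ∑ Z ∈ Λ.powerset with x ∈ Z, 2 * (ν Z * (Z.card : ℝ)) ≤ a)
    (hB : ∀ Z ∈ Λ.powerset, Z.Nonempty → ∀ t : ℝ, 0 ≤ t →
      ‖heisenberg (∑ Z ∈ Λ.powerset, h Z) t (h Z) * B
          - B * heisenberg (∑ Z ∈ Λ.powerset, h Z) t (h Z)‖
        ≤ 2 * ν Z * ‖B‖ * (∑ z ∈ Z, φ z * Real.exp (2 * u * t)
            + (Z.card : ℝ) * ((a * t) ^ m / (m.factorial : ℝ))))
    {X : Finset S} (hX : X ⊆ Λ) {A : 𝔸}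
    (hA : ∀ Z ∈ Λ.powerset, Disjoint Z X → Commute (h Z) A) {t : ℝ} (ht : 0 ≤ t) :
    ‖heisenberg (∑ Z ∈ Λ.powerset, h Z) t A * B - B * heisenberg (∑ Z ∈ Λ.powerset, h Z) t A‖
      ≤ ‖A * B - B * A‖ + 2 * ‖A‖ * ‖B‖ * (∑ x ∈ X, φ x * (Real.exp (2 * u * t) - 1)
          + (X.card : ℝ) * ((a * t) ^ (m + 1) / ((m + 1).factorial : ℝ))) := by
  set H := ∑ Z ∈ Λ.powerset, h Z with hHdef
  have hHsa : IsSelfAdjoint H := isSelfAdjoint_sum _ fun Z _ => hsa Z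
  have hsub : H - ∑ Z ∈ Λ.powerset with Disjoint Z X, h Z
      = ∑ Z ∈ Λ.powerset with ¬ Disjoint Z X, h Z := by
    rw [hHdef, ← Finset.sum_filter_add_sum_filter_not Λ.powerset (fun Z => Disjoint Z X) h]
    abel
  -- `H'` collects the terms that avoid X. β' is the bound `hB` summed over the Z that meet X, and β
  -- is its antiderivative: integration reproduces φ exp(2ut) and raises the remainder from order m
  -- to order m + 1.
  have key := norm_commutator_heisenberg_le (H := H) (A := A) (B := B)
    (H' := ∑ Z ∈ Λ.powerset with Disjoint Z X, h Z)
    (β := fun t => ‖B‖ * ∑ x ∈ X, (φ x * Real.exp (2 * u * t)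
      + (a * t) ^ (m + 1) / ((m + 1).factorial : ℝ)))
    (β' := fun t => 2 * ‖B‖ * ∑ x ∈ X, (u * φ x * Real.exp (2 * u * t)
      + a / 2 * ((a * t) ^ m / (m.factorial : ℝ))))
    hHsa (isSelfAdjoint_sum _ fun Z _ => hsa Z)
    (Commute.sum_left _ _ _ fun Z hZ => hA Z (Finset.mem_filter.1 hZ).1 (Finset.mem_filter.1 hZ).2)
    ?_ ?_ ht
  · refine key.trans (le_of_eq ?_)
    simp only [mul_zero, Real.exp_zero, mul_one, ne_eq, Nat.add_eq_zero_iff, one_ne_zero, and_false,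
      not_false_eq_true, zero_pow, zero_div, add_zero, Finset.sum_add_distrib, Finset.sum_const,
      nsmul_eq_mul, mul_sub, Finset.sum_sub_distrib]
    ring
  · intro t
    have e1 : ∀ x ∈ X, HasDerivAt (fun t : ℝ => φ x * Real.exp (2 * u * t)
      + (a * t) ^ (m + 1) / ((m + 1).factorial : ℝ)) (φ x * (Real.exp (2 * u * t) * (2 * u))
      + ((m + 1 : ℕ) * (a * t) ^ m * a) / ((m + 1).factorial : ℝ)) t := by
      intro x _
      have d1 : HasDerivAt (fun t : ℝ => 2 * u * t) (2 * u) t := by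
        simpa using (hasDerivAt_id t).const_mul (2 * u)
      have d2 : HasDerivAt (fun t : ℝ => a * t) a t := by
        simpa using (hasDerivAt_id t).const_mul a
      exact (d1.exp.const_mul (φ x)).add ((d2.pow (m + 1)).div_const _)
    refine ((HasDerivAt.fun_sum e1).const_mul ‖B‖).congr_deriv ?_
    rw [Finset.mul_sum, Finset.mul_sum]
    refine Finset.sum_congr rfl fun x _ => ?_
    rw [Nat.factorial_succ]
    have : (m.factorial : ℝ) ≠ 0 := by positivity
    push_cast
    field_simp
  · intro t ht
    rw [hsub, heisenberg_sum, Finset.sum_mul, Finset.mul_sum, ← Finset.sum_sub_distrib]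
    have hterm0 : ∀ Z : Finset S, 0 ≤ 2 * ν Z * ‖B‖ * (∑ z ∈ Z, φ z * Real.exp (2 * u * t)
            + (Z.card : ℝ) * ((a * t) ^ m / (m.factorial : ℝ))) := by
      intro Z
      have := hν0 Z
      have h1 : 0 ≤ ∑ z ∈ Z, φ z * Real.exp (2 * u * t) :=
        Finset.sum_nonneg fun z _ => mul_nonneg (hφ0 z) (Real.exp_pos _).le
      positivity
    calc _ ≤ ∑ Z ∈ Λ.powerset with ¬ Disjoint Z X,
          2 * ν Z * ‖B‖ * (∑ z ∈ Z, φ z * Real.exp (2 * u * t)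
            + (Z.card : ℝ) * ((a * t) ^ m / (m.factorial : ℝ))) := by
          refine (norm_sum_le _ _).trans (Finset.sum_le_sum fun Z hZ => ?_)
          rw [Finset.mem_filter] at hZ
          refine hB Z hZ.1 ?_ t ht
          rw [Finset.nonempty_iff_ne_empty]
          rintro rfl
          exact hZ.2 (Finset.disjoint_empty_left _)
      _ ≤ ∑ x ∈ X, ∑ Z ∈ Λ.powerset with x ∈ Z,
          2 * ν Z * ‖B‖ * (∑ z ∈ Z, φ z * Real.exp (2 * u * t)
            + (Z.card : ℝ) * ((a * t) ^ m / (m.factorial : ℝ))) := by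
          simp only [Finset.sum_filter]
          rw [Finset.sum_comm]
          refine Finset.sum_le_sum fun Z _ => ?_
          split_ifs with hd
          · refine Finset.sum_nonneg fun y _ => ?_
            split_ifs
            exacts [hterm0 Z, le_rfl]
          · rw [Finset.not_disjoint_iff] at hd
            obtain ⟨x, hxZ, hxX⟩ := hd
            refine le_trans (by rw [if_pos hxZ]) (Finset.single_le_sum (f := fun x => if x ∈ Z then
              2 * ν Z * ‖B‖ * (∑ z ∈ Z, φ z * Real.exp (2 * u * t)
            + (Z.card : ℝ) * ((a * t) ^ m / (m.factorial : ℝ))) else 0) ?_ hxX)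
            intro y _
            split_ifs
            exacts [hterm0 Z, le_rfl]
      _ ≤ ∑ x ∈ X, 2 * ‖B‖ * (u * φ x * Real.exp (2 * u * t)
            + a / 2 * ((a * t) ^ m / (m.factorial : ℝ))) := by
          refine Finset.sum_le_sum fun x hx => ?_
          have h1 := hu x (hX hx)
          have h2 := ha x (hX hx)
          have hE := (Real.exp_pos (2 * u * t)).le
          have hF : 0 ≤ (a * t) ^ m / (m.factorial : ℝ) := by positivity
          have e : ∀ Z : Finset S, 2 * ν Z * ‖B‖ * (∑ z ∈ Z, φ z * Real.exp (2 * u * t)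
              + (Z.card : ℝ) * ((a * t) ^ m / (m.factorial : ℝ)))
              = 2 * ‖B‖ * ((ν Z * ∑ z ∈ Z, φ z) * Real.exp (2 * u * t)
              + 2 * (ν Z * (Z.card : ℝ)) * (1 / 2 * ((a * t) ^ m / (m.factorial : ℝ)))) := by
            intro Z
            rw [← Finset.sum_mul]
            ring
          simp only [e]
          rw [← Finset.mul_sum, Finset.sum_add_distrib, ← Finset.sum_mul, ← Finset.sum_mul]
          refine mul_le_mul_of_nonneg_left (add_le_add ?_ ?_) (by positivity)
          · exact mul_le_mul_of_nonneg_right h1 hE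
          · calc _ ≤ a * (1 / 2 * ((a * t) ^ m / (m.factorial : ℝ))) :=
                mul_le_mul_of_nonneg_right h2 (by positivity)
              _ = _ := by ring
      _ = _ := by rw [← Finset.mul_sum]

/-- The Lieb–Robinson bound, for a weight `φ` that the interaction multiplies by at most `u`. -/
theorem lieb_robinson {S : Type*} [DecidableEq S] {Λ : Finset S}
    {h : Finset S → 𝔸} (hsa : ∀ Z, IsSelfAdjoint (h Z)) {ν : Finset S → ℝ}
    (hν : ∀ Z, ‖h Z‖ ≤ ν Z)
    (hcomm : ∀ Z ∈ Λ.powerset, ∀ Z' ∈ Λ.powerset, Disjoint Z Z' → Commute (h Z) (h Z'))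
    {φ : S → ℝ} {u : ℝ} (hφ0 : ∀ z, 0 ≤ φ z)
    (hu : ∀ x ∈ Λ, ∑ Z ∈ Λ.powerset with x ∈ Z, ν Z * ∑ z ∈ Z, φ z ≤ u * φ x)
    {X Y : Finset S} (hX : X ⊆ Λ) {A B : 𝔸} (hY : ∀ y ∈ Y, 1 ≤ φ y)
    (hA : ∀ Z ∈ Λ.powerset, Disjoint Z X → Commute (h Z) A)
    (hB : ∀ Z ∈ Λ.powerset, Disjoint Z Y → Commute (h Z) B) (hAB : Commute A B)
    {t : ℝ} (ht : 0 ≤ t) :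
    ‖heisenberg (∑ Z ∈ Λ.powerset, h Z) t A * B - B * heisenberg (∑ Z ∈ Λ.powerset, h Z) t A‖
      ≤ 2 * ‖A‖ * ‖B‖ * ∑ x ∈ X, φ x * (Real.exp (2 * u * t) - 1) := by
  have hν0 : ∀ Z, 0 ≤ ν Z := fun Z => (norm_nonneg _).trans (hν Z)
  have hHsa : IsSelfAdjoint (∑ Z ∈ Λ.powerset, h Z) := isSelfAdjoint_sum _ fun Z _ => hsa Z
  -- a crude rate, which depends on the volume
  set a : ℝ := ∑ Z ∈ Λ.powerset, 2 * (ν Z * (Z.card : ℝ)) with ha_def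
  have hpos : ∀ Z : Finset S, 0 ≤ 2 * (ν Z * (Z.card : ℝ)) := fun Z => by
    have := hν0 Z
    positivity
  have ha0 : 0 ≤ a := Finset.sum_nonneg fun Z _ => hpos Z
  have ha : ∀ x ∈ Λ, ∑ Z ∈ Λ.powerset with x ∈ Z, 2 * (ν Z * (Z.card : ℝ)) ≤ a := fun x _ =>
    Finset.sum_le_sum_of_subset_of_nonneg (Finset.filter_subset _ _) fun Z _ _ => hpos Z
  -- Instead of summing nested commutators, carry the final bound plus a remainder. At m = 0 the
  -- remainder is |Z| ≥ 1 and covers the trivial bound, which is why Z has to be nonempty. The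
  -- volume-dependent rate a occurs only in the remainder, which the factorial sends to 0.
  have hmain : ∀ m : ℕ, ∀ Z ∈ Λ.powerset, Z.Nonempty → ∀ t : ℝ, 0 ≤ t →
      ‖heisenberg (∑ Z ∈ Λ.powerset, h Z) t (h Z) * B
          - B * heisenberg (∑ Z ∈ Λ.powerset, h Z) t (h Z)‖
        ≤ 2 * ν Z * ‖B‖ * (∑ z ∈ Z, φ z * Real.exp (2 * u * t)
            + (Z.card : ℝ) * ((a * t) ^ m / (m.factorial : ℝ))) := by
    intro m
    induction m with
    | zero =>
      intro Z hZ hne t ht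
      refine (norm_commutator_le _ _).trans ?_
      rw [norm_heisenberg hHsa]
      have h1 : 0 ≤ ∑ z ∈ Z, φ z * Real.exp (2 * u * t) :=
        Finset.sum_nonneg fun z _ => mul_nonneg (hφ0 z) (Real.exp_pos _).le
      have h2 : (1 : ℝ) ≤ Z.card := by exact_mod_cast hne.card_pos
      have h3 := hν0 Z
      simp only [pow_zero, Nat.factorial_zero, Nat.cast_one, div_one, mul_one]
      calc 2 * ‖h Z‖ * ‖B‖ ≤ 2 * ν Z * ‖B‖ := by gcongr; exact hν Z
        _ ≤ _ := le_mul_of_one_le_right (by positivity) (by linarith)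
    | succ m ih =>
      intro Z hZ hne t ht
      have h0 : ‖h Z * B - B * h Z‖ ≤ 2 * ‖h Z‖ * ‖B‖ * ∑ z ∈ Z, φ z := by
        by_cases hd : Disjoint Z Y
        · rw [(hB Z hZ hd).eq, sub_self, norm_zero]
          have : 0 ≤ ∑ z ∈ Z, φ z := Finset.sum_nonneg fun z _ => hφ0 z
          positivity
        · obtain ⟨z, hzZ, hzY⟩ := Finset.not_disjoint_iff.1 hd
          have : 1 ≤ ∑ z ∈ Z, φ z :=
            (hY z hzY).trans (Finset.single_le_sum (fun z _ => hφ0 z) hzZ)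
          exact (norm_commutator_le _ _).trans (le_mul_of_one_le_right (by positivity) this)
      have := norm_commutator_heisenberg_sum_le hsa hν0 hφ0 ha0 hu ha ih
        (Finset.mem_powerset.1 hZ) (A := h Z) (fun Z' hZ' hd => hcomm Z' hZ' Z hZ hd) ht
      refine (this.trans (add_le_add_left h0 _)).trans ?_
      -- The initial commutator costs ∑ φ because φ ≥ 1 on Y, and this is exactly the amount
      -- subtracted by the -1 in exp(2ut) - 1. In the final application A and B commute, so the -1
      -- survives.
      have hE : ∑ x ∈ Z, φ x * (Real.exp (2 * u * t) - 1)
          = ∑ x ∈ Z, φ x * Real.exp (2 * u * t) - ∑ x ∈ Z, φ x := by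
        simp [mul_sub]
      rw [hE]
      have h1 : 0 ≤ ∑ z ∈ Z, φ z * Real.exp (2 * u * t) :=
        Finset.sum_nonneg fun z _ => mul_nonneg (hφ0 z) (Real.exp_pos _).le
      calc _ = 2 * ‖h Z‖ * ‖B‖ * (∑ z ∈ Z, φ z * Real.exp (2 * u * t)
            + (Z.card : ℝ) * ((a * t) ^ (m + 1) / ((m + 1).factorial : ℝ))) := by ring
        _ ≤ _ := by gcongr; exact hν Z
  have hlim : Tendsto (fun m : ℕ => 2 * ‖A‖ * ‖B‖ * (∑ x ∈ X, φ x * (Real.exp (2 * u * t) - 1)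
          + (X.card : ℝ) * ((a * t) ^ (m + 1) / ((m + 1).factorial : ℝ)))) atTop
      (𝓝 (2 * ‖A‖ * ‖B‖ * (∑ x ∈ X, φ x * (Real.exp (2 * u * t) - 1) + (X.card : ℝ) * 0))) :=
    ((((tendsto_add_atTop_iff_nat 1).2
      (FloorSemiring.tendsto_pow_div_factorial_atTop (a * t))).const_mul _).const_add _).const_mul _
  rw [mul_zero, add_zero] at hlim
  refine ge_of_tendsto' hlim fun m => ?_
  have := norm_commutator_heisenberg_sum_le hsa hν0 hφ0 ha0 hu ha (hmain m) hX hA ht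
  rwa [hAB.eq, sub_self, norm_zero, zero_add] at this

end LiebRobinson

/-! ### Operators of subvolumes -/

namespace SiteSpaces

variable {S : Type*} [LinearOrder S] (K : SiteSpaces S)

theorem zsign_add (a b : ZMod 2) : zsign (a + b) = zsign a * zsign b := by
  have h : ∀ a : ZMod 2, a = 0 ∨ a = 1 := by decide
  rcases h a with rfl | rfl <;> rcases h b with rfl | rfl <;>
    simp [zsign, CharTwo.add_self_eq_zero]

theorem zsign_zero : zsign 0 = 1 := by simp [zsign]

theorem zsign_sum {ι : Type*} (s : Finset ι) (f : ι → ZMod 2) :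
    zsign (∑ i ∈ s, f i) = ∏ i ∈ s, zsign (f i) := by
  classical
  induction s using Finset.induction_on with
  | empty => simp [zsign_zero]
  | insert i s hi ih => rw [Finset.sum_insert hi, Finset.prod_insert hi, zsign_add, ih]

/-- The exponent of the Jordan–Wigner sign. -/
def jwExp (X Λ : Finset S) (s t : K.Config Λ) : ZMod 2 :=
  ∑ y : Λ, ∑ x : Λ, if (y : S) ∉ X ∧ (x : S) ∈ X ∧ y < x then
    K.par y (s y) * (K.par x (s x) + K.par x (t x)) else 0

theorem jwSign_eq (X Λ : Finset S) (s t : K.Config Λ) :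
    K.jwSign X Λ s t = zsign (K.jwExp X Λ s t) := by
  simp only [jwSign, jwExp, zsign_sum]
  refine Finset.prod_congr rfl fun y _ => Finset.prod_congr rfl fun x _ => ?_
  split_ifs <;> simp [zsign_zero]

/-- The parity of a site y off X is the same in s and u, and the parity changes of a site x from s
to u and from u to t add up mod 2. This cocycle identity makes `embed` multiplicative. -/
theorem jwSign_mul {X Λ : Finset S} {s u t : K.Config Λ}
    (hsu : ∀ y : Λ, (y : S) ∉ X → s y = u y) :
    K.jwSign X Λ s u * K.jwSign X Λ u t = K.jwSign X Λ s t := by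
  rw [jwSign_eq, jwSign_eq, jwSign_eq, ← zsign_add]
  congr 1
  simp only [jwExp, ← Finset.sum_add_distrib]
  refine Finset.sum_congr rfl fun y _ => Finset.sum_congr rfl fun x _ => ?_
  split_ifs with h
  · rw [hsu y h.1]
    have := CharTwo.add_self_eq_zero (K.par x (u x))
    linear_combination K.par y (u y) * this
  · simp

theorem embed_add {X Λ : Finset S} (h : X ⊆ Λ) (M N : K.Op X) :
    K.embed h (M + N) = K.embed h M + K.embed h N := by
  ext s t
  simp only [embed, Matrix.of_apply, Matrix.add_apply]
  split_ifs <;> ring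

theorem embed_smul {X Λ : Finset S} (h : X ⊆ Λ) (c : ℂ) (M : K.Op X) :
    K.embed h (c • M) = c • K.embed h M := by
  ext s t
  simp only [embed, Matrix.of_apply, Matrix.smul_apply, smul_eq_mul]
  split_ifs <;> ring

theorem jwSign_self (X Λ : Finset S) (s : K.Config Λ) : K.jwSign X Λ s s = 1 := by
  rw [jwSign_eq, ← zsign_zero]
  congr 1
  simp [jwExp, CharTwo.add_self_eq_zero]

theorem embed_one {X Λ : Finset S} (h : X ⊆ Λ) : K.embed h (1 : K.Op X) = 1 := by
  ext s t
  simp only [embed, Matrix.of_apply]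
  by_cases hst : s = t
  · subst hst
    simp [jwSign_self]
  · rw [Matrix.one_apply_ne hst]
    split_ifs with h1
    · rw [Matrix.one_apply_ne, mul_zero]
      intro h2
      refine hst (funext fun y => ?_)
      by_cases hy : (y : S) ∈ X
      · exact congrFun h2 ⟨y, hy⟩
      · exact h1 y hy
    · rfl

theorem embed_mul {X Λ : Finset S} (h : X ⊆ Λ) (M N : K.Op X) :
    K.embed h (M * N) = K.embed h M * K.embed h N := by
  ext s t
  -- The only intermediate states that contribute to the matrix product agree with s off X, so they
  -- are parametrized by the configurations of X.
  let glue : K.Config X → K.Config Λ := fun w y => if hy : (y : S) ∈ X then w ⟨y, hy⟩ else s y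
  have hglue_mem : ∀ (w : K.Config X) (x : X), glue w ⟨x, h x.2⟩ = w x := fun w x => by
    simp [glue]
  have hglue_not : ∀ (w : K.Config X) (y : Λ), (y : S) ∉ X → s y = glue w y := fun w y hy => by
    simp [glue, hy]
  rw [Matrix.mul_apply]
  rw [← Finset.sum_of_injOn (s := Finset.univ)
    (f := fun w => K.embed h M s (glue w) * K.embed h N (glue w) t) glue]
  · simp only [embed, Matrix.of_apply]
    have e1 : ∀ w, (∀ y : Λ, (y : S) ∉ X → s y = glue w y) := fun w => hglue_not w
    have e2 : ∀ w, (∀ y : Λ, (y : S) ∉ X → glue w y = t y) ↔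
        (∀ y : Λ, (y : S) ∉ X → s y = t y) := fun w =>
      forall₂_congr fun y hy => by rw [hglue_not w y hy]
    simp only [e2, if_pos (e1 _), hglue_mem]
    split_ifs with hst
    · rw [Matrix.mul_apply, Finset.mul_sum]
      refine Finset.sum_congr rfl fun w _ => ?_
      rw [← K.jwSign_mul (e1 w)]
      ring
    · simp
  · intro w _ w' _ hww
    funext x
    rw [← hglue_mem w x, ← hglue_mem w' x, hww]
  · simp
  · intro u _ hu
    simp only [embed, Matrix.of_apply]
    rw [if_neg, zero_mul]
    intro hsu
    refine hu ⟨fun x => u ⟨x, h x.2⟩, by simp, ?_⟩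
    funext y
    by_cases hy : (y : S) ∈ X
    · simp [glue, hy]
    · simp [glue, hy, hsu y hy]
  · simp

/-- The inclusion of the operators of a subvolume, as a homomorphism of star algebras. -/
def embedHom {X Λ : Finset S} (h : X ⊆ Λ) : K.Op X →⋆ₐ[ℂ] K.Op Λ where
  toFun := K.embed h
  map_one' := K.embed_one h
  map_mul' := K.embed_mul h
  map_zero' := by simpa using K.embed_smul h 0 0
  map_add' := K.embed_add h
  commutes' c := by
    simp only [Algebra.algebraMap_eq_smul_one]
    rw [embed_smul, embed_one]
  map_star' M := (K.embed_conjTranspose h M).symm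

theorem norm_embed_le {X Λ : Finset S} (h : X ⊆ Λ) (M : K.Op X) : ‖K.embed h M‖ ≤ ‖M‖ :=
  NonUnitalStarAlgHom.norm_apply_le (K.embedHom h) M

/-- Every entry of M appears, up to a nonzero sign, between configurations extended by the same
values off X. Injectivity makes the inclusion isometric, being a star homomorphism of C⋆-algebras.
-/
theorem embed_injective {X Λ : Finset S} (h : X ⊆ Λ) : Function.Injective (K.embed h) := by
  intro M N hMN
  ext s t
  have : ∀ x, Nonempty (Fin (K.dim x)) := fun x => ⟨⟨0, K.dim_pos x⟩⟩
  let ext0 : K.Config X → K.Config Λ := fun w y =>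
    if hy : (y : S) ∈ X then w ⟨y, hy⟩ else Classical.arbitrary _
  have h0 : ∀ (w : K.Config X) (x : X), ext0 w ⟨x, h x.2⟩ = w x := fun w x => by simp [ext0]
  have h1 : ∀ y : Λ, (y : S) ∉ X → ext0 s y = ext0 t y := fun y hy => by simp [ext0, hy]
  have := congrFun (congrFun hMN (ext0 s)) (ext0 t)
  simp only [embed, Matrix.of_apply, if_pos h1, h0] at this
  refine mul_left_cancel₀ ?_ this
  rw [jwSign_eq, zsign]
  split_ifs <;> simp

theorem norm_embed {X Λ : Finset S} (h : X ⊆ Λ) (M : K.Op X) : ‖K.embed h M‖ = ‖M‖ :=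
  NonUnitalStarAlgHom.norm_map (K.embedHom h) (K.embed_injective h) M

theorem sum_subtype_eq_ite {M : Type*} [AddCommMonoid M] {Y Λ : Finset S} (h : Y ⊆ Λ) (f : Λ → M) :
    ∑ y : Y, f ⟨y, h y.2⟩ = ∑ y : Λ, if (y : S) ∈ Y then f y else 0 := by
  rw [← Finset.sum_filter]
  refine Finset.sum_bij (fun y _ => ⟨y, h y.2⟩) (by simp) (by simp) ?_ (by simp)
  intro y hy
  exact ⟨⟨y, (Finset.mem_filter.1 hy).2⟩, by simp, rfl⟩

/-- Sites outside X keep their state, so only parity changes at sites x of X contribute to the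
signs. For these, the inner embedding counts the odd sites of Y \ X and the outer one those of Λ \
Y. -/
theorem embed_embed {X Y Λ : Finset S} (hXY : X ⊆ Y) (hY : Y ⊆ Λ) (M : K.Op X) :
    K.embed hY (K.embed hXY M) = K.embed (hXY.trans hY) M := by
  ext s t
  simp only [embed, Matrix.of_apply]
  by_cases hst : ∀ y : Λ, (y : S) ∉ X → s y = t y
  · have h1 : ∀ y : Λ, (y : S) ∉ Y → s y = t y := fun y hy => hst y fun h => hy (hXY h)
    have h2 : ∀ y : Y, (y : S) ∉ X → s ⟨y, hY y.2⟩ = t ⟨y, hY y.2⟩ := fun y hy => hst _ hy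
    rw [if_pos h1, if_pos h2, if_pos hst, ← mul_assoc]
    congr 1
    rw [jwSign_eq, jwSign_eq, jwSign_eq, ← zsign_add]
    congr 1
    simp only [jwExp]
    have e : ∀ y : Y, (∑ x : Y, if (y : S) ∉ X ∧ (x : S) ∈ X ∧ y < x then
        K.par y (s ⟨y, hY y.2⟩) * (K.par x (s ⟨x, hY x.2⟩) + K.par x (t ⟨x, hY x.2⟩)) else 0)
        = ∑ x : Λ, if (x : S) ∈ Y then (if (y : S) ∉ X ∧ (x : S) ∈ X ∧ (y : S) < x then
        K.par y (s ⟨y, hY y.2⟩) * (K.par x (s x) + K.par x (t x)) else 0) else 0 :=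
      fun y => sum_subtype_eq_ite hY fun x => if (y : S) ∉ X ∧ (x : S) ∈ X ∧ (y : S) < x then
        K.par y (s ⟨y, hY y.2⟩) * (K.par x (s x) + K.par x (t x)) else 0
    simp only [e]
    rw [sum_subtype_eq_ite hY fun y => ∑ x : Λ, if (x : S) ∈ Y then
      (if (y : S) ∉ X ∧ (x : S) ∈ X ∧ (y : S) < x then
        K.par y (s y) * (K.par x (s x) + K.par x (t x)) else 0) else 0]
    rw [← Finset.sum_add_distrib]
    refine Finset.sum_congr rfl fun y _ => ?_
    rw [Finset.ite_sum_zero, ← Finset.sum_add_distrib]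
    refine Finset.sum_congr rfl fun x _ => ?_
    by_cases hx : (x : S) ∈ X
    · have hx' := hXY hx
      by_cases hy : (y : S) ∈ Y
      · simp [hx, hx', hy]
      · have hy' : (y : S) ∉ X := fun h => hy (hXY h)
        simp [hx, hx', hy, hy']
    · simp [hx, hst x hx, CharTwo.add_self_eq_zero]
  · rw [if_neg hst]
    split_ifs with h1 h2
    · exfalso
      refine hst fun y hy => ?_
      by_cases hyY : (y : S) ∈ Y
      · exact h2 ⟨y, hyY⟩ hy
      · exact h1 y hyY
    · simp
    · rfl

/-- A single intermediate configuration contributes: the first factor can change s only on X and the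
second only on Y, so it equals t on X and s elsewhere. -/
theorem embed_mul_embed_apply {X Y Λ : Finset S} (hX : X ⊆ Λ) (hY : Y ⊆ Λ) (hd : Disjoint X Y)
    (M : K.Op X) (N : K.Op Y) (s t : K.Config Λ) :
    (K.embed hX M * K.embed hY N) s t =
      if ∀ y : Λ, (y : S) ∉ X → (y : S) ∉ Y → s y = t y then
        K.jwSign X Λ s (fun y => if (y : S) ∈ X then t y else s y) *
          K.jwSign Y Λ (fun y => if (y : S) ∈ X then t y else s y) t *
          (M (fun x => s ⟨x, hX x.2⟩) (fun x => t ⟨x, hX x.2⟩) *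
          N (fun y => s ⟨y, hY y.2⟩) (fun y => t ⟨y, hY y.2⟩))
      else 0 := by
  have hYX : ∀ y ∈ Y, y ∉ X := fun y hy hx => Finset.disjoint_left.1 hd hx hy
  rw [Matrix.mul_apply, Finset.sum_eq_single (fun y : Λ => if (y : S) ∈ X then t y else s y)]
  · simp only [embed, Matrix.of_apply]
    have h1 : ∀ y : Λ, (y : S) ∉ X → s y = if (y : S) ∈ X then t y else s y := fun y hy => by
      rw [if_neg hy]
    rw [if_pos h1]
    have h2 : (∀ y : Λ, (y : S) ∉ Y → (if (y : S) ∈ X then t y else s y) = t y) ↔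
        ∀ y : Λ, (y : S) ∉ X → (y : S) ∉ Y → s y = t y := by
      refine forall_congr' fun y => ?_
      by_cases hy : (y : S) ∈ X <;> simp [hy]
    simp only [h2]
    split_ifs with h
    · have e1 : (fun x : X => if (x : S) ∈ X then t ⟨x, hX x.2⟩ else s ⟨x, hX x.2⟩)
          = fun x : X => t ⟨x, hX x.2⟩ := funext fun x => if_pos x.2
      have e2 : (fun x : Y => if (x : S) ∈ X then t ⟨x, hY x.2⟩ else s ⟨x, hY x.2⟩)
          = fun x : Y => s ⟨x, hY x.2⟩ := funext fun x => if_neg (hYX x x.2)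
      rw [e1, e2]
      ring
    · rw [mul_zero]
  · intro u _ hu
    simp only [embed, Matrix.of_apply]
    split_ifs with h1 h2
    · exfalso
      refine hu (funext fun y => ?_)
      split_ifs with hy
      · exact h2 y fun hy' => hYX y hy' hy
      · exact (h1 y hy).symm
    all_goals simp
  · simp

/-- Even operators commute with all operators of a disjoint volume. -/
theorem embed_commute_of_isEven {X Y Λ : Finset S} (hX : X ⊆ Λ) (hY : Y ⊆ Λ) (hd : Disjoint X Y)
    {M : K.Op X} (hM : K.IsEven M) (N : K.Op Y) :
    Commute (K.embed hX M) (K.embed hY N) := by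
  have hYX : ∀ y ∈ Y, y ∉ X := fun y hy hx => Finset.disjoint_left.1 hd hx hy
  ext s t
  rw [embed_mul_embed_apply K hX hY hd, embed_mul_embed_apply K hY hX hd.symm]
  have hcond : (∀ y : Λ, (y : S) ∉ Y → (y : S) ∉ X → s y = t y) ↔
      (∀ y : Λ, (y : S) ∉ X → (y : S) ∉ Y → s y = t y) := forall_congr' fun y => by tauto
  simp only [hcond]
  split_ifs with hst
  swap
  · rfl
  by_cases hpar : (∑ x : X, K.par x (s ⟨x, hX x.2⟩)) = (∑ x : X, K.par x (t ⟨x, hX x.2⟩))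
  swap
  · rw [hM _ _ hpar]
    simp
  rw [mul_comm (M _ _)]
  congr 1
  simp only [jwSign_eq, ← zsign_add]
  congr 1
  rw [← sub_eq_zero, CharTwo.sub_eq_add]
  -- The sign exponents of the two orders of multiplication differ by the sum over x ∈ X, y ∈ Y of
  -- the product of the parity changes at x and at y. It factorizes, and the total parity change on
  -- X is zero since M is even.
  have hsum : ∑ y : Λ, ∑ x : Λ, (if (x : S) ∈ X ∧ (y : S) ∈ Y then
      (K.par x (s x) + K.par x (t x)) * (K.par y (s y) + K.par y (t y)) else 0) = 0 := by
    refine Finset.sum_eq_zero fun y _ => ?_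
    by_cases hy : (y : S) ∈ Y
    · have := sum_subtype_eq_ite hX fun x => (K.par x (s x) + K.par x (t x)) *
        (K.par y (s y) + K.par y (t y))
      simp only [hy, and_true]
      rw [← this, ← Finset.sum_mul, Finset.sum_add_distrib, hpar, CharTwo.add_self_eq_zero,
        zero_mul]
    · simp [hy]
  rw [← hsum]
  have hswap : ∀ s t : K.Config Λ, K.jwExp Y Λ s t = ∑ y : Λ, ∑ x : Λ,
      if (x : S) ∉ Y ∧ (y : S) ∈ Y ∧ x < y then
    K.par x (s x) * (K.par y (s y) + K.par y (t y)) else 0 := fun s t => Finset.sum_comm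
  rw [hswap, hswap]
  simp only [jwExp, ← Finset.sum_add_distrib]
  refine Finset.sum_congr rfl fun y _ => Finset.sum_congr rfl fun x _ => ?_
  have h2 : (2 : ZMod 2) = 0 := rfl
  by_cases hx : (x : S) ∈ X
  · have hxY : (x : S) ∉ Y := fun h => hYX x h hx
    by_cases hy : (y : S) ∈ Y
    · have hyX := hYX y hy
      rcases lt_trichotomy x y with hlt | heq | hlt
      · simp only [hx, hy, hxY, hyX, hlt, hlt.not_gt, not_false_eq_true, and_self, and_false,
          if_true, if_false]
        ring
      · exact absurd (heq ▸ hx) hyX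
      · simp only [hx, hy, hxY, hyX, hlt, hlt.not_gt, not_false_eq_true, and_self, and_false,
          if_true, if_false]
        ring
    · simp only [hx, hy, hxY, false_and, and_false, if_false, if_true]
      by_cases hc : (y : S) ∉ X ∧ True ∧ y < x
      · simp only [if_pos hc]
        linear_combination (K.par y (s y) * (K.par x (s x) + K.par x (t x))) * h2
      · simp only [if_neg hc]
        ring
  · by_cases hy : (y : S) ∈ Y
    · have hyX := hYX y hy
      simp only [hx, hy, hyX, false_and, and_false, if_false, if_true]
      by_cases hc : (x : S) ∉ Y ∧ True ∧ x < y
      · simp only [if_pos hc]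
        linear_combination (K.par x (s x) * (K.par y (s y) + K.par y (t y))) * h2
      · simp only [if_neg hc]
        ring
    · simp [hx, hy]

namespace LocalObs

variable {K}

theorem toOp_of_subset {A : K.LocalObs} {Λ : Finset S} (h : A.supp ⊆ Λ) :
    A.toOp Λ = K.embed h A.op := dif_pos h

theorem embed_toOp {A : K.LocalObs} {Y Λ : Finset S} (h : A.supp ⊆ Y) (hY : Y ⊆ Λ) :
    K.embed hY (A.toOp Y) = A.toOp Λ := by
  rw [toOp_of_subset h, toOp_of_subset (h.trans hY), embed_embed]

theorem mul_toOp {A B : K.LocalObs} {Λ : Finset S} (hA : A.supp ⊆ Λ) (hB : B.supp ⊆ Λ) :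
    (A.mul B).toOp Λ = A.toOp Λ * B.toOp Λ := by
  have h : (A.mul B).supp ⊆ Λ := Finset.union_subset hA hB
  rw [toOp_of_subset h]
  change K.embed (Finset.union_subset hA hB)
    (A.toOp (A.supp ∪ B.supp) * B.toOp (A.supp ∪ B.supp)) = _
  rw [embed_mul, embed_toOp Finset.subset_union_left, embed_toOp Finset.subset_union_right]

theorem adj_toOp (A : K.LocalObs) (Λ : Finset S) : A.adj.toOp Λ = (A.toOp Λ).conjTranspose := by
  by_cases h : A.supp ⊆ Λ
  · rw [toOp_of_subset h, embed_conjTranspose]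
    exact toOp_of_subset (A := A.adj) h
  · have h' : ¬ A.adj.supp ⊆ Λ := h
    rw [toOp, toOp, dif_neg h, dif_neg h', Matrix.conjTranspose_zero]

theorem norm_toOp_le (A : K.LocalObs) (Λ : Finset S) : ‖A.toOp Λ‖ ≤ ‖A.op‖ := by
  unfold toOp
  split_ifs with h
  · exact K.norm_embed_le h _
  · rw [norm_zero]
    exact norm_nonneg _

theorem norm_toOp {A : K.LocalObs} {Λ : Finset S} (h : A.supp ⊆ Λ) : ‖A.toOp Λ‖ = ‖A.op‖ := by
  rw [toOp_of_subset h, norm_embed]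

theorem norm_adj_op (A : K.LocalObs) : ‖A.adj.op‖ = ‖A.op‖ :=
  Matrix.l2_opNorm_conjTranspose A.op

theorem BosonicPair.commute_toOp {A B : K.LocalObs} (h : A.BosonicPair B)
    (hd : Disjoint A.supp B.supp) {Λ : Finset S} (hA : A.supp ⊆ Λ) (hB : B.supp ⊆ Λ) :
    Commute (A.toOp Λ) (B.toOp Λ) := by
  rw [← embed_toOp Finset.subset_union_left (Finset.union_subset hA hB),
    ← embed_toOp (A := B) Finset.subset_union_right (Finset.union_subset hA hB)]
  exact (h hd).map (K.embedHom (Finset.union_subset hA hB))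

end LocalObs

end SiteSpaces

/-! ### The group velocity -/

namespace DecayLaw

/-- The exponent of a decay law is positive. -/
def Pos : DecayLaw → Prop
  | power η => 0 < η
  | exponential μ => 0 < μ

theorem profile_pos (D : DecayLaw) (r : ℕ) : 0 < D.profile r := by
  cases D
  · exact Real.rpow_pos_of_pos (by positivity) _
  · exact Real.exp_pos _

theorem profile_zero (D : DecayLaw) : D.profile 0 = 1 := by
  cases D <;> simp [profile]

theorem Pos.profile_antitone {D : DecayLaw} (hD : D.Pos) : Antitone D.profile := by
  intro r r' h
  have h' : (r : ℝ) ≤ r' := by exact_mod_cast h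
  cases D with
  | power η =>
    exact Real.rpow_le_rpow_of_nonpos (by positivity) (by linarith) (neg_nonpos.2 (le_of_lt hD))
  | exponential μ =>
    have : (0 : ℝ) < μ := hD
    exact Real.exp_le_exp.2 (by nlinarith)

end DecayLaw

theorem dist_le_graphDiam {S : Type*} (G : SimpleGraph S) {X : Finset S} {x z : S} (hx : x ∈ X) (hz : z ∈ X) :
    G.dist x z ≤ graphDiam G X :=
  Finset.le_sup (f := fun p : S × S => G.dist p.1 p.2) (Finset.mk_mem_product hx hz)

namespace LatticeSystem

open SiteSpaces

variable {S : Type*} [LinearOrder S] (Q : LatticeSystem S)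

/-- The local Hamiltonian, as an observable. -/
def hObs (n : ℕ) (X : Finset S) : Q.K.LocalObs := ⟨X, Q.h n X⟩

theorem H_eq_sum (n : ℕ) :
    Q.H n = ∑ X ∈ (Q.sites n).powerset, (Q.hObs n X).toOp (Q.sites n) := by
  rw [H, ← Finset.sum_attach (Q.sites n).powerset fun X => (Q.hObs n X).toOp (Q.sites n)]
  exact Finset.sum_congr rfl fun X _ =>
    (LocalObs.toOp_of_subset (A := Q.hObs n X) (Finset.mem_powerset.1 X.2)).symm

theorem evolve_eq_heisenberg (n : ℕ) (t : ℝ) (M : Q.K.Op (Q.sites n)) :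
    Q.evolve n t M = heisenberg (Q.H n) t M := rfl

theorem isSelfAdjoint_hObs (n : ℕ) (X : Finset S) :
    IsSelfAdjoint ((Q.hObs n X).toOp (Q.sites n)) := by
  have h : (Q.hObs n X).adj = Q.hObs n X := by
    simp only [hObs, LocalObs.adj, (Q.h_hermitian n X).eq]
  have := LocalObs.adj_toOp (Q.hObs n X) (Q.sites n)
  rw [h] at this
  exact this.symm

theorem hObs_commute {n : ℕ} {X : Finset S} (hX : X ⊆ Q.sites n) {A : Q.K.LocalObs}
    (hd : Disjoint X A.supp) :
    Commute ((Q.hObs n X).toOp (Q.sites n)) (A.toOp (Q.sites n)) := by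
  by_cases hA : A.supp ⊆ Q.sites n
  · rw [LocalObs.toOp_of_subset (A := Q.hObs n X) hX, LocalObs.toOp_of_subset hA]
    exact embed_commute_of_isEven Q.K hX hA hd (Q.h_even n X) A.op
  · rw [LocalObs.toOp, LocalObs.toOp, dif_neg hA]
    exact Commute.zero_right _

theorem dist_triangle {n : ℕ} {x y : S} (hx : x ∈ Q.sites n) (hy : y ∈ Q.sites n) (z : S) :
    (Q.graph n).dist x z ≤ (Q.graph n).dist x y + (Q.graph n).dist y z :=
  (Q.reachable n x hx y hy).dist_triangle_left z

/-- The interaction satisfies a Lieb–Robinson bound with the velocity `2 u`, if it multiplies the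
decaying function by at most `u`. -/
theorem isVelocityBound_of_sum_le {D : DecayLaw} (hD : D.Pos) {u v : ℝ} (hv : 0 < v)
    (huv : 2 * u ≤ v)
    (hu : ∀ n, ∀ x ∈ Q.sites n, ∀ y ∈ Q.sites n,
      ∑ X ∈ (Q.sites n).powerset with x ∈ X,
        ‖Q.h n X‖ * ∑ z ∈ X, D.profile ((Q.graph n).dist z y)
        ≤ u * D.profile ((Q.graph n).dist x y)) :
    Q.IsVelocityBound D v := by
  refine ⟨hv, 2, two_pos, ?_⟩
  intro n A B hA hB hAB r hr hfar t
  have hdisj : Disjoint A.supp B.supp := by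
    refine Finset.disjoint_left.2 fun x hx hx' => ?_
    have := hfar x hx x hx'
    simp only [SimpleGraph.dist_self] at this
    omega
  have hcomm := hAB.commute_toOp hdisj hA hB
  -- This weight is at least 1 on the support of B, since the profile is 1 at distance 0, and at
  -- most |supp B| times the profile at r on the support of A.
  let φ : S → ℝ := fun z => ∑ y ∈ B.supp, D.profile ((Q.graph n).dist z y)
  have hφ0 : ∀ z, 0 ≤ φ z := fun z => Finset.sum_nonneg fun y _ => (D.profile_pos _).le
  have hφu : ∀ x ∈ Q.sites n, ∑ X ∈ (Q.sites n).powerset with x ∈ X,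
      ‖Q.h n X‖ * ∑ z ∈ X, φ z ≤ u * φ x := by
    intro x hx
    simp only [φ]
    rw [Finset.mul_sum]
    calc _ = ∑ y ∈ B.supp, ∑ X ∈ (Q.sites n).powerset with x ∈ X,
        ‖Q.h n X‖ * ∑ z ∈ X, D.profile ((Q.graph n).dist z y) := by
          rw [Finset.sum_comm]
          refine Finset.sum_congr rfl fun X _ => ?_
          rw [Finset.sum_comm, Finset.mul_sum]
      _ ≤ _ := Finset.sum_le_sum fun y hy => hu n x hx y (hB hy)
  have hφ1 : ∀ y ∈ B.supp, 1 ≤ φ y := by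
    intro y hy
    have := Finset.single_le_sum (f := fun y' => D.profile ((Q.graph n).dist y y'))
      (fun y' _ => (D.profile_pos _).le) hy
    simpa [D.profile_zero] using this
  have hnorm : ∀ X, ‖(Q.hObs n X).toOp (Q.sites n)‖ ≤ ‖Q.h n X‖ :=
    fun X => LocalObs.norm_toOp_le (Q.hObs n X) _
  have hc : ∀ Z ∈ (Q.sites n).powerset, ∀ Z' ∈ (Q.sites n).powerset, Disjoint Z Z' →
      Commute ((Q.hObs n Z).toOp (Q.sites n)) ((Q.hObs n Z').toOp (Q.sites n)) :=
    fun Z hZ Z' _ hd => Q.hObs_commute (A := Q.hObs n Z') (Finset.mem_powerset.1 hZ) hd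
  have hcA : ∀ C : Q.K.LocalObs, ∀ Z ∈ (Q.sites n).powerset, Disjoint Z C.supp →
      Commute ((Q.hObs n Z).toOp (Q.sites n)) (C.toOp (Q.sites n)) :=
    fun C Z hZ hd => Q.hObs_commute (Finset.mem_powerset.1 hZ) hd
  have hLR : ‖Q.evolve n t (A.toOp _) * B.toOp _ - B.toOp _ * Q.evolve n t (A.toOp _)‖
      ≤ 2 * ‖A.toOp (Q.sites n)‖ * ‖B.toOp (Q.sites n)‖ *
        ∑ x ∈ A.supp, φ x * (Real.exp (2 * u * |t|) - 1) := by
    rw [evolve_eq_heisenberg, H_eq_sum]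
    rcases le_total 0 t with ht | ht
    · rw [abs_of_nonneg ht]
      exact lieb_robinson (Q.isSelfAdjoint_hObs n) hnorm hc hφ0 hφu hA hφ1 (hcA A) (hcA B) hcomm ht
    · rw [abs_of_nonpos ht]
      -- Negative times are positive times for the Hamiltonian -H.
      have := lieb_robinson (h := fun X => -(Q.hObs n X).toOp (Q.sites n))
        (fun X => (Q.isSelfAdjoint_hObs n X).neg) (fun X => (norm_neg _).trans_le (hnorm X))
        (fun Z hZ Z' hZ' hd => ((hc Z hZ Z' hZ' hd).neg_left).neg_right) hφ0 hφu hA hφ1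
        (fun Z hZ hd => (hcA A Z hZ hd).neg_left) (fun Z hZ hd => (hcA B Z hZ hd).neg_left) hcomm
        (neg_nonneg.2 ht)
      simpa only [Finset.sum_neg_distrib, heisenberg_neg_left, neg_neg] using this
  have hφr : ∀ x ∈ A.supp, φ x ≤ B.supp.card * D.profile r := by
    intro x hx
    calc φ x ≤ ∑ y ∈ B.supp, D.profile r :=
          Finset.sum_le_sum fun y hy => hD.profile_antitone (hfar x hx y hy)
      _ = _ := by simp
  have hexp : Real.exp (2 * u * |t|) - 1 ≤ Real.exp (v * |t|) - 1 := by
    gcongr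
  have hexp0 : 0 ≤ Real.exp (v * |t|) - 1 := by
    have : 0 ≤ v * |t| := by positivity
    linarith [Real.add_one_le_exp (v * |t|)]
  refine hLR.trans ?_
  calc _ ≤ 2 * ‖A.op‖ * ‖B.op‖ *
        ∑ x ∈ A.supp, (B.supp.card * D.profile r) * (Real.exp (v * |t|) - 1) := by
        have hs : ∑ x ∈ A.supp, φ x * (Real.exp (2 * u * |t|) - 1) ≤
            ∑ x ∈ A.supp, (B.supp.card * D.profile r) * (Real.exp (v * |t|) - 1) :=
          Finset.sum_le_sum fun x hx =>
            (mul_le_mul_of_nonneg_left hexp (hφ0 x)).trans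
              (mul_le_mul_of_nonneg_right (hφr x hx) hexp0)
        have hs0 : 0 ≤ ∑ x ∈ A.supp, (B.supp.card * D.profile r) * (Real.exp (v * |t|) - 1) := by
          have := (D.profile_pos r).le
          exact Finset.sum_nonneg fun x _ => by positivity
        calc _ ≤ 2 * ‖A.toOp (Q.sites n)‖ * ‖B.toOp (Q.sites n)‖ *
              ∑ x ∈ A.supp, (B.supp.card * D.profile r) * (Real.exp (v * |t|) - 1) := by gcongr
          _ ≤ _ := by
            gcongr
            · exact LocalObs.norm_toOp_le A _
            · exact LocalObs.norm_toOp_le B _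
    _ = _ := by
      rw [Finset.sum_const, nsmul_eq_mul]
      ring

/-- Exchanging the sums over X and z ∈ X leaves, for each z, the sum over the X that contain both x
and z. This brings in the two-point conditions, the first forms of decay. -/
theorem sum_norm_mul_sum_le {n : ℕ} {x : S} {f g : S → ℝ} (hf : ∀ z, 0 ≤ f z)
    (hg : ∀ z ∈ Q.sites n, ∑ X ∈ (Q.sites n).powerset with x ∈ X ∧ z ∈ X, ‖Q.h n X‖ ≤ g z) :
    ∑ X ∈ (Q.sites n).powerset with x ∈ X, ‖Q.h n X‖ * ∑ z ∈ X, f z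
      ≤ ∑ z ∈ Q.sites n, g z * f z := by
  have h1 : ∀ X ∈ (Q.sites n).powerset.filter (fun X => x ∈ X), ‖Q.h n X‖ * ∑ z ∈ X, f z
      = ∑ z ∈ Q.sites n, if z ∈ X then ‖Q.h n X‖ * f z else 0 := by
    intro X hX
    rw [← Finset.sum_filter, Finset.mul_sum]
    refine Finset.sum_congr ?_ fun _ _ => rfl
    ext z
    have : X ⊆ Q.sites n := Finset.mem_powerset.1 (Finset.mem_filter.1 hX).1
    rw [Finset.mem_filter]
    exact ⟨fun h => ⟨this h, h⟩, fun h => h.2⟩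
  rw [Finset.sum_congr rfl h1, Finset.sum_comm]
  refine Finset.sum_le_sum fun z hz => ?_
  rw [← Finset.sum_filter, Finset.filter_filter, ← Finset.sum_mul]
  exact mul_le_mul_of_nonneg_right (hg z hz) (hf z)

theorem PowerDecay.isVelocityBound {η lam p : ℝ} (h : Q.PowerDecay η lam p) :
    Q.IsVelocityBound (.power η) (2 * lam * p) := by
  have hlam := h.lam_pos
  have hp := h.p_pos
  have hrw : ∀ r : ℕ, (DecayLaw.power η).profile r = 1 / (1 + (r : ℝ)) ^ η := fun r => by
    rw [DecayLaw.profile, Real.rpow_neg (by positivity), one_div]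
  refine Q.isVelocityBound_of_sum_le (D := .power η) h.η_pos (u := lam * p) (by positivity)
    (by linarith) fun n x hx y hy => ?_
  refine (Q.sum_norm_mul_sum_le (f := fun z => (DecayLaw.power η).profile ((Q.graph n).dist z y))
    (fun z => (DecayLaw.profile_pos _ _).le) fun z hz => h.h_le n x hx z hz).trans ?_
  simp only [hrw]
  calc _ = lam * ∑ z ∈ Q.sites n, 1 / (1 + ((Q.graph n).dist x z : ℝ)) ^ η
        * (1 / (1 + ((Q.graph n).dist z y : ℝ)) ^ η) := by
        rw [Finset.mul_sum]
        refine Finset.sum_congr rfl fun z _ => ?_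
        ring
    _ ≤ lam * (p / (1 + ((Q.graph n).dist x y : ℝ)) ^ η) :=
        mul_le_mul_of_nonneg_left (h.lattice_le n x hx y hy) hlam.le
    _ = _ := by ring

/-- For the second forms of decay: moving from x to another point z of X changes the distance to y
by at most the diameter of X, at the price of the factor w(diam X); the sum over z gives |X|. -/
theorem sum_norm_mul_profile_le {D : DecayLaw} {s : ℝ} {w : ℕ → ℝ}
    (hw : ∀ a b c : ℕ, b ≤ a + c → D.profile c ≤ w a * D.profile b)
    (h : ∀ n, ∀ x ∈ Q.sites n, ∑ X ∈ (Q.sites n).powerset with x ∈ X,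
      ‖Q.h n X‖ * (X.card : ℝ) * w (graphDiam (Q.graph n) X) ≤ s)
    (n : ℕ) {x : S} (hx : x ∈ Q.sites n) (y : S) :
    ∑ X ∈ (Q.sites n).powerset with x ∈ X,
        ‖Q.h n X‖ * ∑ z ∈ X, D.profile ((Q.graph n).dist z y)
        ≤ s * D.profile ((Q.graph n).dist x y) := by
  refine le_trans ?_ (mul_le_mul_of_nonneg_right (h n x hx) (D.profile_pos _).le)
  rw [Finset.sum_mul]
  refine Finset.sum_le_sum fun X hX => ?_
  rw [Finset.mem_filter, Finset.mem_powerset] at hX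
  rw [mul_assoc, mul_assoc]
  refine mul_le_mul_of_nonneg_left ?_ (norm_nonneg _)
  calc _ ≤ ∑ z ∈ X, w (graphDiam (Q.graph n) X) * D.profile ((Q.graph n).dist x y) := by
        refine Finset.sum_le_sum fun z hz => hw _ _ _ ?_
        refine (Q.dist_triangle (hX.1 hX.2) (hX.1 hz) y).trans ?_
        exact Nat.add_le_add_right (dist_le_graphDiam _ hX.2 hz) _
    _ = _ := by simp

theorem PowerDecaySum.isVelocityBound {η s : ℝ} (h : Q.PowerDecaySum η s) :
    Q.IsVelocityBound (.power η) (2 * s) := by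
  have hs := h.s_pos
  refine Q.isVelocityBound_of_sum_le (D := .power η) h.η_pos (u := s) (by positivity) le_rfl
    fun n x hx y _ => ?_
  refine Q.sum_norm_mul_profile_le (w := fun r => (1 + (r : ℝ)) ^ η) ?_ h.h_le n hx y
  intro a b c hbc
  have hbc' : (b : ℝ) ≤ a + c := by exact_mod_cast hbc
  simp only [DecayLaw.profile]
  rw [Real.rpow_neg (by positivity), Real.rpow_neg (by positivity), inv_eq_one_div,
    ← div_eq_mul_inv, div_le_div_iff₀ (by positivity) (by positivity), one_mul,
    ← Real.mul_rpow (by positivity) (by positivity)]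
  refine Real.rpow_le_rpow (by positivity) ?_ h.η_pos.le
  have : (0 : ℝ) ≤ a * c := by positivity
  nlinarith

theorem ExpDecaySum.isVelocityBound {μ s : ℝ} (h : Q.ExpDecaySum μ s) :
    Q.IsVelocityBound (.exponential μ) (2 * s) := by
  have hs := h.s_pos
  have hμ := h.μ_pos
  refine Q.isVelocityBound_of_sum_le (D := .exponential μ) hμ (u := s) (by positivity) le_rfl
    fun n x hx y _ => ?_
  refine Q.sum_norm_mul_profile_le (w := fun r => Real.exp (μ * r)) ?_ h.h_le n hx y
  intro a b c hbc
  have hbc' : (b : ℝ) ≤ a + c := by exact_mod_cast hbc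
  simp only [DecayLaw.profile]
  rw [← Real.exp_add]
  refine Real.exp_le_exp.2 ?_
  nlinarith

theorem bddAbove_expPolyConst {ε : ℝ} (hε : 0 < ε) (η : ℝ) :
    BddAbove (Set.range fun r : ℕ => Real.exp (-ε * r) * (1 + (r : ℝ)) ^ η) := by
  have h1 := tendsto_rpow_mul_exp_neg_mul_atTop_nhds_zero η ε hε
  have h2 : Tendsto (fun r : ℕ => 1 + (r : ℝ)) atTop atTop :=
    tendsto_atTop_add_const_left _ _ tendsto_natCast_atTop_atTop
  have h3 := ((h1.comp h2).const_mul (Real.exp ε)).bddAbove_range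
  refine h3.mono ?_
  rintro _ ⟨r, rfl⟩
  refine ⟨r, ?_⟩
  simp only [Function.comp]
  rw [mul_left_comm, ← Real.exp_add, mul_comm]
  congr 2
  ring

theorem exp_le_expPolyConst {ε : ℝ} (hε : 0 < ε) (η : ℝ) (r : ℕ) :
    Real.exp (-ε * r) ≤ expPolyConst ε η * (1 / (1 + (r : ℝ)) ^ η) := by
  have : Real.exp (-ε * r) * (1 + (r : ℝ)) ^ η ≤ expPolyConst ε η :=
    le_ciSup (bddAbove_expPolyConst hε η) r
  rw [mul_one_div, le_div_iff₀ (by positivity)]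
  exact this

theorem ExpDecay.isVelocityBound [Infinite S] {μ ε lam η σ : ℝ} (h : Q.ExpDecay μ ε lam η σ) :
    Q.IsVelocityBound (.exponential μ)
      (2 * (lam * expPolyConst ε η) * (2 ^ (η + 1) * σ)) := by
  have hlam := h.lam_pos
  have hμ := h.μ_pos
  have hσ : 0 < σ := by
    obtain ⟨x⟩ : Nonempty S := inferInstance
    obtain ⟨n, hn⟩ := (Q.eventually_mem x).exists
    refine lt_of_lt_of_le one_pos (le_trans ?_ (h.lattice_le n x hn))
    have := Finset.single_le_sum (f := fun y => 1 / (1 + ((Q.graph n).dist x y : ℝ)) ^ η)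
      (fun y _ => by positivity) hn
    simpa using this
  have hc : 1 ≤ expPolyConst ε η := by
    simpa using exp_le_expPolyConst h.ε_pos η 0
  -- The argument below already works with the rate λ₀λ₀'σ, so the factor 2^(η+1) ≥ 1 only enlarges
  -- the velocity.
  have h2 : (1 : ℝ) ≤ 2 ^ (η + 1) := Real.one_le_rpow one_le_two (by linarith [h.η_pos])
  refine Q.isVelocityBound_of_sum_le (D := .exponential μ) hμ (u := lam * expPolyConst ε η * σ)
    (by positivity) ?_ fun n x hx y hy => ?_
  · have : lam * expPolyConst ε η * σ ≤ lam * expPolyConst ε η * (2 ^ (η + 1) * σ) :=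
      mul_le_mul_of_nonneg_left (le_mul_of_one_le_left hσ.le h2) (by positivity)
    linarith
  refine (Q.sum_norm_mul_sum_le
    (f := fun z => (DecayLaw.exponential μ).profile ((Q.graph n).dist z y))
    (fun z => (DecayLaw.profile_pos _ _).le) fun z hz => h.h_le n x hx z hz).trans ?_
  simp only [DecayLaw.profile]
  calc _ ≤ ∑ z ∈ Q.sites n, lam * expPolyConst ε η * Real.exp (-μ * (Q.graph n).dist x y) *
        (1 / (1 + ((Q.graph n).dist x z : ℝ)) ^ η) := by
        refine Finset.sum_le_sum fun z hz => ?_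
        have h1 := exp_le_expPolyConst h.ε_pos η ((Q.graph n).dist x z)
        -- The triangle inequality uses up the rate μ. The surplus exp(-ε dist(x,z)) is left to make
        -- the sum over z converge.
        have h3 : Real.exp (-μ * (Q.graph n).dist x z) * Real.exp (-μ * (Q.graph n).dist z y)
            ≤ Real.exp (-μ * (Q.graph n).dist x y) := by
          rw [← Real.exp_add]
          refine Real.exp_le_exp.2 ?_
          have : ((Q.graph n).dist x y : ℝ) ≤ (Q.graph n).dist x z + (Q.graph n).dist z y := by
            exact_mod_cast Q.dist_triangle hx hz y
          nlinarith
        have h4 : Real.exp (-(μ + ε) * (Q.graph n).dist x z) =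
            Real.exp (-μ * (Q.graph n).dist x z) * Real.exp (-ε * (Q.graph n).dist x z) := by
          rw [← Real.exp_add]
          congr 1
          ring
        rw [h4]
        calc _ = lam * (Real.exp (-μ * (Q.graph n).dist x z) *
              Real.exp (-μ * (Q.graph n).dist z y)) * Real.exp (-ε * (Q.graph n).dist x z) := by
              ring
          _ ≤ lam * Real.exp (-μ * (Q.graph n).dist x y) *
              (expPolyConst ε η * (1 / (1 + ((Q.graph n).dist x z : ℝ)) ^ η)) := by gcongr
          _ = _ := by ring
    _ ≤ lam * expPolyConst ε η * Real.exp (-μ * (Q.graph n).dist x y) * σ := by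
        rw [← Finset.mul_sum]
        exact mul_le_mul_of_nonneg_left (h.lattice_le n x hx) (by positivity)
    _ = _ := by ring

theorem InteractionDecay.pos {D : DecayLaw} {v : ℝ} (h : Q.InteractionDecay D v) : D.Pos := by
  cases D with
  | power η =>
    rcases h with ⟨lam, p, h, -⟩ | ⟨s, h, -⟩
    exacts [h.η_pos, h.η_pos]
  | exponential μ =>
    rcases h with ⟨ε, lam, η, σ, h, -⟩ | ⟨s, h, -⟩
    exacts [h.μ_pos, h.μ_pos]

theorem InteractionDecay.isVelocityBound [Infinite S] {D : DecayLaw} {v : ℝ}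
    (h : Q.InteractionDecay D v) : Q.IsVelocityBound D v := by
  cases D with
  | power η =>
    rcases h with ⟨lam, p, h, rfl⟩ | ⟨s, h, rfl⟩
    exacts [PowerDecay.isVelocityBound Q h, PowerDecaySum.isVelocityBound Q h]
  | exponential μ =>
    rcases h with ⟨ε, lam, η, σ, h, rfl⟩ | ⟨s, h, rfl⟩
    exacts [ExpDecay.isVelocityBound Q h, ExpDecaySum.isVelocityBound Q h]

end LatticeSystem

/-! ### The Gaussian sign filter -/

section GaussianFilter

open MeasureTheory Set Real

/-- The filter `∫₀^∞ exp(-b t²) (2 sin(ω t) / t) dt`, a smooth version of `π sign ω`. -/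
def gaussSign (b ω : ℝ) : ℝ := ∫ t in Ioi (0 : ℝ), exp (-b * t ^ 2) * (2 * ω * sinc (ω * t))

theorem integrable_gaussSign {b : ℝ} (hb : 0 < b) (ω : ℝ) :
    Integrable fun t : ℝ => exp (-b * t ^ 2) * (2 * ω * sinc (ω * t)) := by
  have hc := continuous_sinc
  refine ((integrable_exp_neg_mul_sq hb).mul_const (2 * |ω|)).mono'
    (Continuous.aestronglyMeasurable (by fun_prop)) (Eventually.of_forall fun t => ?_)
  rw [norm_mul, norm_of_nonneg (exp_pos _).le]
  refine mul_le_mul_of_nonneg_left ?_ (exp_pos _).le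
  rw [norm_eq_abs, abs_mul, abs_mul, abs_two]
  exact mul_le_of_le_one_right (by positivity) (abs_sinc_le_one _)

theorem gaussSign_neg (b ω : ℝ) : gaussSign b (-ω) = -gaussSign b ω := by
  simp only [gaussSign, ← integral_neg]
  congr 1
  funext t
  rw [show -ω * t = -(ω * t) by ring, sinc_neg]
  ring

theorem abs_gaussSign_le {b : ℝ} (hb : 0 < b) (ω : ℝ) : |gaussSign b ω| ≤ |ω| * √(π / b) := by
  have h1 : ‖gaussSign b ω‖ ≤ ∫ t in Ioi (0 : ℝ), exp (-b * t ^ 2) * (2 * |ω|) := by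
    refine norm_integral_le_of_norm_le
      (((integrable_exp_neg_mul_sq hb).mul_const (2 * |ω|)).integrableOn)
      (Eventually.of_forall fun t => ?_)
    rw [norm_mul, norm_of_nonneg (exp_pos _).le]
    refine mul_le_mul_of_nonneg_left ?_ (exp_pos _).le
    rw [norm_eq_abs, abs_mul, abs_mul, abs_two]
    exact mul_le_of_le_one_right (by positivity) (abs_sinc_le_one _)
  rw [integral_mul_const, integral_gaussian_Ioi] at h1
  calc |gaussSign b ω| ≤ _ := h1
    _ = _ := by ring

/-- The real part of the Fourier transform of a Gaussian; the factor 2 comes from folding the even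
integrand onto the half line. -/
theorem integral_exp_mul_cos {b : ℝ} (hb : 0 < b) (ω : ℝ) :
    ∫ t in Ioi (0 : ℝ), exp (-b * t ^ 2) * (2 * cos (ω * t))
      = √(π / b) * exp (-(1 / (4 * b)) * ω ^ 2) := by
  have h1 : ∫ t : ℝ, exp (-b * t ^ 2) * cos (ω * t)
      = √(π / b) * exp (-(1 / (4 * b)) * ω ^ 2) := by
    have h2 := fourierIntegral_gaussian (b := (b : ℂ)) (by simpa using hb) (ω : ℂ)
    have h3 : Integrable fun t : ℝ => Complex.exp (Complex.I * ω * t) *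
        Complex.exp (-b * (t : ℂ) ^ 2) := by
      have := integrable_cexp_quadratic (b := (b : ℂ)) (by simpa using hb) (Complex.I * ω) 0
      refine this.congr (Eventually.of_forall fun t => ?_)
      simp only
      rw [← Complex.exp_add]
      congr 1
      ring
    have h4 := congrArg Complex.re h2
    have h5 := integral_re h3
    simp only [RCLike.re_eq_complex_re] at h5
    rw [← h5] at h4
    have e1 : ∀ t : ℝ, (Complex.exp (Complex.I * ω * t) * Complex.exp (-b * (t : ℂ) ^ 2)).re
        = exp (-b * t ^ 2) * cos (ω * t) := by
      intro t
      have e2 : Complex.exp (-b * (t : ℂ) ^ 2) = ((exp (-b * t ^ 2) : ℝ) : ℂ) := by push_cast; rfl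
      have e3 : Complex.I * ω * t = ((ω * t : ℝ) : ℂ) * Complex.I := by push_cast; ring
      rw [e2, e3, mul_comm, Complex.re_ofReal_mul, Complex.exp_ofReal_mul_I_re]
    simp only [e1] at h4
    rw [h4]
    have e4 : ((π : ℂ) / b) ^ (1 / 2 : ℂ) = ((√(π / b) : ℝ) : ℂ) := by
      rw [Real.sqrt_eq_rpow, Complex.ofReal_cpow (by positivity)]
      push_cast
      rfl
    have e5 : Complex.exp (-(ω : ℂ) ^ 2 / (4 * b)) = ((exp (-(1 / (4 * b)) * ω ^ 2) : ℝ) : ℂ) := by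
      push_cast
      congr 1
      ring
    rw [e4, e5, ← Complex.ofReal_mul, Complex.ofReal_re]
  rw [← h1]
  have h6 := integral_comp_abs (f := fun t : ℝ => exp (-b * t ^ 2) * cos (ω * t))
  have h7 : ∀ t : ℝ, cos (ω * |t|) = cos (ω * t) := fun t => by
    rcases abs_choice t with h | h <;> rw [h]
    rw [mul_neg, cos_neg]
  simp only [sq_abs, h7] at h6
  rw [h6, ← integral_const_mul]
  congr 1
  funext t
  ring

/-- Differentiation in ω cancels the 1/t of the filter and leaves the cosine transform of a
Gaussian. So the filter is the primitive of a Gaussian, a rescaled error function. -/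
theorem hasDerivAt_gaussSign {b : ℝ} (hb : 0 < b) (ω : ℝ) :
    HasDerivAt (gaussSign b) (√(π / b) * exp (-(1 / (4 * b)) * ω ^ 2)) ω := by
  have hc := continuous_sinc
  have := (hasDerivAt_integral_of_dominated_loc_of_deriv_le (μ := volume.restrict (Ioi (0 : ℝ)))
    (F := fun ω t => exp (-b * t ^ 2) * (2 * ω * sinc (ω * t)))
    (F' := fun ω t => exp (-b * t ^ 2) * (2 * cos (ω * t))) (x₀ := ω) (s := univ)
    (bound := fun t => exp (-b * t ^ 2) * 2) univ_mem
    (Eventually.of_forall fun w => Continuous.aestronglyMeasurable (by fun_prop))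
    (integrable_gaussSign hb ω).integrableOn
    (Continuous.aestronglyMeasurable (by fun_prop))
    (Eventually.of_forall fun t w _ => ?_)
    ((integrable_exp_neg_mul_sq hb).mul_const 2).integrableOn ?_).2
  · rwa [integral_exp_mul_cos hb] at this
  · rw [norm_mul, norm_of_nonneg (exp_pos _).le]
    refine mul_le_mul_of_nonneg_left ?_ (exp_pos _).le
    rw [norm_eq_abs, abs_mul, abs_two]
    exact mul_le_of_le_one_right (by positivity) (abs_cos_le_one _)
  · refine (ae_restrict_mem measurableSet_Ioi).mono fun t (ht : 0 < t) w _ => ?_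
    have e : ∀ w : ℝ, 2 * w * sinc (w * t) = 2 / t * sin (w * t) := by
      intro w
      by_cases hw : w = 0
      · simp [hw]
      · rw [sinc_of_ne_zero (by positivity)]
        field_simp
    simp only [e]
    have d1 : HasDerivAt (fun w : ℝ => w * t) t w := by
      simpa using (hasDerivAt_id w).mul_const t
    refine ((d1.sin.const_mul (2 / t)).const_mul _).congr_deriv ?_
    field_simp

theorem gaussSign_eq_integral {b : ℝ} (hb : 0 < b) (ω : ℝ) :
    gaussSign b ω = ∫ u in (0 : ℝ)..ω, √(π / b) * exp (-(1 / (4 * b)) * u ^ 2) := by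
  rw [intervalIntegral.integral_eq_sub_of_hasDerivAt (f := gaussSign b)
    (fun u _ => hasDerivAt_gaussSign hb u)
    (Continuous.intervalIntegrable (by fun_prop) _ _)]
  have : gaussSign b 0 = 0 := by simp [gaussSign]
  rw [this, sub_zero]

/-- The derivative of the filter has total mass π on the half line, so the deviation is its tail
beyond ω. Shifting the tail to the origin gains exp(-ω²/4b), because (u+ω)² ≥ u² + ω² for u, ω ≥ 0.
-/
theorem abs_pi_sub_gaussSign_le {b ω : ℝ} (hb : 0 < b) (hω : 0 ≤ ω) :
    |π - gaussSign b ω| ≤ π * exp (-(1 / (4 * b)) * ω ^ 2) := by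
  set G : ℝ → ℝ := fun u => √(π / b) * exp (-(1 / (4 * b)) * u ^ 2) with hG
  have hG0 : ∀ u, 0 ≤ G u := fun u => by positivity
  have hGc : Continuous G := by fun_prop
  have hGi : Integrable G := (integrable_exp_neg_mul_sq (by positivity)).const_mul _
  have hGtot : ∫ u in Ioi (0 : ℝ), G u = π := by
    rw [integral_const_mul, integral_gaussian_Ioi, mul_div_assoc', ← Real.sqrt_mul (by positivity)]
    have : π / b * (π / (1 / (4 * b))) = (2 * π) ^ 2 := by field_simp; norm_num
    rw [this, Real.sqrt_sq (by positivity)]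
    ring
  have hlim : Tendsto (fun N : ℝ => gaussSign b N) atTop (𝓝 π) := by
    have := intervalIntegral_tendsto_integral_Ioi 0 hGi.integrableOn tendsto_id
    rw [hGtot] at this
    exact this.congr fun N => (gaussSign_eq_integral hb N).symm
  have hii : ∀ x y, IntervalIntegrable G volume x y := fun x y => hGc.intervalIntegrable x y
  have hdiff : ∀ N, gaussSign b N - gaussSign b ω = ∫ u in ω..N, G u := fun N => by
    rw [gaussSign_eq_integral hb, gaussSign_eq_integral hb]
    exact intervalIntegral.integral_interval_sub_left (hii _ _) (hii _ _)
  have hlim2 := hlim.sub_const (gaussSign b ω)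
  rw [abs_le]
  constructor
  · refine le_trans (neg_nonpos.2 (by positivity)) (ge_of_tendsto hlim2 ?_)
    filter_upwards [eventually_ge_atTop ω] with N hN
    rw [hdiff]
    exact intervalIntegral.integral_nonneg hN fun u _ => hG0 u
  · refine le_of_tendsto hlim2 ?_
    filter_upwards [eventually_ge_atTop ω] with N hN
    rw [hdiff]
    have hN' : 0 ≤ N - ω := sub_nonneg.2 hN
    have e := intervalIntegral.integral_comp_add_right (a := 0) (b := N - ω) G ω
    rw [zero_add, sub_add_cancel] at e
    rw [← e]
    calc ∫ u in (0 : ℝ)..(N - ω), G (u + ω)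
        ≤ ∫ u in (0 : ℝ)..(N - ω), G u * exp (-(1 / (4 * b)) * ω ^ 2) := by
          refine intervalIntegral.integral_mono_on hN'
            ((hGc.comp (by fun_prop)).intervalIntegrable _ _)
            ((hGc.mul continuous_const).intervalIntegrable _ _) fun u hu => ?_
          simp only [hG]
          rw [mul_assoc, ← Real.exp_add]
          refine mul_le_mul_of_nonneg_left (Real.exp_le_exp.2 ?_) (by positivity)
          have : 0 ≤ 1 / (4 * b) * (2 * u * ω) := by
            have := hu.1
            positivity
          nlinarith
      _ = (∫ u in (0 : ℝ)..(N - ω), G u) * exp (-(1 / (4 * b)) * ω ^ 2) := by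
          rw [intervalIntegral.integral_mul_const]
      _ ≤ π * exp (-(1 / (4 * b)) * ω ^ 2) := by
          refine mul_le_mul_of_nonneg_right ?_ (exp_pos _).le
          rw [← hGtot, intervalIntegral.integral_of_le hN']
          exact setIntegral_mono_set hGi.integrableOn (Eventually.of_forall hG0)
            (Eventually.of_forall fun u (hu : u ∈ Ioc 0 (N - ω)) => hu.1)

/-- A symmetric bound for frequencies above a gap. -/
theorem abs_pi_sub_gaussSign_le_of_le {b ω g : ℝ} (hb : 0 < b) (hg : 0 ≤ g) (hω : g ≤ ω) :
    |π - gaussSign b ω| ≤ π * exp (-(1 / (4 * b)) * g ^ 2) := by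
  refine (abs_pi_sub_gaussSign_le hb (hg.trans hω)).trans ?_
  refine mul_le_mul_of_nonneg_left (Real.exp_le_exp.2 ?_) pi_pos.le
  have : g ^ 2 ≤ ω ^ 2 := by gcongr
  have h4 : 0 < 1 / (4 * b) := by positivity
  nlinarith

end GaussianFilter

/-! ### Filtering a function of time that grows slowly -/

section FilterBound

open MeasureTheory Set

theorem norm_exp_sub_exp_neg_div (ω t : ℝ) (ht : t ≠ 0) :
    (Complex.exp (t * ω * Complex.I) - Complex.exp (-t * ω * Complex.I)) / t
      = ((2 * ω * Real.sinc (ω * t) : ℝ) : ℂ) * Complex.I := by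
  have e1 : (t : ℂ) * ω * Complex.I = ((ω * t : ℝ) : ℂ) * Complex.I := by push_cast; ring
  have e2 : -(t : ℂ) * ω * Complex.I = ((-(ω * t) : ℝ) : ℂ) * Complex.I := by push_cast; ring
  have htc : (t : ℂ) ≠ 0 := by exact_mod_cast ht
  by_cases hω : ω = 0
  · simp [hω]
  have hωc : (ω : ℂ) ≠ 0 := by exact_mod_cast hω
  rw [e1, e2, Complex.exp_mul_I, Complex.exp_mul_I, Real.sinc_of_ne_zero (mul_ne_zero hω ht)]
  push_cast
  rw [Complex.cos_neg, Complex.sin_neg]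
  field_simp
  ring

theorem exp_sub_one_le_mul_exp (x : ℝ) : Real.exp x - 1 ≤ x * Real.exp x := by
  have h := Real.add_one_le_exp (-x)
  have h2 : Real.exp (-x) * Real.exp x = 1 := by rw [← Real.exp_add]; simp
  nlinarith [Real.exp_pos x]

/-- A trigonometric sum that grows slowly for `|t| ≤ T` is almost annihilated by the sign filter. -/
theorem norm_sum_mul_gaussSign_le {ι : Type*} (s : Finset ι) (p : ι → ℂ) (ω : ι → ℝ)
    {b T v M N₀ : ℝ} (hb : 0 < b) (hT : 0 < T) (hM : 0 ≤ M) (hN : 0 ≤ N₀)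
    (hf : ∀ t : ℝ, ‖∑ k ∈ s, p k * Complex.exp (t * ω k * Complex.I)‖
      ≤ M * (Real.exp (v * |t|) - 1))
    (hf' : ∀ t : ℝ, ‖∑ k ∈ s, p k * Complex.exp (t * ω k * Complex.I)‖ ≤ N₀) :
    ‖∑ k ∈ s, p k * (gaussSign b (ω k) : ℂ)‖
      ≤ 2 * M * Real.exp (v * T) + 2 * N₀ * (Real.exp (-b * T ^ 2) / (b * T ^ 2)) := by
  set f : ℝ → ℂ := fun t => ∑ k ∈ s, p k * Complex.exp (t * ω k * Complex.I) with hfdef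
  set F : ℝ → ℂ := fun t => ∑ k ∈ s, p k *
    ((Real.exp (-b * t ^ 2) * (2 * ω k * Real.sinc (ω k * t)) : ℝ) : ℂ) with hF
  have hFi : Integrable F := integrable_finsetSum _ fun k _ =>
    ((integrable_gaussSign hb (ω k)).ofReal).const_mul _
  have hint : ∑ k ∈ s, p k * (gaussSign b (ω k) : ℂ) = ∫ t in Ioi (0 : ℝ), F t := by
    rw [integral_finsetSum]
    · refine Finset.sum_congr rfl fun k _ => ?_
      rw [integral_const_mul, integral_complex_ofReal, gaussSign]
    · exact fun k _ => (((integrable_gaussSign hb (ω k)).ofReal).const_mul _).integrableOn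
  -- The filter sees only the odd part of f, divided by t.
  have hFt : ∀ t : ℝ, 0 < t → ‖F t‖ = Real.exp (-b * t ^ 2) * ‖f t - f (-t)‖ / t := by
    intro t ht
    have : F t * Complex.I = (Real.exp (-b * t ^ 2) : ℂ) * ((f t - f (-t)) / t) := by
      simp only [hF, hfdef, ← Finset.sum_sub_distrib, Finset.sum_mul, Finset.sum_div,
        Finset.mul_sum]
      refine Finset.sum_congr rfl fun k _ => ?_
      rw [← mul_sub, mul_div_assoc]
      have := norm_exp_sub_exp_neg_div (ω k) t ht.ne'
      push_cast at this ⊢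
      rw [this]
      ring
    have h2 := congrArg norm this
    rw [norm_mul, Complex.norm_I, mul_one, norm_mul, norm_div, Complex.norm_real, Complex.norm_real,
      Real.norm_of_nonneg (Real.exp_pos _).le, Real.norm_of_nonneg ht.le] at h2
    rw [h2, mul_div_assoc]
  -- Up to time T the growth bound is used. It vanishes at t = 0, so exp(vt) - 1 ≤ vt exp(vt)
  -- cancels the 1/t. After T the uniform bound N₀ is used, with 1/t ≤ 1/T and exp(-bt²) ≤
  -- exp(-bTt).
  rw [hint, ← Ioc_union_Ioi_eq_Ioi hT.le, setIntegral_union (Ioc_disjoint_Ioi le_rfl)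
    measurableSet_Ioi hFi.integrableOn hFi.integrableOn]
  refine (norm_add_le _ _).trans (add_le_add ?_ ?_)
  · have hc : Continuous fun t : ℝ => 2 * M * (v * Real.exp (v * t)) := by fun_prop
    have h1 : ‖∫ t in Ioc 0 T, F t‖ ≤ ∫ t in Ioc 0 T, 2 * M * (v * Real.exp (v * t)) := by
      refine norm_integral_le_of_norm_le (hc.integrableOn_Ioc) ?_
      refine (ae_restrict_mem measurableSet_Ioc).mono fun t ht => ?_
      rw [hFt t ht.1, div_le_iff₀ ht.1]
      have h2 : ‖f t - f (-t)‖ ≤ 2 * (M * (Real.exp (v * t) - 1)) := by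
        have h3 := hf t
        have h4 := hf (-t)
        rw [abs_neg] at h4
        rw [abs_of_pos ht.1] at h3 h4
        exact (norm_sub_le _ _).trans (by linarith)
      have h5 := exp_sub_one_le_mul_exp (v * t)
      have h6 : Real.exp (-b * t ^ 2) ≤ 1 := Real.exp_le_one_iff.2 (by nlinarith [sq_nonneg t])
      calc Real.exp (-b * t ^ 2) * ‖f t - f (-t)‖ ≤ 1 * (2 * (M * (v * t * Real.exp (v * t)))) := by
            refine mul_le_mul h6 (h2.trans ?_) (norm_nonneg _) zero_le_one
            gcongr
        _ = _ := by ring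
    refine h1.trans ?_
    rw [← intervalIntegral.integral_of_le hT.le, intervalIntegral.integral_const_mul,
      intervalIntegral.integral_eq_sub_of_hasDerivAt (f := fun t => Real.exp (v * t))
        (fun t _ => ?_) (Continuous.intervalIntegrable (by fun_prop) _ _)]
    · refine mul_le_mul_of_nonneg_left ?_ (by positivity)
      linarith [Real.exp_pos (v * 0)]
    · have d1 : HasDerivAt (fun t : ℝ => v * t) v t := by
        simpa using (hasDerivAt_id t).const_mul v
      exact d1.exp.congr_deriv (mul_comm _ _)
  · have hbT : 0 < b * T := by positivity
    have h1 : ‖∫ t in Ioi T, F t‖ ≤ ∫ t in Ioi T, 2 * N₀ / T * Real.exp (-(b * T) * t) := by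
      refine norm_integral_le_of_norm_le ((integrableOn_exp_mul_Ioi (by linarith) T).const_mul _) ?_
      refine (ae_restrict_mem measurableSet_Ioi).mono fun t (ht : T < t) => ?_
      have ht0 : 0 < t := hT.trans ht
      rw [hFt t ht0]
      have h2 : ‖f t - f (-t)‖ ≤ 2 * N₀ :=
        (norm_sub_le _ _).trans (by linarith [hf' t, hf' (-t)])
      have h3 : Real.exp (-b * t ^ 2) ≤ Real.exp (-(b * T) * t) := by
        refine Real.exp_le_exp.2 ?_
        have : b * T * t ≤ b * t * t := by gcongr
        nlinarith
      calc Real.exp (-b * t ^ 2) * ‖f t - f (-t)‖ / t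
          ≤ Real.exp (-(b * T) * t) * (2 * N₀) / T := by gcongr
        _ = _ := by ring
    refine h1.trans (le_of_eq ?_)
    rw [integral_const_mul, integral_exp_mul_Ioi (by linarith)]
    have : -(b * T) * T = -b * T ^ 2 := by ring
    rw [this]
    field_simp

end FilterBound

/-! ### Norm estimates for matrices and vectors -/

section Spectral

open Matrix

theorem norm_star_dotProduct_le {N : Type*} [Fintype N] (a b : N → ℂ) :
    ‖star a ⬝ᵥ b‖ ≤ ‖WithLp.toLp 2 a‖ * ‖WithLp.toLp 2 b‖ := by
  have := norm_inner_le_norm (𝕜 := ℂ) (WithLp.toLp 2 a) (WithLp.toLp 2 b)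
  rwa [EuclideanSpace.inner_toLp_toLp, dotProduct_comm] at this

theorem norm_toLp_eq_one {N : Type*} [Fintype N] {a : N → ℂ} (ha : star a ⬝ᵥ a = 1) : ‖WithLp.toLp 2 a‖ = 1 := by
  have h := inner_self_eq_norm_sq_to_K (𝕜 := ℂ) (WithLp.toLp 2 a)
  rw [EuclideanSpace.inner_toLp_toLp, dotProduct_comm, ha] at h
  have h2 : ‖WithLp.toLp 2 a‖ ^ 2 = 1 := by
    have h3 : (1 : ℂ) = ((‖WithLp.toLp 2 a‖ ^ 2 : ℝ) : ℂ) := by rw [h]; simp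
    exact_mod_cast h3.symm
  exact (pow_eq_one_iff_of_nonneg (norm_nonneg _) two_ne_zero).1 h2

variable {N : Type*} [Fintype N] [DecidableEq N]

theorem norm_toLp_mulVec_le (A : Matrix N N ℂ) (b : N → ℂ) :
    ‖WithLp.toLp 2 (A *ᵥ b)‖ ≤ ‖A‖ * ‖WithLp.toLp 2 b‖ :=
  Matrix.l2_opNorm_mulVec A (WithLp.toLp 2 b)

theorem norm_star_dotProduct_mulVec_le (A : Matrix N N ℂ) {a : N → ℂ}
    (ha : ‖WithLp.toLp 2 a‖ = 1) : ‖star a ⬝ᵥ A *ᵥ a‖ ≤ ‖A‖ := by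
  have h1 := norm_star_dotProduct_le a (A *ᵥ a)
  have h2 := norm_toLp_mulVec_le A a
  rw [ha] at h1 h2
  linarith

/-- Cauchy–Schwarz: the ℓ² norm of row i is the norm of the adjoint of A applied to the i-th basis
vector, hence at most ‖A‖. -/
theorem sum_norm_row_mul_le (A : Matrix N N ℂ) (b : N → ℂ) (i : N) :
    ∑ j, ‖A i j‖ * ‖b j‖ ≤ ‖A‖ * ‖WithLp.toLp 2 b‖ := by
  have h1 := norm_toLp_mulVec_le Aᴴ (Pi.single i 1)
  rw [Matrix.l2_opNorm_conjTranspose, Matrix.mulVec_single_one] at h1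
  have h2 : ‖WithLp.toLp 2 (Pi.single i (1 : ℂ) : N → ℂ)‖ = 1 := by simp
  rw [h2, mul_one] at h1
  refine (Real.sum_mul_le_sqrt_mul_sqrt _ _ _).trans ?_
  rw [EuclideanSpace.norm_eq (WithLp.toLp 2 b)]
  refine mul_le_mul_of_nonneg_right (le_trans (le_of_eq ?_) h1) (Real.sqrt_nonneg _)
  rw [EuclideanSpace.norm_eq]
  simp [Matrix.conjTranspose_apply]

/-- Multiplication of the rows in `J` by small factors gives an operator that is small in the states
of the sector `J`. -/
theorem norm_star_dotProduct_schur_le {J : Finset N} {a : N → ℂ} (ha : ∀ i ∉ J, a i = 0)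
    (hn : ‖WithLp.toLp 2 a‖ = 1) {κ : ℝ} {c : N → N → ℂ} (hc : ∀ i ∈ J, ∀ j, ‖c i j‖ ≤ κ)
    (A : Matrix N N ℂ) (b : N → ℂ) :
    ‖star a ⬝ᵥ (Matrix.of fun i j => c i j * A i j) *ᵥ b‖
      ≤ J.card * κ * (‖A‖ * ‖WithLp.toLp 2 b‖) := by
  have ha1 : ∀ i, ‖a i‖ ≤ 1 := fun i => by
    have := PiLp.norm_apply_le (WithLp.toLp 2 a) i
    rwa [hn] at this
  have e : star a ⬝ᵥ (Matrix.of fun i j => c i j * A i j) *ᵥ b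
      = ∑ i ∈ J, star (a i) * ∑ j, c i j * A i j * b j := by
    simp only [dotProduct, mulVec, Matrix.of_apply, Pi.star_apply]
    refine (Finset.sum_subset (Finset.subset_univ J) fun i _ hi => ?_).symm
    rw [ha i hi, star_zero, zero_mul]
  -- Only the rows in J enter. Each is estimated separately by κ‖A‖‖b‖, whence the factor |J|.
  rw [e, mul_assoc, ← nsmul_eq_mul]
  refine norm_sum_le_of_le _ (f := _) (n := fun _ => κ * (‖A‖ * ‖WithLp.toLp 2 b‖)) (fun i hi => ?_)
    |>.trans (by simp)
  have hκ : 0 ≤ κ := (norm_nonneg _).trans (hc i hi i)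
  rw [norm_mul, norm_star]
  calc ‖a i‖ * ‖∑ j, c i j * A i j * b j‖ ≤ 1 * ∑ j, κ * (‖A i j‖ * ‖b j‖) := by
        refine mul_le_mul (ha1 i) (norm_sum_le_of_le _ fun j _ => ?_) (norm_nonneg _) zero_le_one
        rw [norm_mul, norm_mul, mul_assoc]
        exact mul_le_mul_of_nonneg_right (hc i hi j) (by positivity)
    _ ≤ _ := by
        rw [one_mul, ← Finset.mul_sum]
        exact mul_le_mul_of_nonneg_left (sum_norm_row_mul_le A b i) hκ

end Spectral

/-! ### The filtered commutator in an eigenbasis -/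

section Spectral

open Matrix

/-- Written linearly in the entries of M. For M = A(t) in an eigenbasis this displays the
expectation as a trigonometric sum with frequencies E_i - E_j, the form required by
`norm_sum_mul_gaussSign_le`. -/
theorem star_dotProduct_commutator {N : Type*} [Fintype N] (M B : Matrix N N ℂ) (a : N → ℂ) :
    star a ⬝ᵥ (M * B - B * M) *ᵥ a = ∑ k : N × N, M k.1 k.2 *
      (star (a k.1) * (B *ᵥ a) k.2 - (star a ᵥ* B) k.1 * a k.2) := by
  rw [sub_mulVec, dotProduct_sub, ← mulVec_mulVec, ← mulVec_mulVec, dotProduct_mulVec _ B,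
    Fintype.sum_prod_type]
  generalize B *ᵥ a = c
  generalize star a ᵥ* B = d
  simp only [dotProduct, mulVec, Pi.star_apply, Finset.mul_sum, ← Finset.sum_sub_distrib]
  refine Finset.sum_congr rfl fun i _ => Finset.sum_congr rfl fun j _ => ?_
  ring

variable {N : Type*} [Fintype N] [DecidableEq N]

/-- The projection onto the span of the basis vectors in `J`. -/
def coordProj (J : Finset N) : Matrix N N ℂ := diagonal fun i => if i ∈ J then 1 else 0

/-- The time evolution in an eigenbasis of the Hamiltonian, with eigenvalues `E`. -/
def diagEvolve (E : N → ℝ) (t : ℝ) (A : Matrix N N ℂ) : Matrix N N ℂ :=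
  diagonal (fun i => Complex.exp (t * E i * Complex.I)) * A *
    diagonal (fun i => Complex.exp (-(t * E i * Complex.I)))

theorem star_star_dotProduct_mulVec {N : Type*} [Fintype N] (M : Matrix N N ℂ) (a : N → ℂ) :
    star (star a ⬝ᵥ M *ᵥ a) = star a ⬝ᵥ Mᴴ *ᵥ a := by
  rw [star_dotProduct, star_mulVec, dotProduct_mulVec, star_star]

/-- Compare two values of ⟨[A_s,B]⟩, where A_s has entries `gaussSign` (E_i - E_j) A_ij. As a time
average of A(t) it almost commutes with B, up to the first two terms of the bound; as a spectral
filter it is almost ∓π times A with P removed, up to the last term. -/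
theorem norm_anticommutator_sector_le_of_diag {E : N → ℝ} {J : Finset N} {a : N → ℂ}
    (ha : ∀ i ∉ J, a i = 0) (hn : ‖WithLp.toLp 2 a‖ = 1) {A B : Matrix N N ℂ}
    {ΔE δ b T v M : ℝ} (hΔ : 0 < ΔE) (hδ : 0 ≤ δ) (hb : 0 < b) (hT : 0 < T) (hM : 0 ≤ M)
    (hgap : ∀ i ∈ J, ∀ j ∉ J, E i + ΔE < E j) (hwidth : ∀ i ∈ J, ∀ j ∈ J, |E i - E j| ≤ δ)
    (hLR : ∀ t : ℝ, ‖diagEvolve E t A * B - B * diagEvolve E t A‖ ≤ M * (Real.exp (v * |t|) - 1)) :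
    Real.pi * ‖star a ⬝ᵥ (A * B + B * A - A * coordProj J * B - B * coordProj J * A) *ᵥ a‖
      ≤ 2 * M * Real.exp (v * T) + 4 * ‖A‖ * ‖B‖ * (Real.exp (-b * T ^ 2) / (b * T ^ 2))
        + 2 * J.card * (Real.pi * Real.exp (-(1 / (4 * b)) * ΔE ^ 2) + δ * √(Real.pi / b))
          * ‖A‖ * ‖B‖ := by
  set κ := Real.pi * Real.exp (-(1 / (4 * b)) * ΔE ^ 2) + δ * √(Real.pi / b) with hκ
  have hstep : ∀ i ∈ J, ∀ j, |gaussSign b (E j - E i) - Real.pi * (if j ∈ J then 0 else 1)| ≤ κ := by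
    intro i hi j
    split_ifs with hj
    · rw [mul_zero, sub_zero]
      refine (abs_gaussSign_le hb _).trans ?_
      have := mul_le_mul_of_nonneg_right (hwidth j hj i hi) (Real.sqrt_nonneg (Real.pi / b))
      have h2 : 0 ≤ Real.pi * Real.exp (-(1 / (4 * b)) * ΔE ^ 2) := by positivity
      linarith
    · rw [mul_one, abs_sub_comm]
      have := abs_pi_sub_gaussSign_le_of_le hb hΔ.le (ω := E j - E i) (by linarith [hgap i hi j hj])
      have h2 : 0 ≤ δ * √(Real.pi / b) := by positivity
      linarith
  have hBa : ‖WithLp.toLp 2 (B *ᵥ a)‖ ≤ ‖B‖ := by simpa [hn] using norm_toLp_mulVec_le B a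
  -- the filtered operator
  set As : Matrix N N ℂ := of fun i j => (gaussSign b (E i - E j) : ℂ) * A i j with hAs
  have hφ : ‖star a ⬝ᵥ (As * B - B * As) *ᵥ a‖ ≤ 2 * M * Real.exp (v * T)
      + 2 * (2 * ‖A‖ * ‖B‖) * (Real.exp (-b * T ^ 2) / (b * T ^ 2)) := by
    have hsum : ∀ t : ℝ, ∑ k : N × N, A k.1 k.2 *
        (star (a k.1) * (B *ᵥ a) k.2 - (star a ᵥ* B) k.1 * a k.2) *
        Complex.exp (t * (E k.1 - E k.2 : ℝ) * Complex.I) =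
        star a ⬝ᵥ (diagEvolve E t A * B - B * diagEvolve E t A) *ᵥ a := by
      intro t
      rw [star_dotProduct_commutator]
      refine Finset.sum_congr rfl fun k _ => ?_
      have : diagEvolve E t A k.1 k.2 =
          Complex.exp (t * (E k.1 - E k.2 : ℝ) * Complex.I) * A k.1 k.2 := by
        rw [diagEvolve, mul_diagonal, diagonal_mul, mul_right_comm, ← Complex.exp_add]
        congr 2
        push_cast
        ring
      rw [this]
      ring
    have hD1 : ∀ s : ℂ, s.re = 0 →
        ‖(diagonal fun i => Complex.exp (s * E i) : Matrix N N ℂ)‖ ≤ 1 := by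
      intro s hs
      rw [l2_opNorm_diagonal]
      refine (pi_norm_le_iff_of_nonneg zero_le_one).2 fun i => ?_
      rw [Complex.norm_exp]
      simp [hs]
    have hevol : ∀ t : ℝ, ‖diagEvolve E t A‖ ≤ ‖A‖ := by
      intro t
      have h1 := hD1 (t * Complex.I) (by simp)
      have h2 := hD1 (-(t * Complex.I)) (by simp)
      have e1 : (fun i => Complex.exp (t * Complex.I * E i)) =
        fun i => Complex.exp (t * E i * Complex.I) := by funext i; congr 1; ring
      have e2 : (fun i => Complex.exp (-(t * Complex.I) * E i)) =
        fun i => Complex.exp (-(t * E i * Complex.I)) := by funext i; congr 1; ring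
      rw [e1] at h1
      rw [e2] at h2
      rw [diagEvolve]
      refine (norm_mul_le _ _).trans ((mul_le_of_le_one_right (norm_nonneg _) h2).trans ?_)
      exact (norm_mul_le _ _).trans (mul_le_of_le_one_left (norm_nonneg _) h1)
    have key := norm_sum_mul_gaussSign_le (Finset.univ : Finset (N × N))
      (fun k => A k.1 k.2 * (star (a k.1) * (B *ᵥ a) k.2 - (star a ᵥ* B) k.1 * a k.2))
      (fun k => E k.1 - E k.2) (N₀ := 2 * ‖A‖ * ‖B‖) (v := v) hb hT hM (by positivity)
      (fun t => by
        rw [hsum]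
        exact (norm_star_dotProduct_mulVec_le _ hn).trans (hLR t))
      (fun t => by
        rw [hsum]
        refine (norm_star_dotProduct_mulVec_le _ hn).trans ((norm_commutator_le _ _).trans ?_)
        gcongr
        exact hevol t)
    rw [star_dotProduct_commutator]
    refine le_of_eq_of_le (congrArg norm (Finset.sum_congr rfl fun k _ => ?_)) key
    simp only [hAs, of_apply]
    ring
  -- the deviation from the sharp step function
  set e₁ : N → N → ℂ := fun i j => ((gaussSign b (E i - E j) +
    Real.pi * (if j ∈ J then 0 else 1) : ℝ) : ℂ) with he₁
  set e₂ : N → N → ℂ := fun i j => ((gaussSign b (E i - E j) -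
    Real.pi * (if i ∈ J then 0 else 1) : ℝ) : ℂ) with he₂
  have hA1 : As = (of fun i j => e₁ i j * A i j) - (Real.pi : ℂ) • (A * (1 - coordProj J)) := by
    ext i j
    have : (1 - coordProj J : Matrix N N ℂ) = diagonal fun j => if j ∈ J then 0 else 1 := by
      rw [← diagonal_one, coordProj, diagonal_sub]
      congr 1
      funext j
      split_ifs <;> simp
    rw [this]
    simp only [hAs, he₁, of_apply, Matrix.sub_apply, Matrix.smul_apply, mul_diagonal, smul_eq_mul]
    push_cast
    split_ifs
    · simp
    · simp
      ring
  have hA2 : As = (of fun i j => e₂ i j * A i j) + (Real.pi : ℂ) • ((1 - coordProj J) * A) := by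
    ext i j
    have : (1 - coordProj J : Matrix N N ℂ) = diagonal fun j => if j ∈ J then 0 else 1 := by
      rw [← diagonal_one, coordProj, diagonal_sub]
      congr 1
      funext j
      split_ifs <;> simp
    rw [this]
    simp only [hAs, he₂, of_apply, Matrix.add_apply, Matrix.smul_apply, diagonal_mul, smul_eq_mul]
    push_cast
    split_ifs
    · simp
    · simp
      ring
  have herr1 : ‖star a ⬝ᵥ ((of fun i j => e₁ i j * A i j) * B) *ᵥ a‖
      ≤ J.card * κ * (‖A‖ * ‖B‖) := by
    rw [← mulVec_mulVec]
    have hc : ∀ i ∈ J, ∀ j, ‖e₁ i j‖ ≤ κ := by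
      intro i hi j
      have := hstep i hi j
      rw [he₁, Complex.norm_real, Real.norm_eq_abs, ← neg_sub (E j), gaussSign_neg, ← abs_neg]
      convert! this using 2
      ring
    refine (norm_star_dotProduct_schur_le ha hn hc A (B *ᵥ a)).trans ?_
    have hκ0 : 0 ≤ κ := by positivity
    gcongr
  have herr2 : ‖star a ⬝ᵥ (B * (of fun i j => e₂ i j * A i j)) *ᵥ a‖
      ≤ J.card * κ * (‖A‖ * ‖B‖) := by
    have hc : ∀ i ∈ J, ∀ j, ‖star (e₂ j i)‖ ≤ κ := by
      intro i hi j
      rw [norm_star, he₂, Complex.norm_real, Real.norm_eq_abs]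
      exact hstep i hi j
    have h1 := norm_star_dotProduct_schur_le ha hn hc Aᴴ (Bᴴ *ᵥ a)
    have h2 : star (star a ⬝ᵥ (B * (of fun i j => e₂ i j * A i j)) *ᵥ a) =
        star a ⬝ᵥ (of fun i j => star (e₂ j i) * Aᴴ i j) *ᵥ (Bᴴ *ᵥ a) := by
      have h3 : (of fun i j => star (e₂ j i) * Aᴴ i j) = (of fun i j => e₂ i j * A i j)ᴴ := by
        ext i j
        simp [conjTranspose_apply]
      rw [h3, mulVec_mulVec, ← conjTranspose_mul, star_star_dotProduct_mulVec]
    rw [← norm_star, h2]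
    refine h1.trans ?_
    rw [l2_opNorm_conjTranspose]
    have hB' : ‖WithLp.toLp 2 (Bᴴ *ᵥ a)‖ ≤ ‖B‖ := by
      have := norm_toLp_mulVec_le Bᴴ a
      rwa [hn, mul_one, l2_opNorm_conjTranspose] at this
    have hκ0 : 0 ≤ κ := by positivity
    gcongr
  have hid : (Real.pi : ℂ) * (star a ⬝ᵥ (A * B + B * A - A * coordProj J * B
      - B * coordProj J * A) *ᵥ a)
      = star a ⬝ᵥ ((of fun i j => e₁ i j * A i j) * B) *ᵥ a
      - star a ⬝ᵥ (B * (of fun i j => e₂ i j * A i j)) *ᵥ a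
      - star a ⬝ᵥ (As * B - B * As) *ᵥ a := by
    -- The row form of A_s is used in A_s B, where A_s meets the sector vector on its left, and the
    -- column form in B A_s, where it meets the one on its right.
    have : As * B - B * As = (of fun i j => e₁ i j * A i j) * B - B * (of fun i j => e₂ i j * A i j)
        - (Real.pi : ℂ) • (A * B + B * A - A * coordProj J * B - B * coordProj J * A) := by
      conv_lhs => rw [hA2]
      conv_lhs => enter [1]; rw [← hA2, hA1]
      simp only [sub_mul, mul_add, mul_sub, smul_mul_assoc, mul_smul_comm, smul_add, smul_sub,
        mul_one, one_mul, mul_assoc]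
      abel
    rw [this]
    simp only [sub_mulVec, dotProduct_sub, smul_mulVec, dotProduct_smul, smul_eq_mul]
    ring
  have hfin : Real.pi * ‖star a ⬝ᵥ (A * B + B * A - A * coordProj J * B
      - B * coordProj J * A) *ᵥ a‖ ≤ J.card * κ * (‖A‖ * ‖B‖) + J.card * κ * (‖A‖ * ‖B‖) +
      (2 * M * Real.exp (v * T)
      + 2 * (2 * ‖A‖ * ‖B‖) * (Real.exp (-b * T ^ 2) / (b * T ^ 2))) := by
    have h1 := congrArg norm hid
    rw [norm_mul, Complex.norm_real, Real.norm_of_nonneg Real.pi_pos.le] at h1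
    rw [h1]
    exact (norm_sub_le _ _).trans (add_le_add ((norm_sub_le _ _).trans
      (add_le_add herr1 herr2)) hφ)
  refine hfin.trans (le_of_eq ?_)
  ring

end Spectral

/-! ### Passing between a Hamiltonian and its eigenbasis -/

section Spectral

open Matrix

variable {N : Type*} [Fintype N] [DecidableEq N] {H : Matrix N N ℂ} (hH : H.IsHermitian)

/-- The spectral projection onto the eigenvectors with indices in `J`. -/
def spectralProj (J : Finset N) : Matrix N N ℂ :=
  ∑ i ∈ J, vecMulVec (hH.eigenvectorBasis i).ofLp (star (hH.eigenvectorBasis i).ofLp)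

/-- A matrix in the eigenbasis of `H`. -/
def toEigenbasis : Matrix N N ℂ ≃⋆ₐ[ℂ] Matrix N N ℂ :=
  Unitary.conjStarAlgAut ℂ (Matrix N N ℂ) (star hH.eigenvectorUnitary)

theorem toEigenbasis_apply (M : Matrix N N ℂ) :
    toEigenbasis hH M = (hH.eigenvectorUnitary : Matrix N N ℂ)ᴴ * M * hH.eigenvectorUnitary := by
  simp [toEigenbasis, Unitary.conjStarAlgAut_apply, star_eq_conjTranspose]

theorem eigenvectorUnitary_mul_conjTranspose :
    (hH.eigenvectorUnitary : Matrix N N ℂ) * (hH.eigenvectorUnitary : Matrix N N ℂ)ᴴ = 1 :=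
  Unitary.coe_mul_star_self hH.eigenvectorUnitary

theorem conjTranspose_mul_eigenvectorUnitary :
    (hH.eigenvectorUnitary : Matrix N N ℂ)ᴴ * (hH.eigenvectorUnitary : Matrix N N ℂ) = 1 :=
  Unitary.coe_star_mul_self hH.eigenvectorUnitary

theorem norm_toEigenbasis (M : Matrix N N ℂ) : ‖toEigenbasis hH M‖ = ‖M‖ :=
  NonUnitalStarAlgHom.norm_map (toEigenbasis hH) (toEigenbasis hH).injective M

theorem toEigenbasis_self :
    toEigenbasis hH H = diagonal fun i => (hH.eigenvalues i : ℂ) :=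
  hH.conjStarAlgAut_star_eigenvectorUnitary

theorem toEigenbasis_spectralProj (J : Finset N) :
    toEigenbasis hH (spectralProj hH J) = coordProj J := by
  have h : spectralProj hH J = (hH.eigenvectorUnitary : Matrix N N ℂ) * coordProj J *
      (hH.eigenvectorUnitary : Matrix N N ℂ)ᴴ := by
    ext x y
    simp only [spectralProj, Matrix.sum_apply, vecMulVec_apply, coordProj, mul_apply, diagonal_apply,
      conjTranspose_apply, IsHermitian.eigenvectorUnitary_apply, Pi.star_apply]
    simp
  rw [h, toEigenbasis_apply]
  have e := conjTranspose_mul_eigenvectorUnitary hH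
  calc _ = ((hH.eigenvectorUnitary : Matrix N N ℂ)ᴴ * (hH.eigenvectorUnitary : Matrix N N ℂ)) *
      coordProj J * ((hH.eigenvectorUnitary : Matrix N N ℂ)ᴴ *
      (hH.eigenvectorUnitary : Matrix N N ℂ)) := by simp only [mul_assoc]
    _ = _ := by rw [e, one_mul, mul_one]

theorem toEigenbasis_exp (c : ℂ) :
    toEigenbasis hH (NormedSpace.exp (c • H)) =
      diagonal fun i => Complex.exp (c * hH.eigenvalues i) := by
  let _ : NormedAlgebra ℚ (Matrix N N ℂ) := NormedAlgebra.restrictScalars ℚ ℂ _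
  have hc : Continuous (toEigenbasis hH) := by
    have : (toEigenbasis hH : Matrix N N ℂ → Matrix N N ℂ) = fun M =>
      (hH.eigenvectorUnitary : Matrix N N ℂ)ᴴ * M * hH.eigenvectorUnitary :=
      funext (toEigenbasis_apply hH)
    rw [this]
    exact (continuous_const.mul continuous_id).mul continuous_const
  rw [NormedSpace.map_exp (toEigenbasis hH) hc, map_smul, toEigenbasis_self]
  have : c • (diagonal fun i => (hH.eigenvalues i : ℂ)) =
      diagonal fun i => c * hH.eigenvalues i := by
    ext i j
    simp [diagonal_apply]
  rw [this, Matrix.exp_diagonal]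
  congr 1
  funext i
  rw [Pi.coe_exp, Complex.exp_eq_exp_ℂ]

theorem toEigenbasis_heisenberg (t : ℝ) (A : Matrix N N ℂ) :
    toEigenbasis hH (heisenberg H t A) = diagEvolve hH.eigenvalues t (toEigenbasis hH A) := by
  rw [heisenberg, map_mul, map_mul, toEigenbasis_exp, toEigenbasis_exp, diagEvolve]
  congr 3 <;> funext i <;> congr 1 <;> ring

/-- The coordinates of a vector in the eigenbasis. -/
def eigenCoords (Φ : N → ℂ) : N → ℂ := (hH.eigenvectorUnitary : Matrix N N ℂ)ᴴ *ᵥ Φ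

theorem star_eigenCoords_dotProduct (M : Matrix N N ℂ) (Φ : N → ℂ) :
    star (eigenCoords hH Φ) ⬝ᵥ toEigenbasis hH M *ᵥ eigenCoords hH Φ = star Φ ⬝ᵥ M *ᵥ Φ := by
  have e := eigenvectorUnitary_mul_conjTranspose hH
  rw [eigenCoords, toEigenbasis_apply, star_mulVec, conjTranspose_conjTranspose,
    ← dotProduct_mulVec, mulVec_mulVec, mulVec_mulVec]
  congr 2
  calc _ = ((hH.eigenvectorUnitary : Matrix N N ℂ) * (hH.eigenvectorUnitary : Matrix N N ℂ)ᴴ) *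
      M * ((hH.eigenvectorUnitary : Matrix N N ℂ) *
      (hH.eigenvectorUnitary : Matrix N N ℂ)ᴴ) := by simp only [mul_assoc]
    _ = _ := by rw [e, one_mul, mul_one]

theorem toEigenbasis_mulVec_eigenCoords (M : Matrix N N ℂ) (Φ : N → ℂ) :
    toEigenbasis hH M *ᵥ eigenCoords hH Φ = eigenCoords hH (M *ᵥ Φ) := by
  have e := eigenvectorUnitary_mul_conjTranspose hH
  rw [eigenCoords, eigenCoords, toEigenbasis_apply, mulVec_mulVec, mulVec_mulVec]
  congr 1
  rw [mul_assoc, e, mul_one]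

/-- In the ground state sector, `A B + B A` is close to `A P₀ B + B P₀ A`, if the commutator of
`A(t)` and `B` grows slowly. -/
theorem norm_anticommutator_sector_le {J : Finset N} {Φ : N → ℂ} (hΦ : star Φ ⬝ᵥ Φ = 1)
    (hP : spectralProj hH J *ᵥ Φ = Φ) {A B : Matrix N N ℂ}
    {ΔE δ b T v M : ℝ} (hΔ : 0 < ΔE) (hδ : 0 ≤ δ) (hb : 0 < b) (hT : 0 < T) (hM : 0 ≤ M)
    (hgap : ∀ i ∈ J, ∀ j ∉ J, hH.eigenvalues i + ΔE < hH.eigenvalues j)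
    (hwidth : ∀ i ∈ J, ∀ j ∈ J, |hH.eigenvalues i - hH.eigenvalues j| ≤ δ)
    (hLR : ∀ t : ℝ, ‖heisenberg H t A * B - B * heisenberg H t A‖ ≤ M * (Real.exp (v * |t|) - 1)) :
    Real.pi * ‖star Φ ⬝ᵥ (A * B + B * A - A * spectralProj hH J * B - B * spectralProj hH J * A) *ᵥ Φ‖
      ≤ 2 * M * Real.exp (v * T) + 4 * ‖A‖ * ‖B‖ * (Real.exp (-b * T ^ 2) / (b * T ^ 2))
        + 2 * J.card * (Real.pi * Real.exp (-(1 / (4 * b)) * ΔE ^ 2) + δ * √(Real.pi / b))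
          * ‖A‖ * ‖B‖ := by
  have hn : star (eigenCoords hH Φ) ⬝ᵥ eigenCoords hH Φ = 1 := by
    have := star_eigenCoords_dotProduct hH 1 Φ
    rwa [map_one, one_mulVec, one_mulVec, hΦ] at this
  have ha : ∀ i ∉ J, eigenCoords hH Φ i = 0 := by
    intro i hi
    have := toEigenbasis_mulVec_eigenCoords hH (spectralProj hH J) Φ
    rw [hP, toEigenbasis_spectralProj] at this
    rw [← this, coordProj, mulVec_diagonal, if_neg hi, zero_mul]
  have key := norm_anticommutator_sector_le_of_diag (E := hH.eigenvalues) ha (norm_toLp_eq_one hn)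
    (A := toEigenbasis hH A) (B := toEigenbasis hH B) (v := v) hΔ hδ hb hT hM hgap hwidth
    (fun t => by
      rw [← toEigenbasis_heisenberg, ← map_mul, ← map_mul, ← map_sub, norm_toEigenbasis]
      exact hLR t)
  rw [← toEigenbasis_spectralProj hH] at key
  simp only [← map_mul, ← map_add, ← map_sub, norm_toEigenbasis, star_eigenCoords_dotProduct] at key
  exact key

end Spectral

/-! ### Choice of the time cutoff, and clustering up to the sector projection -/

namespace DecayLaw

/-- The number `G` in `profile = exp (-G)`. -/
def rate : DecayLaw → ℕ → ℝ
  | power η, r => η * Real.log (1 + r)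
  | exponential μ, r => μ * r

theorem profile_eq_exp (D : DecayLaw) (r : ℕ) : D.profile r = Real.exp (-D.rate r) := by
  cases D with
  | power η =>
    have : (0 : ℝ) < 1 + r := by positivity
    rw [profile, rate, Real.rpow_def_of_pos this]
    congr 1
    ring
  | exponential μ =>
    rw [profile, rate, neg_mul]

theorem rate_tilde (D : DecayLaw) (v ΔE : ℝ) (r : ℕ) :
    (D.tilde v ΔE).rate r = D.rate r / (1 + 2 * v / ΔE) := by
  cases D <;> simp only [tilde, rate] <;> ring

theorem Pos.rate_mono {D : DecayLaw} (hD : D.Pos) : Monotone D.rate := by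
  intro r r' h
  have := hD.profile_antitone h
  rw [profile_eq_exp, profile_eq_exp, Real.exp_le_exp] at this
  linarith

theorem Pos.rate_one_pos {D : DecayLaw} (hD : D.Pos) : 0 < D.rate 1 := by
  cases D with
  | power η =>
    have hη : 0 < η := hD
    have : 0 < Real.log (1 + (1 : ℕ)) := Real.log_pos (by norm_num)
    exact mul_pos hη this
  | exponential μ =>
    have hμ : 0 < μ := hD
    simpa [rate] using hμ

theorem Pos.tilde {D : DecayLaw} (hD : D.Pos) {v ΔE : ℝ} (hv : 0 < v) (hΔ : 0 < ΔE) :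
    (D.tilde v ΔE).Pos := by
  cases D with
  | power η =>
    have hη : 0 < η := hD
    exact show 0 < η / (1 + 2 * v / ΔE) by positivity
  | exponential μ =>
    have hμ : 0 < μ := hD
    exact show 0 < μ / (1 + 2 * v / ΔE) by positivity

theorem Pos.tendsto_profile {D : DecayLaw} (hD : D.Pos) :
    Tendsto D.profile atTop (𝓝 0) := by
  cases D with
  | power η =>
    have hη : 0 < η := hD
    have h2 : Tendsto (fun r : ℕ => 1 + (r : ℝ)) atTop atTop :=
      tendsto_atTop_add_const_left _ _ tendsto_natCast_atTop_atTop
    exact (tendsto_rpow_neg_atTop hη).comp h2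
  | exponential μ =>
    have hμ : 0 < μ := hD
    have h2 : Tendsto (fun r : ℕ => μ * (r : ℝ)) atTop atTop :=
      tendsto_natCast_atTop_atTop.const_mul_atTop hμ
    refine (Real.tendsto_exp_neg_atTop_nhds_zero.comp h2).congr fun r => ?_
    simp [profile]

end DecayLaw

namespace LatticeSystem

open SiteSpaces Matrix

variable {S : Type*} [LinearOrder S] (Q : LatticeSystem S)

theorem sectorProj_eq (n : ℕ) (J : Finset (Q.K.Config (Q.sites n))) :
    Q.sectorProj n J = spectralProj (Q.H_hermitian n) J := rfl

theorem eventually_subset (X : Finset S) : ∀ᶠ n in atTop, X ⊆ Q.sites n :=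
  (X.eventually_all.2 fun x _ => Q.eventually_mem x).mono fun _ h x hx => h x hx

theorem eventually_farApart {r : ℕ} {X Y : Finset S} (h : FarApart Q.G r X Y) :
    ∀ᶠ n in atTop, FarApart (Q.graph n) r X Y := by
  have : ∀ᶠ n in atTop, ∀ x ∈ X, ∀ y ∈ Y, (Q.graph n).dist x y = Q.G.dist x y :=
    X.eventually_all.2 fun x _ => Y.eventually_all.2 fun y _ => Q.eventually_dist x y
  filter_upwards [this] with n hn x hx y hy
  rw [hn x hx y hy]
  exact h x hx y hy

/-- The filter estimate with optimized parameters. Only the velocity bound brings the factor |X||Y|;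
the Gaussian tail and the smoothing of the sign do not, and the + 1 makes room for them. The sector
width goes into ε. -/
theorem exists_clustering_const {D : DecayLaw} (hD : D.Pos) {v : ℝ} (hv : Q.IsVelocityBound D v)
    {q : ℕ} {ΔE : ℝ} {I : ∀ n, Finset (Q.K.Config (Q.sites n))} (hI : Q.UniformGap q ΔE I) :
    ∃ C : ℝ, 0 < C ∧ ∀ A B : Q.K.LocalObs, A.BosonicPair B → ∀ r : ℕ, 0 < r →
      FarApart Q.G r A.supp B.supp → ∀ ε : ℝ, 0 < ε → ∀ᶠ n in atTop,
      ∀ Φ : Q.K.Config (Q.sites n) → ℂ, star Φ ⬝ᵥ Φ = 1 → Q.sectorProj n (I n) *ᵥ Φ = Φ →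
      ‖star Φ ⬝ᵥ (A.toOp (Q.sites n) * B.toOp (Q.sites n) + B.toOp (Q.sites n) * A.toOp (Q.sites n)
        - A.toOp (Q.sites n) * Q.sectorProj n (I n) * B.toOp (Q.sites n)
        - B.toOp (Q.sites n) * Q.sectorProj n (I n) * A.toOp (Q.sites n)) *ᵥ Φ‖
        ≤ C * (‖A.op‖ * ‖B.op‖ * ((A.supp.card : ℝ) * B.supp.card + 1)
          * (D.tilde v ΔE).profile r) + ε := by
  obtain ⟨hv0, C', hC', hLR⟩ := hv
  have hΔ := hI.gap_pos
  have hq := hI.q_pos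
  have hden : 0 < v + ΔE / 2 := by positivity
  -- With b = ΔE/(2T) both Gaussian errors exp(-bT²) and exp(-ΔE²/4b) equal exp(-ΔE T/2). This T
  -- then solves -rate + vT = -ΔE T/2, and ΔE T/2 is the rate divided by 1 + 2v/ΔE.
  set T : ℕ → ℝ := fun r => D.rate r / (v + ΔE / 2) with hTdef
  have hT1 : 0 < T 1 := div_pos hD.rate_one_pos hden
  -- A lower bound for T uniform in r ≥ 1 keeps the prefactor 1/(bT²) = 2/(ΔE T) bounded.
  have hTr : ∀ r, 0 < r → T 1 ≤ T r := fun r hr =>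
    div_le_div_of_nonneg_right (hD.rate_mono hr) hden.le
  have htilde : ∀ r, (D.tilde v ΔE).profile r = Real.exp (-(ΔE / 2 * T r)) := by
    intro r
    rw [DecayLaw.profile_eq_exp, DecayLaw.rate_tilde, hTdef]
    congr 2
    field_simp
    ring
  refine ⟨2 * C' + 8 / (ΔE * T 1) + 2 * q * Real.pi, by positivity, ?_⟩
  intro A B hAB r hr hfar ε hε
  have hTpos : 0 < T r := hT1.trans_le (hTr r hr)
  set b : ℝ := ΔE / (2 * T r) with hb
  have hb0 : 0 < b := by positivity
  set δ : ℝ := ε / (2 * q * √(Real.pi / b) * ‖A.op‖ * ‖B.op‖ + 1) with hδ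
  have hδ0 : 0 < δ := by positivity
  filter_upwards [hI.card_eq, hI.gap, hI.width δ hδ0, Q.eventually_subset A.supp,
    Q.eventually_subset B.supp, Q.eventually_farApart hfar] with n hcard hgap hwidth hA hB hfarn
  intro Φ hΦ hPΦ
  rw [sectorProj_eq] at hPΦ ⊢
  have hp := (D.profile_pos r).le
  have key := norm_anticommutator_sector_le (Q.H_hermitian n) hΦ hPΦ (A := A.toOp (Q.sites n))
    (B := B.toOp (Q.sites n)) (v := v) (T := T r) (b := b)
    (M := C' * ‖A.op‖ * ‖B.op‖ * (A.supp.card : ℝ) * (B.supp.card : ℝ) * D.profile r)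
    hΔ hδ0.le hb0 hTpos (by positivity) hgap hwidth
    (fun t => hLR n A B hA hB hAB r hr hfarn t)
  set w := ‖star Φ ⬝ᵥ (A.toOp (Q.sites n) * B.toOp (Q.sites n) +
        B.toOp (Q.sites n) * A.toOp (Q.sites n)
        - A.toOp (Q.sites n) * spectralProj (Q.H_hermitian n) (I n) * B.toOp (Q.sites n)
        - B.toOp (Q.sites n) * spectralProj (Q.H_hermitian n) (I n) * A.toOp (Q.sites n)) *ᵥ Φ‖
    with hw
  set g := (D.tilde v ΔE).profile r with hg
  have hg0 : 0 < g := DecayLaw.profile_pos _ r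
  have e1 : D.profile r * Real.exp (v * T r) = g := by
    rw [hg, htilde, DecayLaw.profile_eq_exp, ← Real.exp_add]
    congr 1
    have : D.rate r = T r * (v + ΔE / 2) := by rw [hTdef]; field_simp
    rw [this]
    ring
  have e2 : Real.exp (-b * T r ^ 2) = g := by
    rw [hg, htilde, hb]
    congr 1
    field_simp
  have e3 : b * T r ^ 2 = ΔE * T r / 2 := by
    rw [hb]
    field_simp
  have e4 : Real.exp (-(1 / (4 * b)) * ΔE ^ 2) = g := by
    rw [hg, htilde, hb]
    congr 1
    field_simp
    norm_num
  rw [e2, e3, e4, hcard] at key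
  have hw1 : w ≤ Real.pi * w :=
    le_mul_of_one_le_left (norm_nonneg _) (by linarith [Real.two_le_pi])
  have hAn := LocalObs.norm_toOp_le A (Q.sites n)
  have hBn := LocalObs.norm_toOp_le B (Q.sites n)
  have f1 : 2 * (C' * ‖A.op‖ * ‖B.op‖ * (A.supp.card : ℝ) * (B.supp.card : ℝ) * D.profile r) *
      Real.exp (v * T r) ≤ 2 * C' * (‖A.op‖ * ‖B.op‖ * ((A.supp.card : ℝ) * B.supp.card + 1) * g) := by
    rw [← e1]
    have : 0 ≤ C' * (‖A.op‖ * ‖B.op‖ * (D.profile r * Real.exp (v * T r))) := by positivity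
    nlinarith
  have hcc : (1 : ℝ) ≤ (A.supp.card : ℝ) * B.supp.card + 1 := by
    have : (0 : ℝ) ≤ (A.supp.card : ℝ) * B.supp.card := by positivity
    linarith
  have f2 : 4 * ‖A.toOp (Q.sites n)‖ * ‖B.toOp (Q.sites n)‖ * (g / (ΔE * T r / 2)) ≤
      8 / (ΔE * T 1) * (‖A.op‖ * ‖B.op‖ * ((A.supp.card : ℝ) * B.supp.card + 1) * g) := by
    calc _ ≤ 4 * ‖A.op‖ * ‖B.op‖ * (g / (ΔE * T 1 / 2)) := by
          have := hTr r hr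
          gcongr
      _ = 8 / (ΔE * T 1) * (‖A.op‖ * ‖B.op‖ * 1 * g) := by
          field_simp
          ring
      _ ≤ _ := by gcongr
  have f3 : 2 * (q : ℝ) * (Real.pi * g + δ * √(Real.pi / b)) * ‖A.toOp (Q.sites n)‖ *
      ‖B.toOp (Q.sites n)‖ ≤
      2 * q * Real.pi * (‖A.op‖ * ‖B.op‖ * ((A.supp.card : ℝ) * B.supp.card + 1) * g) + ε := by
    have hδε : δ * (2 * q * √(Real.pi / b) * ‖A.op‖ * ‖B.op‖) ≤ ε := by
      rw [hδ, div_mul_eq_mul_div, div_le_iff₀ (by positivity)]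
      have : 0 ≤ ε := hε.le
      nlinarith
    calc _ ≤ 2 * (q : ℝ) * (Real.pi * g + δ * √(Real.pi / b)) * ‖A.op‖ * ‖B.op‖ := by gcongr
      _ = 2 * q * Real.pi * (‖A.op‖ * ‖B.op‖ * 1 * g) +
          δ * (2 * q * √(Real.pi / b) * ‖A.op‖ * ‖B.op‖) := by ring
      _ ≤ _ := by gcongr
  linarith

end LatticeSystem

/-! ### Linear and antilinear automorphisms -/

section Automorphisms

open Matrix Polynomial

variable {N : Type*} [Fintype N] [DecidableEq N]

/-- A linear or antilinear ring automorphism, as an automorphism of a real algebra. -/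
def realAlgEquiv (R : Matrix N N ℂ ≃+* Matrix N N ℂ)
    (hR : (∀ (c : ℂ) (M : Matrix N N ℂ), R (c • M) = c • R M) ∨
      (∀ (c : ℂ) (M : Matrix N N ℂ), R (c • M) = (starRingEnd ℂ) c • R M)) :
    Matrix N N ℂ ≃ₐ[ℝ] Matrix N N ℂ :=
  AlgEquiv.ofRingEquiv (f := R) fun r => by
    have e : (algebraMap ℝ (Matrix N N ℂ)) r = (r : ℂ) • 1 := by
      rw [Algebra.algebraMap_eq_smul_one, Complex.coe_smul]
    rw [e]
    rcases hR with h | h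
    · rw [h, map_one]
    · rw [h, map_one, Complex.conj_ofReal]

/-- By the C⋆ identity ‖M‖² is the spectral radius of M†M. Automorphisms preserve the spectrum, and
the real spectrum is enough for a self-adjoint element, so antilinear maps are included. R need not
be a star map: compatibility with the adjoint at M suffices. -/
theorem norm_algEquiv_apply (R : Matrix N N ℂ ≃ₐ[ℝ] Matrix N N ℂ) {M : Matrix N N ℂ}
    (hM : R Mᴴ = (R M)ᴴ) : ‖R M‖ = ‖M‖ := by
  have h1 : spectrum ℝ (R (star M * M)) = spectrum ℝ (star M * M) := AlgEquiv.spectrum_eq R _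
  have h2 : R (star M * M) = star (R M) * R M := by
    rw [map_mul]
    exact congrArg (· * R M) hM
  have h3 : spectralRadius ℝ (star (R M) * R M) = spectralRadius ℝ (star M * M) := by
    rw [← h2, spectralRadius, spectralRadius, h1]
  have h4 := (IsSelfAdjoint.star_mul_self (R M)).toReal_spectralRadius_eq_norm
  have h5 := (IsSelfAdjoint.star_mul_self M).toReal_spectralRadius_eq_norm
  rw [h3, h5, CStarRing.norm_star_mul_self, CStarRing.norm_star_mul_self] at h4
  exact ((mul_self_inj (norm_nonneg _) (norm_nonneg _)).1 h4).symm

variable {H : Matrix N N ℂ} (hH : H.IsHermitian)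

/-- The spectral projections of isolated parts of the spectrum are real polynomials in `H`. -/
theorem exists_spectralProj_eq_aeval {J : Finset N}
    (hJ : ∀ i ∈ J, ∀ j ∉ J, hH.eigenvalues i ≠ hH.eigenvalues j) :
    ∃ p : ℝ[X], spectralProj hH J = aeval H p := by
  classical
  let s : Finset ℝ := Finset.univ.image hH.eigenvalues
  let r : ℝ → ℝ := fun e => if e ∈ J.image hH.eigenvalues then 1 else 0
  let p : ℝ[X] := Lagrange.interpolate s id r
  -- An eigenvalue attained in J is not attained outside J, so its membership in the image of J
  -- decides whether i ∈ J.
  have hp : ∀ i, p.eval (hH.eigenvalues i) = if i ∈ J then 1 else 0 := by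
    intro i
    have hi : hH.eigenvalues i ∈ s := Finset.mem_image_of_mem _ (Finset.mem_univ i)
    have h1 := Lagrange.eval_interpolate_at_node (v := (id : ℝ → ℝ)) r
      (Function.injective_id.injOn) hi
    refine h1.trans ?_
    simp only [r]
    congr 1
    refine propext ⟨fun h => ?_, fun h => Finset.mem_image_of_mem _ h⟩
    obtain ⟨j, hj, hij⟩ := Finset.mem_image.1 h
    by_contra hiJ
    exact hJ j hj i hiJ hij
  refine ⟨p, EquivLike.injective (toEigenbasis hH) ?_⟩
  have e1 : toEigenbasis hH (aeval H p) = aeval (toEigenbasis hH H) p := by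
    rw [← aeval_map_algebraMap ℂ, ← aeval_map_algebraMap ℂ (toEigenbasis hH H)]
    exact (aeval_algHom_apply ((toEigenbasis hH).toAlgEquiv : Matrix N N ℂ →ₐ[ℂ] Matrix N N ℂ) H _).symm
  rw [toEigenbasis_spectralProj, e1, toEigenbasis_self]
  have e2 := aeval_algHom_apply (diagonalAlgHom (n := N) (α := ℂ) ℝ)
    (fun i => (hH.eigenvalues i : ℂ)) p
  rw [diagonalAlgHom_apply, diagonalAlgHom_apply] at e2
  rw [e2, coordProj, aeval_pi_apply]
  congr 1
  funext i
  have e3 : aeval (hH.eigenvalues i : ℂ) p = ((p.eval (hH.eigenvalues i) : ℝ) : ℂ) := by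
    have := aeval_algebraMap_apply ℂ (hH.eigenvalues i) p
    simpa using this
  rw [e3, hp]
  split_ifs <;> simp

/-- The projection is a polynomial in H with real coefficients, which are respected even by
antilinear maps. -/
theorem algEquiv_spectralProj (R : Matrix N N ℂ ≃ₐ[ℝ] Matrix N N ℂ) (hR : R H = H) {J : Finset N}
    (hJ : ∀ i ∈ J, ∀ j ∉ J, hH.eigenvalues i ≠ hH.eigenvalues j) :
    R (spectralProj hH J) = spectralProj hH J := by
  obtain ⟨p, hp⟩ := exists_spectralProj_eq_aeval hH hJ
  have h := aeval_algHom_apply (R : Matrix N N ℂ →ₐ[ℝ] Matrix N N ℂ) H p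
  rw [hp]
  refine h.symm.trans ?_
  congr 1
  exact congrArg _ hR

end Automorphisms

/-! ### Almost orthogonal blocks -/

section Gram

open Matrix

/-- More vectors than the dimension cannot be nonzero and almost orthogonal. -/
theorem exists_norm_gram_le {ι κ : Type*} [Fintype ι] [DecidableEq ι] [Fintype κ]
    (hcard : Fintype.card κ < Fintype.card ι) (m : ι → κ → ℂ) {ε : ℝ} (hε : 0 ≤ ε)
    (h : ∀ i j, i ≠ j → ‖star (m i) ⬝ᵥ m j‖ ≤ ε) :
    ∃ i, ‖star (m i) ⬝ᵥ m i‖ ≤ Fintype.card ι * ε := by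
  have hdep : ¬ LinearIndependent ℂ m := fun hl => by
    have := hl.fintype_card_le_finrank
    rw [Module.finrank_fintype_fun_eq_card] at this
    omega
  obtain ⟨c, hc, i₀, hi₀⟩ := Fintype.not_linearIndependent_iff.1 hdep
  -- In a linear relation pick the vector with the largest coefficient; pairing the relation with it
  -- bounds its squared norm by the off-diagonal Gram entries.
  obtain ⟨i, -, hi⟩ := Finset.exists_max_image Finset.univ (fun i => ‖c i‖) ⟨i₀, Finset.mem_univ _⟩
  have hci : 0 < ‖c i‖ := (norm_pos_iff.2 hi₀).trans_le (hi i₀ (Finset.mem_univ _))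
  refine ⟨i, ?_⟩
  have h1 : ∑ j, c j * (star (m i) ⬝ᵥ m j) = 0 := by
    have := congrArg (fun x => star (m i) ⬝ᵥ x) hc
    simpa [dotProduct_sum, dotProduct_smul] using this
  rw [← Finset.add_sum_erase _ _ (Finset.mem_univ i)] at h1
  have h2 : ‖c i * (star (m i) ⬝ᵥ m i)‖ ≤ ‖c i‖ * (Fintype.card ι * ε) := by
    rw [eq_neg_of_add_eq_zero_left h1, norm_neg]
    calc _ ≤ ∑ j ∈ Finset.univ.erase i, ‖c i‖ * ε := by
          refine norm_sum_le_of_le _ fun j hj => ?_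
          rw [norm_mul]
          exact mul_le_mul (hi j (Finset.mem_univ _)) (h i j (Finset.ne_of_mem_erase hj).symm)
            (norm_nonneg _) (norm_nonneg _)
      _ ≤ ∑ j : ι, ‖c i‖ * ε :=
          Finset.sum_le_sum_of_subset_of_nonneg (Finset.erase_subset _ _)
            fun _ _ _ => by positivity
      _ = _ := by
          rw [Finset.sum_const, nsmul_eq_mul, Finset.card_univ]
          ring
  rw [norm_mul] at h2
  exact le_of_mul_le_mul_left h2 hci

variable {N : Type*} [Fintype N] [DecidableEq N]

theorem norm_sq_le_sum_norm_sq (M : Matrix N N ℂ) : ‖M‖ ^ 2 ≤ ∑ a, ∑ b, ‖M a b‖ ^ 2 := by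
  have hs : 0 ≤ ∑ a, ∑ b, ‖M a b‖ ^ 2 := by positivity
  have h : ‖M‖ ≤ √(∑ a, ∑ b, ‖M a b‖ ^ 2) := by
    rw [cstar_norm_def]
    refine ContinuousLinearMap.opNorm_le_bound _ (Real.sqrt_nonneg _) fun x => ?_
    rw [← Real.sqrt_sq (norm_nonneg x), ← Real.sqrt_mul hs, EuclideanSpace.norm_eq]
    refine Real.sqrt_le_sqrt ?_
    rw [Finset.sum_mul]
    refine Finset.sum_le_sum fun a _ => ?_
    rw [ofLp_toEuclideanCLM, EuclideanSpace.norm_sq_eq]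
    calc ‖(M *ᵥ x.ofLp) a‖ ^ 2 ≤ (∑ b, ‖M a b‖ * ‖x b‖) ^ 2 := by
          gcongr
          refine norm_sum_le_of_le _ fun b _ => ?_
          rw [norm_mul]
      _ ≤ _ := Finset.sum_mul_sq_le_sq_mul_sq _ _ _
  calc ‖M‖ ^ 2 ≤ √(∑ a, ∑ b, ‖M a b‖ ^ 2) ^ 2 := by gcongr
    _ = _ := Real.sq_sqrt hs

theorem sum_coe_prod_coe {N M : Type*} [Fintype N] [DecidableEq N] [AddCommMonoid M]
    (J : Finset N) (f : N → N → M) :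
    ∑ k : J × J, f k.1 k.2 = ∑ a, ∑ b, if a ∈ J ∧ b ∈ J then f a b else 0 := by
  rw [Fintype.sum_prod_type, Finset.sum_coe_sort J fun a => ∑ b : J, f a b]
  simp only [ite_and]
  rw [← Finset.sum_filter_add_sum_filter_not Finset.univ (· ∈ J)
    (fun a => ∑ b, if a ∈ J then if b ∈ J then f a b else 0 else 0)]
  rw [Finset.sum_eq_zero (s := Finset.univ.filter fun a => a ∉ J), add_zero]
  · refine Finset.sum_congr (by simp) fun a ha => ?_
    have haJ : a ∈ J := by simpa using ha
    simp only [haJ, if_true]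
    rw [Finset.sum_coe_sort J fun b => f a b, Finset.sum_ite_mem, Finset.univ_inter]
  · intro a ha
    simp [(Finset.mem_filter.1 ha).2]

theorem trace_conjTranspose_coordProj (J : Finset N) (C D : Matrix N N ℂ) :
    (Cᴴ * coordProj J * D * coordProj J).trace =
      star (fun k : J × J => C k.1 k.2) ⬝ᵥ fun k : J × J => D k.1 k.2 := by
  have h : ∀ b, (Cᴴ * coordProj J * D * coordProj J) b b =
      ∑ a, if a ∈ J ∧ b ∈ J then star (C a b) * D a b else 0 := by
    intro b
    rw [coordProj, mul_diagonal, mul_apply]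
    simp only [mul_diagonal, conjTranspose_apply, Finset.sum_mul]
    refine Finset.sum_congr rfl fun a _ => ?_
    by_cases ha : a ∈ J <;> by_cases hb : b ∈ J <;> simp [ha, hb]
  simp only [trace, diag_apply, h]
  rw [Finset.sum_comm]
  exact (sum_coe_prod_coe J fun a b => star (C a b) * D a b).symm

/-- The traces are the Hilbert–Schmidt products of the J × J blocks, which live in dimension |J|²,
so the Gram lemma applies. The Hilbert–Schmidt norm dominates the operator norm. -/
theorem exists_norm_coordProj_sq_le {ι : Type*} [Fintype ι] [DecidableEq ι] {J : Finset N}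
    (hcard : J.card ^ 2 < Fintype.card ι) (C : ι → Matrix N N ℂ) {ε : ℝ} (hε : 0 ≤ ε)
    (h : ∀ i j, i ≠ j → ‖((C i)ᴴ * coordProj J * C j * coordProj J).trace‖ ≤ ε) :
    ∃ i, ‖coordProj J * C i * coordProj J‖ ^ 2 ≤ Fintype.card ι * ε := by
  obtain ⟨i, hi⟩ := exists_norm_gram_le (κ := J × J)
    (by rwa [Fintype.card_prod, Fintype.card_coe, ← sq]) (fun i k => C i k.1 k.2) hε
    (fun i j hij => by rw [← trace_conjTranspose_coordProj]; exact h i j hij)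
  refine ⟨i, (norm_sq_le_sum_norm_sq _).trans (le_trans (le_of_eq ?_) hi)⟩
  have e : star (fun k : J × J => C i k.1 k.2) ⬝ᵥ (fun k : J × J => C i k.1 k.2)
      = ((∑ a : J, ∑ b : J, ‖C i a b‖ ^ 2 : ℝ) : ℂ) := by
    simp only [dotProduct, Pi.star_apply, Fintype.sum_prod_type, Complex.ofReal_sum]
    refine Finset.sum_congr rfl fun a _ => Finset.sum_congr rfl fun b _ => ?_
    rw [Complex.star_def, Complex.conj_mul']
    push_cast
    rfl
  rw [e, Complex.norm_real, Real.norm_of_nonneg (by positivity)]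
  rw [← Fintype.sum_prod_type' (f := fun a b : J => ‖C i a b‖ ^ 2),
    sum_coe_prod_coe J fun a b => ‖C i a b‖ ^ 2]
  refine Finset.sum_congr rfl fun a _ => Finset.sum_congr rfl fun b _ => ?_
  rw [coordProj, mul_diagonal, diagonal_mul]
  by_cases ha : a ∈ J <;> by_cases hb : b ∈ J <;> simp [ha, hb]

end Gram

/-! ### Traces and expectations in the ground state sector -/

section SpectralProj

open Matrix

theorem coordProj_conjTranspose {N : Type*} [DecidableEq N] (J : Finset N) : (coordProj J)ᴴ = coordProj J := by
  rw [coordProj, diagonal_conjTranspose]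
  congr 1
  funext i
  simp only [Pi.star_apply]
  split_ifs <;> simp

variable {N : Type*} [Fintype N] [DecidableEq N] {H : Matrix N N ℂ} (hH : H.IsHermitian)

theorem spectralProj_conjTranspose (J : Finset N) : (spectralProj hH J)ᴴ = spectralProj hH J := by
  apply EquivLike.injective (toEigenbasis hH)
  rw [← star_eq_conjTranspose, map_star, toEigenbasis_spectralProj, star_eq_conjTranspose,
    coordProj_conjTranspose]

theorem trace_toEigenbasis (M : Matrix N N ℂ) : (toEigenbasis hH M).trace = M.trace := by
  rw [toEigenbasis_apply, mul_assoc, trace_mul_comm, mul_assoc,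
    eigenvectorUnitary_mul_conjTranspose, mul_one]

theorem star_eigenvector_dotProduct (i j : N) :
    star (hH.eigenvectorBasis i).ofLp ⬝ᵥ (hH.eigenvectorBasis j).ofLp = if i = j then 1 else 0 := by
  have := orthonormal_iff_ite.1 hH.eigenvectorBasis.orthonormal i j
  rwa [EuclideanSpace.inner_eq_star_dotProduct, dotProduct_comm] at this

theorem spectralProj_mulVec_eigenvector {J : Finset N} {i : N} (hi : i ∈ J) :
    spectralProj hH J *ᵥ (hH.eigenvectorBasis i).ofLp = (hH.eigenvectorBasis i).ofLp := by
  rw [spectralProj, sum_mulVec, Finset.sum_eq_single i]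
  · rw [vecMulVec_mulVec, star_eigenvector_dotProduct, if_pos rfl]
    simp
  · intro j _ hj
    rw [vecMulVec_mulVec, star_eigenvector_dotProduct, if_neg hj]
    simp
  · exact fun h => absurd hi h

theorem trace_mul_spectralProj (M : Matrix N N ℂ) (J : Finset N) :
    (M * spectralProj hH J).trace = ∑ i ∈ J,
      star (hH.eigenvectorBasis i).ofLp ⬝ᵥ M *ᵥ (hH.eigenvectorBasis i).ofLp := by
  rw [spectralProj, Finset.mul_sum, trace_sum]
  refine Finset.sum_congr rfl fun i _ => ?_
  rw [mul_vecMulVec, trace_vecMulVec, dotProduct_comm]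

theorem norm_trace_mul_spectralProj_le {M : Matrix N N ℂ} {J : Finset N} {κ : ℝ}
    (h : ∀ Φ : N → ℂ, star Φ ⬝ᵥ Φ = 1 → spectralProj hH J *ᵥ Φ = Φ → ‖star Φ ⬝ᵥ M *ᵥ Φ‖ ≤ κ) :
    ‖(M * spectralProj hH J).trace‖ ≤ J.card * κ := by
  rw [trace_mul_spectralProj, ← nsmul_eq_mul]
  refine norm_sum_le_of_le J (n := fun _ => κ) (fun i hi => h _ ?_ ?_) |>.trans (by simp)
  · rw [star_eigenvector_dotProduct, if_pos rfl]
  · exact spectralProj_mulVec_eigenvector hH hi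

/-- The block traces of a commuting pair, in terms of the expectation of the product. -/
theorem norm_trace_block_le {X Y : Matrix N N ℂ} (hXY : Commute X Y) {J : Finset N} {κ : ℝ}
    (h : ∀ Φ : N → ℂ, star Φ ⬝ᵥ Φ = 1 → spectralProj hH J *ᵥ Φ = Φ →
      ‖star Φ ⬝ᵥ (X * Y + Y * X - X * spectralProj hH J * Y - Y * spectralProj hH J * X) *ᵥ Φ‖ ≤ κ) :
    ‖(X * spectralProj hH J * Y * spectralProj hH J).trace‖
      ≤ ‖(X * Y * spectralProj hH J).trace‖ + J.card * κ / 2 := by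
  have h1 := norm_trace_mul_spectralProj_le hH h
  set P := spectralProj hH J
  have h2 : (Y * P * X * P).trace = (X * P * Y * P).trace := by
    rw [mul_assoc (Y * P), trace_mul_comm, mul_assoc (X * P)]
  have h3 : ((X * Y + Y * X - X * P * Y - Y * P * X) * P).trace =
      2 * (X * Y * P).trace - 2 * (X * P * Y * P).trace := by
    rw [← hXY.eq, sub_mul, sub_mul, add_mul, trace_sub, trace_sub, trace_add, h2]
    ring
  rw [h3] at h1
  have h4 : 2 * (X * P * Y * P).trace = 2 * (X * Y * P).trace -
      (2 * (X * Y * P).trace - 2 * (X * P * Y * P).trace) := by ring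
  have h5 : 2 * ‖(X * P * Y * P).trace‖ ≤ 2 * ‖(X * Y * P).trace‖ + J.card * κ := by
    have := congrArg norm h4
    rw [norm_mul, Complex.norm_ofNat] at this
    rw [this]
    refine (norm_sub_le _ _).trans (add_le_add (le_of_eq ?_) h1)
    rw [norm_mul, Complex.norm_ofNat]
  linarith

theorem exists_norm_spectralProj_sq_le {ι : Type*} [Fintype ι] [DecidableEq ι] {J : Finset N}
    (hcard : J.card ^ 2 < Fintype.card ι) (C : ι → Matrix N N ℂ) {ε : ℝ} (hε : 0 ≤ ε)
    (h : ∀ i j, i ≠ j →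
      ‖((C i)ᴴ * spectralProj hH J * C j * spectralProj hH J).trace‖ ≤ ε) :
    ∃ i, ‖spectralProj hH J * C i * spectralProj hH J‖ ^ 2 ≤ Fintype.card ι * ε := by
  obtain ⟨i, hi⟩ := exists_norm_coordProj_sq_le hcard (fun i => toEigenbasis hH (C i)) hε
    fun i j hij => by
      have := h i j hij
      rwa [← trace_toEigenbasis hH, map_mul, map_mul, map_mul, toEigenbasis_spectralProj,
        ← star_eq_conjTranspose, map_star] at this
  refine ⟨i, ?_⟩
  rwa [← toEigenbasis_spectralProj hH, ← map_mul, ← map_mul, norm_toEigenbasis] at hi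

/-- A sector vector absorbs a further projection on the left, so only the block PAP enters. -/
theorem norm_expectation_mul_proj_mul_le {J : Finset N} {Φ : N → ℂ} (hΦ : star Φ ⬝ᵥ Φ = 1)
    (hP : spectralProj hH J *ᵥ Φ = Φ) (A B : Matrix N N ℂ) :
    ‖star Φ ⬝ᵥ (A * spectralProj hH J * B) *ᵥ Φ‖
      ≤ ‖spectralProj hH J * A * spectralProj hH J‖ * ‖B‖ := by
  have h1 : star Φ ⬝ᵥ (A * spectralProj hH J * B) *ᵥ Φ =
      star Φ ⬝ᵥ (spectralProj hH J * A * spectralProj hH J * B) *ᵥ Φ := by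
    have h2 : star Φ ᵥ* spectralProj hH J = star Φ := by
      have := congrArg star hP
      rwa [star_mulVec, spectralProj_conjTranspose] at this
    rw [mul_assoc (spectralProj hH J), mul_assoc (spectralProj hH J),
      ← mulVec_mulVec Φ (spectralProj hH J), dotProduct_mulVec _ (spectralProj hH J), h2]
  rw [h1]
  exact (norm_star_dotProduct_mulVec_le _ (norm_toLp_eq_one hΦ)).trans (norm_mul_le _ _)

end SpectralProj

theorem FarApart.mono {S : Type*} {G : SimpleGraph S} {r r' : ℕ} (hr : r ≤ r') {X Y : Finset S}
    (h : FarApart G r' X Y) : FarApart G r X Y :=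
  fun x hx y hy => hr.trans (h x hx y hy)

theorem FarApart.symm {S : Type*} {G : SimpleGraph S} {r : ℕ} {X Y : Finset S}
    (h : FarApart G r X Y) : FarApart G r Y X :=
  fun y hy x hx => by rw [SimpleGraph.dist_comm]; exact h x hx y hy

theorem FarApart.disjoint {S : Type*} {G : SimpleGraph S} {r : ℕ} (hr : 0 < r) {X Y : Finset S}
    (h : FarApart G r X Y) : Disjoint X Y :=
  Finset.disjoint_left.2 fun x hx hx' => by
    have := h x hx x hx'
    rw [SimpleGraph.dist_self] at this
    omega

/-! ### Vanishing of the sector block, and decay of the correlations -/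

namespace LatticeSystem

open SiteSpaces Matrix

variable {S : Type*} [LinearOrder S] (Q : LatticeSystem S)

/-- A transformation, as an automorphism of the real algebra of a finite volume. -/
def Transformation.realEquiv {Q : LatticeSystem S} (R : Q.Transformation) (n : ℕ) :
    Q.K.Op (Q.sites n) ≃ₐ[ℝ] Q.K.Op (Q.sites n) :=
  realAlgEquiv (R.toFun n) (R.smul n)

theorem Transformation.realEquiv_apply {Q : LatticeSystem S} (R : Q.Transformation) (n : ℕ)
    (M : Q.K.Op (Q.sites n)) : R.realEquiv n M = R.toFun n M := rfl

theorem Transformation.Maps.norm_op {Q : LatticeSystem S} {R : Q.Transformation}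
    {A B : Q.K.LocalObs} (h : R.Maps A B) (h' : R.Maps A.adj B.adj) : ‖B.op‖ = ‖A.op‖ := by
  obtain ⟨n, hn, hn', hA, hB⟩ := (h.and (h'.and
    ((Q.eventually_subset A.supp).and (Q.eventually_subset B.supp)))).exists
  rw [← LocalObs.norm_toOp hA, ← LocalObs.norm_toOp hB, ← hn, ← R.realEquiv_apply]
  refine norm_algEquiv_apply _ ?_
  rw [R.realEquiv_apply, R.realEquiv_apply, ← LocalObs.adj_toOp, hn', hn, LocalObs.adj_toOp]

/-- R fixes H and hence P, so it carries PAP to PBP. It is compatible with the adjoint at PAP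
because it is at A. -/
theorem Transformation.Maps.eventually_norm_block {Q : LatticeSystem S} {R : Q.Transformation}
    {A B : Q.K.LocalObs} (h : R.Maps A B) (h' : R.Maps A.adj B.adj)
    (hH : ∀ᶠ n in atTop, R.toFun n (Q.H n) = Q.H n)
    {q : ℕ} {ΔE : ℝ} {I : ∀ n, Finset (Q.K.Config (Q.sites n))} (hI : Q.UniformGap q ΔE I) :
    ∀ᶠ n in atTop, ‖Q.sectorProj n (I n) * B.toOp (Q.sites n) * Q.sectorProj n (I n)‖ =
      ‖Q.sectorProj n (I n) * A.toOp (Q.sites n) * Q.sectorProj n (I n)‖ := by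
  filter_upwards [h, h', hH, hI.gap] with n hn hn' hHn hgap
  have hP : R.realEquiv n (Q.sectorProj n (I n)) = Q.sectorProj n (I n) :=
    algEquiv_spectralProj (Q.H_hermitian n) _ hHn fun i hi j hj => by
      have := hgap i hi j hj
      have := hI.gap_pos
      linarith
  have e : ∀ M, R.realEquiv n (Q.sectorProj n (I n) * M * Q.sectorProj n (I n)) =
      Q.sectorProj n (I n) * R.realEquiv n M * Q.sectorProj n (I n) := fun M => by
    rw [map_mul, map_mul, hP]
  have hPs : (Q.sectorProj n (I n))ᴴ = Q.sectorProj n (I n) := spectralProj_conjTranspose _ _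
  have hnB : R.realEquiv n (A.toOp (Q.sites n)) = B.toOp (Q.sites n) := hn
  have hnB' : R.realEquiv n (A.toOp (Q.sites n))ᴴ = (B.toOp (Q.sites n))ᴴ := by
    rw [← LocalObs.adj_toOp, ← LocalObs.adj_toOp]
    exact hn'
  rw [← hnB, ← e]
  refine norm_algEquiv_apply _ ?_
  rw [conjTranspose_mul, conjTranspose_mul, hPs, ← mul_assoc, e, e, hnB, hnB', conjTranspose_mul,
    conjTranspose_mul, hPs, ← mul_assoc]

/-- A and its q² copies are one more than the dimension of the space of blocks. Their blocks are
almost orthogonal and of equal norm, hence all small. -/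
theorem eventually_norm_block_le {D : DecayLaw} (hD : D.Pos) {v : ℝ} (hv : Q.IsVelocityBound D v)
    {q : ℕ} {ΔE : ℝ} {I : ∀ n, Finset (Q.K.Config (Q.sites n))} (hI : Q.UniformGap q ΔE I)
    {T : Set Q.Transformation} {𝒜 : Set Q.K.LocalObs} {ρ : Q.K.LocalObs → ℂ}
    (hself : Q.SelfSimilar q T) (hcl : Q.IsBosonicClass T 𝒜) (hρ : Q.IsSectorExpectation q I ρ)
    (hvan : Q.CorrelationsVanish ρ 𝒜) {A : Q.K.LocalObs} (hA : A ∈ 𝒜) {ε : ℝ} (hε : 0 < ε) :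
    ∀ᶠ n in atTop,
      ‖Q.sectorProj n (I n) * A.toOp (Q.sites n) * Q.sectorProj n (I n)‖ ≤ ε := by
  obtain ⟨C, hC, hclust⟩ := Q.exists_clustering_const hD hv hI
  obtain ⟨k, hk⟩ := hself A
  have hq : (0 : ℝ) < q := by exact_mod_cast hI.q_pos
  set K : ℕ := max (max k A.supp.card) ⌈‖A.op‖⌉₊ with hK
  have hkK : k ≤ K := (le_max_left _ _).trans (le_max_left _ _)
  have hAK : A.supp.card ≤ K := (le_max_right _ _).trans (le_max_left _ _)
  have hnK : ‖A.op‖ ≤ K := (Nat.le_ceil _).trans (by exact_mod_cast le_max_right _ _)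
  -- The Gram lemma multiplies the off-diagonal bound by the number q² + 1 of operators, which
  -- returns ε². One half of η is spent on the sector correlations and one half on clustering.
  set η : ℝ := ε ^ 2 / (q ^ 2 + 1) with hη
  have hη0 : 0 < η := by positivity
  obtain ⟨r₀, hr₀⟩ := hvan K (η / (4 * q)) (by positivity)
  -- The bound K on supports and norms is fixed before L: the copies have at most k sites whatever L
  -- is, and they have the norm of A. So r₀ and the clustering bound hold for all copies at once.
  obtain ⟨L, hL1, hLr, hLg⟩ : ∃ L : ℕ, 0 < L ∧ r₀ ≤ L ∧
      C * ((K : ℝ) * K * ((K : ℝ) * K + 1) * (D.tilde v ΔE).profile L) ≤ η / (2 * q) := by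
    have h0 := ((hD.tilde hv.1 hI.gap_pos).tendsto_profile.const_mul
      ((K : ℝ) * K * ((K : ℝ) * K + 1))).const_mul C
    rw [mul_zero, mul_zero] at h0
    obtain ⟨L, h1, h2, h3⟩ := ((eventually_gt_atTop 0).and ((eventually_ge_atTop r₀).and
      (h0.eventually_le_const (show 0 < η / (2 * q) by positivity)))).exists
    exact ⟨L, h1, h2, h3⟩
  obtain ⟨R, B, hRB, hBB⟩ := hk L
  let W : Option (Fin (q ^ 2)) → Q.K.LocalObs := fun i => i.elim A B
  have hW𝒜 : ∀ i, W i ∈ 𝒜 := by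
    rintro (_ | j)
    · exact hA
    · exact hcl.maps (R j) (hRB j).1 A hA (B j) (hRB j).2.2.1
  have hWcard : ∀ i, (W i).supp.card ≤ K := by
    rintro (_ | j)
    · exact hAK
    · exact (hRB j).2.2.2.2.1.trans hkK
  have hWnorm : ∀ i, ‖(W i).op‖ ≤ K := by
    rintro (_ | j)
    · exact hnK
    · exact ((hRB j).2.2.1.norm_op (hRB j).2.2.2.1).trans_le hnK
  have hWfar : ∀ i j, i ≠ j → FarApart Q.G L (W i).supp (W j).supp := by
    rintro (_ | i) (_ | j) hij
    · exact absurd rfl hij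
    · exact (hRB j).2.2.2.2.2
    · exact (hRB i).2.2.2.2.2.symm
    · exact hBB i j fun h => hij (congrArg some h)
  have hWblock : ∀ i, ∀ᶠ n in atTop,
      ‖Q.sectorProj n (I n) * (W i).toOp (Q.sites n) * Q.sectorProj n (I n)‖ =
      ‖Q.sectorProj n (I n) * A.toOp (Q.sites n) * Q.sectorProj n (I n)‖ := by
    rintro (_ | j)
    · exact Eventually.of_forall fun _ => rfl
    · exact (hRB j).2.2.1.eventually_norm_block (hRB j).2.2.2.1 (hRB j).2.1 hI
  have hgram : ∀ i j, i ≠ j → ∀ᶠ n in atTop,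
      ‖(((W i).toOp (Q.sites n))ᴴ * Q.sectorProj n (I n) * (W j).toOp (Q.sites n) *
        Q.sectorProj n (I n)).trace‖ ≤ η := by
    intro i j hij
    have hfar : FarApart Q.G L (W i).adj.supp (W j).supp := hWfar i j hij
    have hadj := hcl.adj _ (hW𝒜 i)
    have hbos := hcl.bosonic _ hadj _ (hW𝒜 j)
    have hnadj : ‖(W i).adj.op‖ ≤ K := (LocalObs.norm_adj_op _).trans_le (hWnorm i)
    have hcorr := hr₀ _ hadj _ (hW𝒜 j) (hWcard i) (hWcard j) hnadj (hWnorm j) (hfar.mono hLr)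
    have hlim := (hρ ((W i).adj.mul (W j))).norm.eventually_le_const
      (lt_of_le_of_lt hcorr (show η / (4 * q) < η / (2 * q) by gcongr; norm_num))
    filter_upwards [hclust _ _ hbos L hL1 hfar (η / (2 * q)) (by positivity), hlim, hI.card_eq,
      Q.eventually_subset (W i).adj.supp, Q.eventually_subset (W j).supp] with n h1 h2 hcard hi hj
    rw [LocalObs.mul_toOp hi hj, norm_mul, norm_div, norm_one, Complex.norm_natCast] at h2
    have h3 := norm_trace_block_le (Q.H_hermitian n)
      (hbos.commute_toOp (hfar.disjoint hL1) hi hj) h1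
    rw [hcard] at h3
    rw [LocalObs.adj_toOp] at h2 h3
    have h4 : ‖(W i).adj.op‖ * ‖(W j).op‖ * (((W i).adj.supp.card : ℝ) * (W j).supp.card + 1) *
        (D.tilde v ΔE).profile L ≤ (K : ℝ) * K * ((K : ℝ) * K + 1) * (D.tilde v ΔE).profile L := by
      have c1 : ((W i).adj.supp.card : ℝ) ≤ K := by exact_mod_cast hWcard i
      have c2 : ((W j).supp.card : ℝ) ≤ K := by exact_mod_cast hWcard j
      have := (DecayLaw.profile_pos (D.tilde v ΔE) L).le
      have := hWnorm j
      gcongr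
    have h5 := mul_le_mul_of_nonneg_left h4 hC.le
    refine h3.trans ?_
    have h6 : (q : ℝ) * (C * (‖(W i).adj.op‖ * ‖(W j).op‖ *
        (((W i).adj.supp.card : ℝ) * (W j).supp.card + 1) * (D.tilde v ΔE).profile L) +
        η / (2 * q)) / 2 ≤ q * (η / (2 * q) + η / (2 * q)) / 2 := by
      gcongr
      exact h5.trans hLg
    have h7 : (q : ℝ) * (η / (2 * q) + η / (2 * q)) / 2 = η / 2 := by
      field_simp
      norm_num
    have h8 : ‖(((W i).toOp (Q.sites n))ᴴ * (W j).toOp (Q.sites n) *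
        Q.sectorProj n (I n)).trace‖ ≤ η / 2 := by
      have := mul_le_mul_of_nonneg_left h2 hq.le
      rw [← mul_assoc, mul_one_div_cancel hq.ne', one_mul] at this
      refine this.trans (le_of_eq ?_)
      field_simp
    rw [sectorProj_eq] at h8
    linarith
  have hgram' : ∀ᶠ n in atTop, ∀ i j, i ≠ j →
      ‖(((W i).toOp (Q.sites n))ᴴ * Q.sectorProj n (I n) * (W j).toOp (Q.sites n) *
        Q.sectorProj n (I n)).trace‖ ≤ η :=
    eventually_all.2 fun i => eventually_all.2 fun j => by
      by_cases hij : i = j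
      · exact Eventually.of_forall fun _ h => absurd hij h
      · exact (hgram i j hij).mono fun _ h _ => h
  filter_upwards [hgram', eventually_all.2 hWblock, hI.card_eq] with n h1 h2 hcard
  obtain ⟨i, hi⟩ := exists_norm_spectralProj_sq_le (Q.H_hermitian n) (J := I n)
    (ι := Option (Fin (q ^ 2))) (by simp [hcard]) (fun i => (W i).toOp (Q.sites n)) hη0.le h1
  have h3 := h2 i
  rw [sectorProj_eq] at h3 ⊢
  rw [h3] at hi
  have h4 : (Fintype.card (Option (Fin (q ^ 2))) : ℝ) * η = ε ^ 2 := by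
    rw [hη]
    simp only [Fintype.card_option, Fintype.card_fin]
    push_cast
    field_simp
  rw [h4] at hi
  exact (pow_le_pow_iff_left₀ (norm_nonneg _) hε.le two_ne_zero).1 hi

/-- Decay of the correlations in a ground state, with a constant that depends only on the lattice
system. -/
theorem exists_decay_const {D : DecayLaw} (hD : D.Pos) {v : ℝ} (hv : Q.IsVelocityBound D v)
    {q : ℕ} {ΔE : ℝ} {I : ∀ n, Finset (Q.K.Config (Q.sites n))} (hI : Q.UniformGap q ΔE I) :
    ∃ C : ℝ, 0 < C ∧
      ∀ (T : Set Q.Transformation) (𝒜 : Set Q.K.LocalObs) (ρ ω : Q.K.LocalObs → ℂ),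
        Q.SelfSimilar q T → Q.IsBosonicClass T 𝒜 →
        Q.IsSectorExpectation q I ρ → Q.CorrelationsVanish ρ 𝒜 →
        Q.IsGroundStateExpectation I ω →
        ∀ A ∈ 𝒜, ∀ B : Q.K.LocalObs, A.BosonicPair B →
        ∀ r : ℕ, 0 < r → FarApart Q.G r A.supp B.supp →
          ‖ω (A.mul B)‖ ≤ C * (‖A.op‖ * ‖B.op‖ * ((A.supp.card : ℝ) * B.supp.card + 1)
            * (D.tilde v ΔE).profile r) := by
  obtain ⟨C, hC, hclust⟩ := Q.exists_clustering_const hD hv hI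
  refine ⟨C, hC, ?_⟩
  intro T 𝒜 ρ ω hself hcl hρ hvan ⟨Φ, hΦ, hω⟩ A hA B hAB r hr hfar
  refine le_of_forall_pos_le_add fun ε hε => ?_
  refine le_of_tendsto (hω (A.mul B)).norm ?_
  filter_upwards [hclust A B hAB r hr hfar (ε / 2) (by positivity), hΦ,
    Q.eventually_norm_block_le hD hv hI hself hcl hρ hvan hA
      (show 0 < ε / (4 * (‖B.op‖ + 1)) by positivity),
    Q.eventually_subset A.supp, Q.eventually_subset B.supp] with n h1 hΦn hblock hAn hBn
  have h2 := h1 (Φ n) hΦn.1 hΦn.2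
  rw [sectorProj_eq] at h2 hΦn hblock
  have hcomm := hAB.commute_toOp (hfar.disjoint hr) hAn hBn
  rw [LocalObs.mul_toOp hAn hBn]
  set a := A.toOp (Q.sites n)
  set b := B.toOp (Q.sites n)
  set P := spectralProj (Q.H_hermitian n) (I n) with hPdef
  have hbn : ‖b‖ ≤ ‖B.op‖ := LocalObs.norm_toOp_le B _
  have hsmall : ‖P * a * P‖ * ‖b‖ ≤ ε / 4 := by
    have : ε / (4 * (‖B.op‖ + 1)) * ‖B.op‖ ≤ ε / 4 := by
      rw [div_mul_eq_mul_div, div_le_div_iff₀ (by positivity) (by positivity)]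
      nlinarith [norm_nonneg B.op]
    exact (mul_le_mul hblock hbn (norm_nonneg _) (by positivity)).trans this
  have h3 : ‖star (Φ n) ⬝ᵥ (a * P * b) *ᵥ Φ n‖ ≤ ε / 4 :=
    (norm_expectation_mul_proj_mul_le (Q.H_hermitian n) hΦn.1 hΦn.2 a b).trans hsmall
  -- Taking adjoints turns BPA into A†PB†, whose block is the adjoint of PAP. So only the block of A
  -- has to be small, and B may lie outside the class.
  have h4 : ‖star (Φ n) ⬝ᵥ (b * P * a) *ᵥ Φ n‖ ≤ ε / 4 := by
    have h5 := norm_expectation_mul_proj_mul_le (Q.H_hermitian n) hΦn.1 hΦn.2 aᴴ bᴴ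
    have hPs : Pᴴ = P := spectralProj_conjTranspose _ _
    have h6 : (b * P * a)ᴴ = aᴴ * P * bᴴ := by
      rw [conjTranspose_mul, conjTranspose_mul, hPs, mul_assoc]
    have h7 : P * aᴴ * P = (P * a * P)ᴴ := by
      rw [conjTranspose_mul, conjTranspose_mul, hPs, mul_assoc]
    rw [← norm_star, star_star_dotProduct_mulVec, h6]
    rw [← hPdef, h7, l2_opNorm_conjTranspose, l2_opNorm_conjTranspose] at h5
    exact h5.trans hsmall
  have h8 : 2 * (star (Φ n) ⬝ᵥ (a * b) *ᵥ Φ n) =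
      star (Φ n) ⬝ᵥ (a * b + b * a - a * P * b - b * P * a) *ᵥ Φ n +
      star (Φ n) ⬝ᵥ (a * P * b) *ᵥ Φ n + star (Φ n) ⬝ᵥ (b * P * a) *ᵥ Φ n := by
    rw [← hcomm.eq]
    simp only [sub_mulVec, add_mulVec, dotProduct_sub, dotProduct_add]
    ring
  have h9 := congrArg norm h8
  rw [norm_mul, Complex.norm_ofNat] at h9
  have h10 := (norm_add₃_le).trans (add_le_add (add_le_add h2 h3) h4)
  rw [← h9] at h10
  have h11 : 0 ≤ C * (‖A.op‖ * ‖B.op‖ * ((A.supp.card : ℝ) * B.supp.card + 1)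
            * (D.tilde v ΔE).profile r) := by
    have := (DecayLaw.profile_pos (D.tilde v ΔE) r).le
    positivity
  linarith

theorem IsGroundStateExpectation.norm_apply_mul_le {Q : LatticeSystem S}
    {I : ∀ n, Finset (Q.K.Config (Q.sites n))} {ω : Q.K.LocalObs → ℂ}
    (hω : Q.IsGroundStateExpectation I ω) (A B : Q.K.LocalObs) :
    ‖ω (A.mul B)‖ ≤ ‖A.op‖ * ‖B.op‖ := by
  obtain ⟨Φ, hΦ, hlim⟩ := hω
  refine le_of_tendsto (hlim (A.mul B)).norm ?_
  filter_upwards [hΦ, Q.eventually_subset A.supp, Q.eventually_subset B.supp] with n hn hA hB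
  rw [LocalObs.mul_toOp hA hB]
  refine (norm_star_dotProduct_mulVec_le _ (norm_toLp_eq_one hn.1)).trans ((norm_mul_le _ _).trans ?_)
  exact mul_le_mul (LocalObs.norm_toOp_le A _) (LocalObs.norm_toOp_le B _) (norm_nonneg _)
    (norm_nonneg _)

end LatticeSystem

end

/-! ### Conclusion: from |X||Y| + 1 to |X||Y| -/

theorem mainTheorem1 {S : Type*} [LinearOrder S] [Infinite S] (Q : LatticeSystem S)
    (D : DecayLaw) (v₀ : ℝ) (hint : Q.InteractionDecay D v₀) :
    Q.IsVelocityBound D v₀ ∧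
    ∀ v : ℝ, Q.IsVelocityBound D v →
    ∀ (q : ℕ) (ΔE : ℝ) (I : ∀ n, Finset (Q.K.Config (Q.sites n))), Q.UniformGap q ΔE I →
    ∃ C : ℝ, 0 < C ∧
      ∀ (T : Set Q.Transformation) (𝒜 : Set Q.K.LocalObs) (ρ ω : Q.K.LocalObs → ℂ),
        Q.SelfSimilar q T → Q.IsBosonicClass T 𝒜 →
        Q.IsSectorExpectation q I ρ → Q.CorrelationsVanish ρ 𝒜 →
        Q.IsGroundStateExpectation I ω →
        ∀ A ∈ 𝒜, ∀ B : Q.K.LocalObs, A.BosonicPair B →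
        ∀ r : ℕ, FarApart Q.G r A.supp B.supp →
          ‖ω (A.mul B)‖ ≤ C * ‖A.op‖ * ‖B.op‖ * (A.supp.card : ℝ) * (B.supp.card : ℝ)
            * (D.tilde v ΔE).profile r := by
  refine ⟨LatticeSystem.InteractionDecay.isVelocityBound Q hint, ?_⟩
  intro v hv q ΔE I hI
  have hD : D.Pos := LatticeSystem.InteractionDecay.pos Q hint
  obtain ⟨C, hC, h⟩ := Q.exists_decay_const hD hv hI
  -- For nonempty supports |X||Y| + 1 ≤ 2|X||Y|, which accounts for 2C. The added 1 covers r = 0,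
  -- where the profile is 1 and the trivial bound ‖A‖‖B‖ is used.
  refine ⟨2 * C + 1, by positivity, ?_⟩
  intro T 𝒜 ρ ω hself hcl hρ hvan hω A hA B hAB r hfar
  have hg := (D.tilde v ΔE).profile_pos
  by_cases hcard : A.supp.card * B.supp.card = 0
  · -- one of the supports is empty, and the distance is infinite
    have hfar' : ∀ r, FarApart Q.G r A.supp B.supp := by
      intro r x hx y hy
      rcases Nat.mul_eq_zero.1 hcard with h0 | h0
      · rw [Finset.card_eq_zero.1 h0] at hx
        exact absurd hx (Finset.notMem_empty x)
      · rw [Finset.card_eq_zero.1 h0] at hy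
        exact absurd hy (Finset.notMem_empty y)
    -- With an empty support the right-hand side is 0. The estimate then holds for every r, and r →
    -- ∞ gives ω(AB) = 0.
    have hlim := ((hD.tilde hv.1 hI.gap_pos).tendsto_profile.const_mul
      (‖A.op‖ * ‖B.op‖ * ((A.supp.card : ℝ) * B.supp.card + 1))).const_mul C
    rw [mul_zero, mul_zero] at hlim
    have h0 : ‖ω (A.mul B)‖ ≤ 0 := ge_of_tendsto hlim <| by
      filter_upwards [eventually_gt_atTop 0] with r hr
      exact h T 𝒜 ρ ω hself hcl hρ hvan hω A hA B hAB r hr (hfar' r)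
    refine h0.trans ?_
    have := (hg r).le
    positivity
  · have hc : (1 : ℝ) ≤ (A.supp.card : ℝ) * B.supp.card := by
      exact_mod_cast Nat.one_le_iff_ne_zero.2 hcard
    rcases Nat.eq_zero_or_pos r with rfl | hr
    · rw [DecayLaw.profile_zero, mul_one]
      refine (hω.norm_apply_mul_le A B).trans ?_
      calc ‖A.op‖ * ‖B.op‖ = 1 * (‖A.op‖ * ‖B.op‖) * 1 := by ring
        _ ≤ (2 * C + 1) * (‖A.op‖ * ‖B.op‖) * ((A.supp.card : ℝ) * B.supp.card) := by
            gcongr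
            linarith
        _ = _ := by ring
    · refine (h T 𝒜 ρ ω hself hcl hρ hvan hω A hA B hAB r hr hfar).trans ?_
      have := (hg r).le
      calc C * (‖A.op‖ * ‖B.op‖ * ((A.supp.card : ℝ) * B.supp.card + 1)
            * (D.tilde v ΔE).profile r)
          ≤ C * (‖A.op‖ * ‖B.op‖ * ((A.supp.card : ℝ) * B.supp.card +
            (A.supp.card : ℝ) * B.supp.card) * (D.tilde v ΔE).profile r) := by gcongr
        _ = 2 * C * (‖A.op‖ * ‖B.op‖ * ((A.supp.card : ℝ) * B.supp.card)
            * (D.tilde v ΔE).profile r) := by ring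
        _ ≤ (2 * C + 1) * (‖A.op‖ * ‖B.op‖ * ((A.supp.card : ℝ) * B.supp.card)
            * (D.tilde v ΔE).profile r) := by
            gcongr
            linarith
        _ = _ := by ring
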